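/- Let $n\ge 1$ and $\nu>n$. Let $dz$ be Lebesgue measure on the unit ball $\mathbb B^n\subset\mathbb C^n$ normalized to mass $1$, $c_\nu=\frac{\Gamma(\nu)}{n!\,\Gamma(\nu-n)}$, $d\mu_\nu(z)=c_\nu(1-|z|^2)^{\nu-n-1}dz$, $d\lambda(z)=(1-|z|^2)^{-(n+1)}dz$, and let $\mathcal A^2_\nu$ be the Bergman space of holomorphic functions in $L^2(\mathbb B^n,\mu_\nu)$, with reproducing kernel $K_\nu(z,w)=(1-\langle z,w\rangle)^{-\nu}$ and normalized kernel $k_w(z)=(1-|w|^2)^{\nu/2}K_\nu(z,w)$. Let $G=\mathrm{SU}(n,1)$ act on $\mathbb B^n$ by fractional linear maps, $K\cong\mathrm U(n)$ the stabilizer of $0$ with normalized Haar measure $\mu_K$, and $\mu_G$ the Haar measure of $G$ with $\int_G f(x\cdot 0)\,d\mu_G(x)=\int_{\mathbb B^n} f\,d\lambda$; identify functions on $\mathbb B^n$ with right $K$-invariant functions on $G$ through $x\mapsto x\cdot 0$. Put $\pi_\nu(x)g(z)=k_{x\cdot 0}(z)\,g(x^{-1}\cdot z)$ on $\mathcal A^2_\nu$.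 An operator $A$ is radial if $\pi_\nu(k)A\pi_\nu(k)^*=A$ for all $k\in K$. Let $\mathfrak A_\nu=L^1(\mathbb B^n,\lambda)^K\oplus\mathcal T^1(\mathcal A^2_\nu)^K$ be the space of pairs of a $K$-invariant integrable function and a radial trace class operator, with $\|(f,A)\|=\|f\|_1+\|A\|_1$ and the product $$(f,A)*(g,B)=(f*g+A*B,\ f*B+g*A),$$ where $(f*g)(x)=\int_G f(y)g(y^{-1}x)\,d\mu_G(y)$, $(A*B)(x)=\mathrm{tr}(A\,\pi_\nu(x)B\pi_\nu(x)^*)$ and $f*A=\int_G f(x)\,\pi_\nu(x)A\pi_\nu(x)^*\,d\mu_G(x)$ (weakly). Let $\mathcal M(\mathfrak A_\nu)$ be the set of nonzero multiplicative linear functionals on $\mathfrak A_\nu$. Let $\mathcal S_{bdd}$ be the set of bounded spherical functions, i.e. bounded continuous nonzero $\phi:G\to\mathbb C$ with $\int_K\phi(xky)\,d\mu_K(k)=\phi(x)\phi(y)$, and $\widehat f(\phi)=\int_G f(x)\phi(x^{-1})\,d\mu_G(x)$. Let $h_\nu(z)=(1-|z|^2)^\nu$, and let $P_0=1\otimes 1$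 be the projection onto the constants. Fix any square root of $\widehat{h_\nu}$ on $\mathcal S_{bdd}$, i.e. a function $\sqrt{\widehat{h_\nu}}$ with $\big(\sqrt{\widehat{h_\nu}}(\phi)\big)^2=\widehat{h_\nu}(\phi)$ for all $\phi$ (for instance a continuous one). It has no zeros. For $\phi\in\mathcal S_{bdd}$ and $j\in\{0,1\}$ put $$\Phi_{\phi,j}(f,A)=\widehat f(\phi)+(-1)^j\,\frac{\widehat{(A*P_0)}(\phi)}{\sqrt{\widehat{h_\nu}}(\phi)},\qquad (f,A)\in\mathfrak A_\nu .$$ 1. $\Phi_{\phi,j}\in\mathcal M(\mathfrak A_\nu)$, and $\Phi_{\phi,j}$ is bounded, for all $\phi\in\mathcal S_{bdd}$ and $j\in\{0,1\}$. 2. Every $\Phi\in\mathcal M(\mathfrak A_\nu)$ equals $\Phi_{\phi,j}$ for some $\phi\in\mathcal S_{bdd}$ and $j\in\{0,1\}$. 3. Let $T^{(\nu)}_\phi g(z)=\int_{\mathbb B^n}\phi(w)g(w)K_\nu(z,w)\,d\mu_\nu(w)$ be the Toeplitz operator with symbol $\phi$ and $T^{\phi,\nu}=\frac{1}{c_\nu\sqrt{\widehat{h_\nu}}(\phi)}\,T^{(\nu)}_\phi$.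 Then $$\Phi_{\phi,j}(f,A)=\widehat f(\phi)+(-1)^j\,\mathrm{tr}(A\,T^{\phi,\nu}),\qquad (f,A)\in\mathfrak A_\nu .$$ 4. $T^{\phi,\nu}$ is radial, and on the space $\mathrm P^m$ of homogeneous polynomials of degree $m\ge 0$ it acts as multiplication by $$c_m(\phi,\nu)=\frac{n!\;\Gamma(m+\nu)}{\sqrt{\widehat{h_\nu}}(\phi)\;\Gamma(\nu)\,(n+m-1)!}\int_0^1\phi(\sqrt r)\,r^{n+m-1}(1-r)^{\nu-n-1}\,dr,$$ where $\phi(\sqrt r)$ is the value of the radial function $\phi$ at any point of norm $\sqrt r$. -/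

import Mathlib

open MeasureTheory

noncomputable section

namespace BergmanQHA

/-! ### The ball and its measures -/

/-- The space `ℂⁿ` with its Euclidean norm.  Note that `inner ℂ w z = ∑ j, z j * conj (w j)`. -/
abbrev E (n : ℕ) : Type := EuclideanSpace ℂ (Fin n)

/-- Lebesgue measure on the open unit ball of `ℂⁿ`, normalized to total mass one. -/
def lebBall (n : ℕ) : Measure (E n) :=
  ((volume : Measure (E n)) (Metric.ball 0 1))⁻¹ • volume.restrict (Metric.ball 0 1)

/-- `c_ν = Γ(ν) / (n! Γ(ν - n))`. -/
def cNu (n : ℕ) (ν : ℝ) : ℝ := Real.Gamma ν / (n.factorial * Real.Gamma (ν - n))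

/-- The probability measure `dμ_ν = c_ν (1 - |z|²)^(ν - n - 1) dz`. -/
def muNu (n : ℕ) (ν : ℝ) : Measure (E n) :=
  (lebBall n).withDensity fun z => ENNReal.ofReal (cNu n ν * (1 - ‖z‖ ^ 2) ^ (ν - n - 1))

/-- The Möbius invariant measure `dλ = (1 - |z|²)^(-(n + 1)) dz`. -/
def invMeasure (n : ℕ) : Measure (E n) :=
  (lebBall n).withDensity fun z => ENNReal.ofReal (((1 - ‖z‖ ^ 2) ^ (n + 1))⁻¹)

/-- `h_ν(z) = (1 - |z|²)^ν`. -/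
def hNu (n : ℕ) (ν : ℝ) (z : E n) : ℂ := (((1 - ‖z‖ ^ 2) ^ ν : ℝ) : ℂ)

/-- The reproducing kernel `K_ν(z, w) = (1 - ⟨z, w⟩)^(-ν)`; on the ball the base has positive real
part and the power is the principal one. -/
def kerNu (n : ℕ) (ν : ℝ) (z w : E n) : ℂ := (1 - inner ℂ w z) ^ (-(ν : ℂ))

/-- The normalized reproducing kernel `k_w(z) = (1 - |w|²)^(ν/2) K_ν(z, w)`. -/
def nkerNu (n : ℕ) (ν : ℝ) (w z : E n) : ℂ :=
  (((1 - ‖w‖ ^ 2) ^ (ν / 2) : ℝ) : ℂ) * kerNu n ν z w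

/-! ### The group `G = SU(n,1)`, its subgroup `K = U(n)`, and the action on the ball -/

/-- The matrix `diag(-1, …, -1, 1)`. -/
def J (n : ℕ) : Matrix (Fin n ⊕ Unit) (Fin n ⊕ Unit) ℂ := Matrix.fromBlocks (-1) 0 0 1

/-- `SU(n,1)`: the matrices `x` with `det x = 1` and `x* J x = J`. -/
def SU (n : ℕ) : Subgroup (Matrix.SpecialLinearGroup (Fin n ⊕ Unit) ℂ) where
  carrier := {x | (x : Matrix (Fin n ⊕ Unit) (Fin n ⊕ Unit) ℂ).conjTranspose * J n * x.1 = J n}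
  one_mem' := by simp
  mul_mem' := by
    intro x y hx hy
    simp only [Set.mem_ofPred_eq, Matrix.SpecialLinearGroup.coe_mul,
      Matrix.conjTranspose_mul] at hx hy ⊢
    calc y.1.conjTranspose * x.1.conjTranspose * J n * (x.1 * y.1)
        = y.1.conjTranspose * (x.1.conjTranspose * J n * x.1) * y.1 := by
          simp only [Matrix.mul_assoc]
      _ = J n := by rw [hx, hy]
  inv_mem' := by
    intro x hx
    simp only [Set.mem_ofPred_eq] at hx ⊢
    have h1 : x.1 * (x⁻¹).1 = 1 := by
      rw [← Matrix.SpecialLinearGroup.coe_mul, mul_inv_cancel, Matrix.SpecialLinearGroup.coe_one]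
    have h2 : (x⁻¹).1.conjTranspose * x.1.conjTranspose = 1 := by
      rw [← Matrix.conjTranspose_mul, h1, Matrix.conjTranspose_one]
    calc (x⁻¹).1.conjTranspose * J n * (x⁻¹).1
        = (x⁻¹).1.conjTranspose * (x.1.conjTranspose * J n * x.1) * (x⁻¹).1 := by rw [hx]
      _ = ((x⁻¹).1.conjTranspose * x.1.conjTranspose) * J n * (x.1 * (x⁻¹).1) := by
          simp only [Matrix.mul_assoc]
      _ = J n := by rw [h1, h2]; simp

instance (n : ℕ) : MeasurableSpace (SU n) := borel _
instance (n : ℕ) : BorelSpace (SU n) := ⟨rfl⟩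

instance (n : ℕ) : LocallyCompactSpace (SU n) := by
  have h1 : Topology.IsClosedEmbedding
      (Subtype.val : Matrix.SpecialLinearGroup (Fin n ⊕ Unit) ℂ → _) :=
    Matrix.SpecialLinearGroup.isClosedEmbedding_val
  have hc : IsClosed (SU n : Set (Matrix.SpecialLinearGroup (Fin n ⊕ Unit) ℂ)) := by
    have hv : Continuous (Subtype.val : Matrix.SpecialLinearGroup (Fin n ⊕ Unit) ℂ → _) :=
      h1.continuous
    exact isClosed_eq ((hv.matrix_conjTranspose.mul continuous_const).mul hv) continuous_const
  have : LocallyCompactSpace (Matrix (Fin n ⊕ Unit) (Fin n ⊕ Unit) ℂ) :=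
    inferInstanceAs (LocallyCompactSpace (Fin n ⊕ Unit → Fin n ⊕ Unit → ℂ))
  exact (h1.comp hc.isClosedEmbedding_subtypeVal).locallyCompactSpace

/-- The fractional linear action `x · z = (A z + w) / (v · z + d)` of `x = (A, w; v, d)`. -/
def act {n : ℕ} (x : SU n) (z : E n) : E n :=
  WithLp.toLp 2 fun i =>
    (∑ j, x.1.1 (Sum.inl i) (Sum.inl j) * z j + x.1.1 (Sum.inl i) (Sum.inr ())) /
      (∑ j, x.1.1 (Sum.inr ()) (Sum.inl j) * z j + x.1.1 (Sum.inr ()) (Sum.inr ()))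

/-- The group `U(n)`. -/
abbrev U (n : ℕ) : Submonoid (Matrix (Fin n) (Fin n) ℂ) := Matrix.unitaryGroup (Fin n) ℂ

instance (n : ℕ) : MeasurableSpace (U n) := borel _
instance (n : ℕ) : BorelSpace (U n) := ⟨rfl⟩

instance (n : ℕ) : CompactSpace (U n) := by
  have hcl : IsClosed (U n : Set (Matrix (Fin n) (Fin n) ℂ)) := isClosed_unitary
  have hK : IsCompact (Set.pi Set.univ fun _ : Fin n =>
      Set.pi Set.univ fun _ : Fin n => Metric.closedBall (0 : ℂ) 1) :=
    isCompact_univ_pi fun _ => isCompact_univ_pi fun _ => isCompact_closedBall 0 1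
  refine isCompact_iff_compactSpace.mp (hK.of_isClosed_subset hcl ?_)
  intro u hu i _ j _
  simpa using entry_norm_bound_of_unitary hu i j

/-- The embedding `k ↦ diag(k, conj (det k))` of `U(n)` onto the stabilizer `K` of `0` in `G`. -/
def kEmb {n : ℕ} (k : U n) : SU n :=
  ⟨⟨Matrix.fromBlocks k.1 0 0 (Matrix.of fun _ _ => star k.1.det), by
      have h := congrArg Matrix.det (Matrix.mem_unitaryGroup_iff.mp k.2)
      rw [Matrix.det_mul, Matrix.star_eq_conjTranspose, Matrix.det_conjTranspose,
        Matrix.det_one] at h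
      rw [Matrix.det_fromBlocks_zero₂₁]
      simpa using h⟩, by
    have h := Matrix.mem_unitaryGroup_iff'.mp k.2
    have hd := congrArg Matrix.det h
    rw [Matrix.det_mul, Matrix.star_eq_conjTranspose, Matrix.det_conjTranspose,
        Matrix.det_one] at hd
    rw [Matrix.star_eq_conjTranspose] at h
    change Matrix.conjTranspose (Matrix.fromBlocks _ _ _ _) * Matrix.fromBlocks _ _ _ _ *
      Matrix.fromBlocks _ _ _ _ = Matrix.fromBlocks _ _ _ _
    rw [Matrix.fromBlocks_conjTranspose, Matrix.fromBlocks_multiply, Matrix.fromBlocks_multiply]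
    congr 1
    · simp [h]
    · simp
    · simp
    · ext i j
      simp [Matrix.mul_apply]
      simpa [mul_comm] using hd⟩

/-- The normalized Haar measure of `K`. -/
def muK (n : ℕ) : Measure (U n) := Measure.haarMeasure ⊤

/-- The Haar measure of `G`, normalized such that `∫_G f(x · 0) dμ_G(x) = ∫_𝔹 f dλ`.  Both sides are
`G`-invariant in `f`, hence proportional, so it suffices to normalize on the ball of radius
`1/2`. -/
def muG (n : ℕ) : Measure (SU n) :=
  (invMeasure n (Metric.ball 0 (1 / 2)) /
    (Measure.haar : Measure (SU n)) {x | act x 0 ∈ Metric.ball (0 : E n) (1 / 2)}) • Measure.haar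

/-- The function `f ∘ p` on `G` given by a function `f` on the ball, where `p(x) = x · 0`. -/
def pull {n : ℕ} (f : E n → ℂ) (x : SU n) : ℂ := f (act x 0)

/-- The function on the ball given by a right `K`-invariant function `F` on `G`: its value at `z` is
`F(x)` for any `x` with `x · 0 = z`. -/
def onBall {n : ℕ} (F : SU n → ℂ) (z : E n) : ℂ := F (Classical.epsilon fun x => act x 0 = z)

/-- Convolution of functions on `G`. -/
def conv {n : ℕ} (F H : SU n → ℂ) (x : SU n) : ℂ := ∫ y, F y * H (y⁻¹ * x) ∂muG n

/-- The set `S_bdd` of bounded spherical functions: bounded continuous nonzero functions on `G` with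
`∫_K φ(x k y) dμ_K(k) = φ(x) φ(y)`. -/
def SBdd (n : ℕ) : Set (SU n → ℂ) :=
  {φ | Continuous φ ∧ φ ≠ 0 ∧ (∀ x y, ∫ k : U n, φ (x * kEmb k * y) ∂muK n = φ x * φ y) ∧
    ∃ C : ℝ, ∀ x, ‖φ x‖ ≤ C}

/-- The spherical Fourier transform `∫_G F(x) φ(x⁻¹) dμ_G(x)`. -/
def sphTransform {n : ℕ} (F : SU n → ℂ) (φ : SBdd n) : ℂ := ∫ x, F x * φ.1 x⁻¹ ∂muG n

/-! ### Trace class operators -/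

section TraceClass

variable {H : Type*} [NormedAddCommGroup H] [InnerProductSpace ℂ H]

/-- `A = ∑ₖ uₖ ⊗ vₖ` with `∑ₖ ‖uₖ‖ ‖vₖ‖ < ∞`, where `(u ⊗ v) g = ⟨g, v⟩ u`. -/
def IsNuclearRep (A : H →L[ℂ] H) (u v : ℕ → H) : Prop :=
  Summable (fun k => ‖u k‖ * ‖v k‖) ∧ ∀ g, HasSum (fun k => inner ℂ (v k) g • u k) (A g)

/-- Trace class operators on a Hilbert space. -/
def IsTraceClass (A : H →L[ℂ] H) : Prop := ∃ u v : ℕ → H, IsNuclearRep A u v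

/-- The trace norm of a trace class operator. -/
def traceNorm (A : H →L[ℂ] H) : ℝ :=
  sInf {t | ∃ u v : ℕ → H, IsNuclearRep A u v ∧ t = ∑' k, ‖u k‖ * ‖v k‖}

variable (H) in
/-- A maximal orthonormal set; in a Hilbert space this is an orthonormal basis. -/
def onBasis : Set H :=
  (exists_maximal_orthonormal (𝕜 := ℂ) (s := (∅ : Set H)) (by simp)).choose

/-- The trace `∑ₑ ⟨A e, e⟩` over an orthonormal basis. -/
def trace (A : H →L[ℂ] H) : ℂ := ∑' e : onBasis H, inner ℂ (e : H) (A e)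

/-- The Hilbert space adjoint: the operator `V` with `⟨A g, h⟩ = ⟨g, V h⟩` for all `g, h`
(on a complete space it exists and is unique; this form does not need a completeness instance). -/
def adj (A : H →L[ℂ] H) : H →L[ℂ] H :=
  Classical.epsilon fun V : H →L[ℂ] H => ∀ g h, inner ℂ (A g) h = inner ℂ g (V h)

theorem IsTraceClass.zero : IsTraceClass (0 : H →L[ℂ] H) :=
  ⟨fun _ => 0, fun _ => 0, by simp, fun g => by simp⟩

theorem IsTraceClass.smul (c : ℂ) {A : H →L[ℂ] H} (hA : IsTraceClass A) :
    IsTraceClass (c • A) := by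
  obtain ⟨u, v, h1, h2⟩ := hA
  refine ⟨fun k => c • u k, v, ?_, fun g => ?_⟩
  · simpa [norm_smul, mul_assoc] using h1.mul_left ‖c‖
  · simpa [smul_comm c] using (h2 g).const_smul c

theorem IsTraceClass.add {A B : H →L[ℂ] H} (hA : IsTraceClass A) (hB : IsTraceClass B) :
    IsTraceClass (A + B) := by
  obtain ⟨u, v, h1, h2⟩ := hA
  obtain ⟨u', v', h1', h2'⟩ := hB
  let e : ℕ ⊕ ℕ ≃ ℕ := Equiv.natSumNatEquivNat
  refine ⟨fun k => Sum.elim u u' (e.symm k), fun k => Sum.elim v v' (e.symm k), ?_, fun g => ?_⟩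
  · refine (e.symm.summable_iff (f := fun s => ‖Sum.elim u u' s‖ * ‖Sum.elim v v' s‖)).mpr ?_
    exact Summable.sum _ (by simpa [Function.comp_def] using h1)
      (by simpa [Function.comp_def] using h1')
  · refine (e.symm.hasSum_iff
      (f := fun s => inner ℂ (Sum.elim v v' s) g • Sum.elim u u' s)).mpr ?_
    exact HasSum.sum (by simpa [Function.comp_def] using h2 g)
      (by simpa [Function.comp_def] using h2' g)

end TraceClass

/-! ### The Bergman space and its operators -/

/-- The Bergman space `𝒜²_ν`: the (classes of) functions in `L²(μ_ν)` that are holomorphic on the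
ball, with the inner product of `L²(μ_ν)`. -/
def bergman (n : ℕ) (ν : ℝ) : Submodule ℂ (Lp ℂ 2 (muNu n ν)) where
  carrier := {g | ∃ F : E n → ℂ, DifferentiableOn ℂ F (Metric.ball 0 1) ∧ g =ᵐ[muNu n ν] F}
  zero_mem' := ⟨0, differentiableOn_const 0, Lp.coeFn_zero ..⟩
  add_mem' := by
    rintro f g ⟨F, hF, hf⟩ ⟨G, hG, hg⟩
    exact ⟨F + G, hF.add hG, (Lp.coeFn_add f g).trans (hf.add hg)⟩
  smul_mem' := by
    rintro c f ⟨F, hF, hf⟩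
    exact ⟨c • F, hF.const_smul c, (Lp.coeFn_smul c f).trans (hf.const_smul c)⟩

/-- Bounded operators on the Bergman space. -/
abbrev Op (n : ℕ) (ν : ℝ) : Type := bergman n ν →L[ℂ] bergman n ν

/-- The bounded operator on the Bergman space that acts on functions by the formula `T`.  There is at
most one such operator; it exists for all the formulas `T` used below. -/
def opOf (n : ℕ) (ν : ℝ) (T : (E n → ℂ) → E n → ℂ) : Op n ν :=
  Classical.epsilon fun V : Op n ν => ∀ g : bergman n ν,
    ((V g : Lp ℂ 2 (muNu n ν)) : E n → ℂ) =ᵐ[muNu n ν] T ((g : Lp ℂ 2 (muNu n ν)) : E n → ℂ)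

/-- The projective representation `π_ν(x) g(z) = k_{x · 0}(z) g(x⁻¹ · z)`. -/
def piNu (n : ℕ) (ν : ℝ) (x : SU n) : Op n ν :=
  opOf n ν fun g z => nkerNu n ν (act x 0) z * g (act x⁻¹ z)

/-- The Toeplitz operator `T_f g(z) = ∫ f(w) g(w) K_ν(z, w) dμ_ν(w)`. -/
def toeplitz (n : ℕ) (ν : ℝ) (f : E n → ℂ) : Op n ν :=
  opOf n ν fun g z => ∫ w, f w * g w * kerNu n ν z w ∂muNu n ν

/-- `P₀ = 1 ⊗ 1`, that is, `P₀ g = ⟨g, 1⟩ 1`. -/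
def P0 (n : ℕ) (ν : ℝ) : Op n ν := opOf n ν fun g _ => ∫ w, g w ∂muNu n ν

/-- Translation of operators, `π_ν(x) A π_ν(x)*`. -/
def translate {n : ℕ} {ν : ℝ} (x : SU n) (A : Op n ν) : Op n ν :=
  piNu n ν x ∘L A ∘L adj (piNu n ν x)

/-- Radial operators: the `K`-invariant ones. -/
def IsRadialOp {n : ℕ} {ν : ℝ} (A : Op n ν) : Prop := ∀ k : U n, translate (kEmb k) A = A

/-- The convolution `(A * B)(x) = tr(A π_ν(x) B π_ν(x)*)` of two operators, a function on `G`. -/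
def opConv {n : ℕ} {ν : ℝ} (A B : Op n ν) (x : SU n) : ℂ := trace (A ∘L translate x B)

/-- The convolution `F * A = ∫_G F(x) π_ν(x) A π_ν(x)* dμ_G(x)` (weak integral) of a function and an
operator. -/
def funOpConv {n : ℕ} {ν : ℝ} (F : SU n → ℂ) (A : Op n ν) : Op n ν :=
  Classical.epsilon fun V : Op n ν => ∀ g h : bergman n ν,
    inner ℂ h (V g) = ∫ x, F x * inner ℂ h (translate x A g) ∂muG n

/-- `g` belongs to the space `P^m` of homogeneous polynomials of degree `m`. -/
def IsHomogeneousPoly {n : ℕ} {ν : ℝ} (m : ℕ) (g : bergman n ν) : Prop :=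
  ∃ p : MvPolynomial (Fin n) ℂ, p.IsHomogeneous m ∧
    ((g : Lp ℂ 2 (muNu n ν)) : E n → ℂ) =ᵐ[muNu n ν] fun z => MvPolynomial.eval (fun i => z i) p

/-! ### The convolution algebra `𝔄_ν = L¹(𝔹, λ)^K ⊕ 𝒯¹(𝒜²_ν)^K` -/

/-- The (classes of) radial, that is `K`-invariant, functions in `L¹(𝔹, λ)`. -/
def L1K (n : ℕ) : Submodule ℂ (Lp ℂ 1 (invMeasure n)) where
  carrier := {f | ∃ F : E n → ℂ, (∀ (k : U n) (z : E n), F (act (kEmb k) z) = F z) ∧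
    f =ᵐ[invMeasure n] F}
  zero_mem' := ⟨0, fun _ _ => rfl, Lp.coeFn_zero ..⟩
  add_mem' := by
    rintro f g ⟨F, hF, hf⟩ ⟨G, hG, hg⟩
    exact ⟨F + G, fun k z => by simp [hF k z, hG k z], (Lp.coeFn_add f g).trans (hf.add hg)⟩
  smul_mem' := by
    rintro c f ⟨F, hF, hf⟩
    exact ⟨c • F, fun k z => by simp [hF k z], (Lp.coeFn_smul c f).trans (hf.const_smul c)⟩

/-- The radial trace class operators. -/
def T1K (n : ℕ) (ν : ℝ) : Submodule ℂ (Op n ν) where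
  carrier := {A | IsTraceClass A ∧ IsRadialOp A}
  zero_mem' := ⟨IsTraceClass.zero, fun k => by simp [translate]⟩
  add_mem' := by
    rintro A B ⟨hA, hA'⟩ ⟨hB, hB'⟩
    refine ⟨hA.add hB, fun k => ?_⟩
    have h1 := hA' k
    have h2 := hB' k
    simp only [translate] at h1 h2 ⊢
    rw [ContinuousLinearMap.add_comp, ContinuousLinearMap.comp_add, h1, h2]
  smul_mem' := by
    rintro c A ⟨hA, hA'⟩
    refine ⟨hA.smul c, fun k => ?_⟩
    have h1 := hA' k
    simp only [translate] at h1 ⊢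
    rw [ContinuousLinearMap.smul_comp, ContinuousLinearMap.comp_smul, h1]

/-- The underlying vector space of the convolution algebra. -/
abbrev Alg (n : ℕ) (ν : ℝ) : Type := L1K n × T1K n ν

/-- The function on `G` that corresponds to an element of `L¹(𝔹, λ)^K`. -/
def onG {n : ℕ} (f : L1K n) : SU n → ℂ := pull ((f : Lp ℂ 1 (invMeasure n)) : E n → ℂ)

/-- The norm `‖(f, A)‖ = ‖f‖₁ + ‖A‖₁`. -/
def algNorm {n : ℕ} {ν : ℝ} (a : Alg n ν) : ℝ := ‖a.1‖ + traceNorm (a.2 : Op n ν)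

/-- The product `(f, A) * (g, B) = (f * g + A * B, f * B + g * A)`: the element of the algebra whose
first component, as a class of functions on `G`, and second component are the given ones.  These two
conditions determine the element. -/
def algMul {n : ℕ} {ν : ℝ} (a b : Alg n ν) : Alg n ν :=
  Classical.epsilon fun c : Alg n ν =>
    (onG c.1 =ᵐ[muG n] fun x => conv (onG a.1) (onG b.1) x + opConv (a.2 : Op n ν) b.2 x) ∧
    (c.2 : Op n ν) = funOpConv (onG a.1) (b.2 : Op n ν) + funOpConv (onG b.1) (a.2 : Op n ν)

/-- `Φ ∈ ℳ(𝔄_ν)`: nonzero multiplicative linear functionals. -/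
structure IsMultiplicativeFunctional {n : ℕ} {ν : ℝ} (Φ : Alg n ν → ℂ) : Prop where
  map_add : ∀ a b, Φ (a + b) = Φ a + Φ b
  map_smul : ∀ (c : ℂ) a, Φ (c • a) = c * Φ a
  map_mul : ∀ a b, Φ (algMul a b) = Φ a * Φ b
  ne_zero : ∃ a, Φ a ≠ 0

/-- `ĥ_ν`, the spherical transform of `h_ν`. -/
def hHat (n : ℕ) (ν : ℝ) (φ : SBdd n) : ℂ := sphTransform (pull (hNu n ν)) φ

/-- `Φ_{φ,j}(f, A) = f̂(φ) + (-1)^j (A * P₀)^(φ) / s(φ)`, where `s` is a square root of `ĥ_ν`. -/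
def Phi {n : ℕ} {ν : ℝ} (s : SBdd n → ℂ) (φ : SBdd n) (j : Fin 2) (a : Alg n ν) : ℂ :=
  sphTransform (onG a.1) φ +
    (-1) ^ (j : ℕ) * (sphTransform (opConv (a.2 : Op n ν) (P0 n ν)) φ / s φ)

/-- The operator `T^{φ,ν} = c_ν⁻¹ s(φ)⁻¹ T_φ`, where `T_φ` is the Toeplitz operator with symbol `φ`
and `s` is a square root of `ĥ_ν`. -/
def TOp (n : ℕ) (ν : ℝ) (s : SBdd n → ℂ) (φ : SBdd n) : Op n ν :=
  ((cNu n ν : ℂ) * s φ)⁻¹ • toeplitz n ν (onBall φ.1)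

end BergmanQHA

end

open MeasureTheory
set_option linter.unusedSimpArgs false
set_option linter.unusedSectionVars false

noncomputable section

namespace BergmanQHA

open Matrix ComplexConjugate Metric
open scoped ENNReal

/-! ### The fractional linear action of `SU(n,1)` on the ball and the stabilizer of the origin. -/

section Action

variable {n : ℕ}

/-! For a bounded spherical function `φ` and a radial trace class operator `B` consider the weak
integral `X_B = ∫ φ(x) π(x) B π(x)* dx`. Its trace pairing with a trace class `A` is the spherical
transform of `A * B` at `φ` (`sphTransform_opConv`). Its Berezin transform is a convolution of `φ`
with the `K`-invariant function `B * P₀`, so by the functional equation it is `(B * P₀)^(φ)` times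
`φ` (`inner_orbit_sphOp`). A bounded operator is determined by its Berezin transform
(`eq_zero_of_inner_kerVec_self`), hence `ĥ_ν X_B = (B * P₀)^ X_{P₀}` at `φ`, and tracing against `A`
gives `(A * B)^ ĥ_ν = (A * P₀)^ (B * P₀)^` (`sphTransform_opConv_mul_hHat`). After division by `ĥ_ν
= s²` this is exactly the multiplicativity of the two functionals attached to `φ`; the two signs are
the two square roots.

The division is legitimate (`hHat_ne_zero`): if `ĥ_ν(φ) = 0`, then `X_{P₀} = 0`, so `φ` annihilates
`|F|²` for every bounded holomorphic `F`, hence every function of `|z|²`, which contradicts `φ(0) =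
1`.

Conversely, a multiplicative functional restricts to a nonzero character of the algebra of radial
`L¹` functions. Such a character is contractive, extends to `L¹(G)` by Hahn-Banach, and is therefore
integration against a bounded spherical function (`exists_spherical`). Its value on `P₀` squares to
`ĥ_ν(φ)`, which fixes the sign, and multiplying by that value determines it on every operator
(`exists_eq_Phi`).

The operator `X_{P₀}` is `c_ν⁻¹` times the Toeplitz operator with symbol `φ`, since `π(x) P₀ π(x)*`
projects onto the normalized kernel at `x · 0`; this gives the trace formula. On `P^m` only the
degree `m` term of the kernel expansion survives integration, so the eigenvalue is a quotient of two
radial moments.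

The analysis underneath rests on three facts: `x⁻¹ ∈ K x K`, which gives unimodularity and symmetry;
square integrability of the matrix coefficients of `π_ν`, which makes the convolutions of trace
class operators integrable; and polarization, by which a sesquiholomorphic function is determined by
its diagonal values. -/

/-- The vector `(z, t)` of `ℂⁿ⁺¹`. -/
def hvec (z : E n) (t : ℂ) : Fin n ⊕ Unit → ℂ := Sum.elim z fun _ => t

/-- The denominator `v · z + d` of the fractional linear action. -/
def den (x : SU n) (z : E n) : ℂ :=
  ∑ j, x.1.1 (Sum.inr ()) (Sum.inl j) * z j + x.1.1 (Sum.inr ()) (Sum.inr ())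

/-- The numerator `A z + w` of the fractional linear action. -/
def num (x : SU n) (z : E n) : E n :=
  WithLp.toLp 2 fun i =>
    ∑ j, x.1.1 (Sum.inl i) (Sum.inl j) * z j + x.1.1 (Sum.inl i) (Sum.inr ())

theorem act_eq (x : SU n) (z : E n) : act x z = (den x z)⁻¹ • num x z := by
  ext i
  simp [act, den, num, div_eq_inv_mul]

theorem mulVec_hvec (x : SU n) (z : E n) : x.1.1 *ᵥ hvec z 1 = hvec (num x z) (den x z) := by
  ext i
  rcases i with i | i <;> simp [Matrix.mulVec, dotProduct, hvec, num, den]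

theorem hvec_smul (c : ℂ) (z : E n) (t : ℂ) : hvec (c • z) (c * t) = c • hvec z t := by
  ext i
  rcases i with i | i <;> simp [hvec]

theorem hvec_inj {z w : E n} {s t : ℂ} (h : hvec z s = hvec w t) : z = w ∧ s = t := by
  refine ⟨?_, by simpa [hvec] using congrFun h (Sum.inr ())⟩
  ext i
  simpa [hvec] using congrFun h (Sum.inl i)

theorem form_hvec (z w : E n) (s t : ℂ) :
    star (hvec z s) ⬝ᵥ (J n *ᵥ hvec w t) = conj s * t - inner ℂ z w := by
  simp [hvec, J, Matrix.mulVec, dotProduct, Matrix.fromBlocks, Matrix.one_apply,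
    PiLp.inner_apply, mul_comm]
  ring

theorem SU_cond (x : SU n) : x.1.1ᴴ * J n * x.1.1 = J n := x.2

/-- Invariance of the Hermitian form of `J`, evaluated on the lifts `(z, 1)` and `(w, 1)`. All
transformation rules for `1 - ⟨z, w⟩` come from here. -/
theorem form_num (x : SU n) (z w : E n) :
    conj (den x z) * den x w - inner ℂ (num x z) (num x w) = 1 - inner ℂ z w := by
  have h := form_hvec (num x z) (num x w) (den x z) (den x w)
  rw [← mulVec_hvec, ← mulVec_hvec, Matrix.star_mulVec, ← Matrix.dotProduct_mulVec,
    Matrix.mulVec_mulVec, Matrix.mulVec_mulVec, SU_cond, form_hvec] at h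
  rw [← h]
  simp

theorem den_normSq (x : SU n) (z : E n) : ‖den x z‖ ^ 2 - ‖num x z‖ ^ 2 = 1 - ‖z‖ ^ 2 := by
  have h := form_num x z z
  rw [inner_self_eq_norm_sq_to_K, inner_self_eq_norm_sq_to_K, ← Complex.normSq_eq_conj_mul_self,
    Complex.normSq_eq_norm_sq] at h
  simp only [Complex.coe_algebraMap] at h
  exact_mod_cast h

theorem norm_lt_one_of_mem {z : E n} (hz : z ∈ ball (0 : E n) 1) : ‖z‖ < 1 := by simpa using hz

theorem one_sub_normSq_pos {z : E n} (hz : z ∈ ball (0 : E n) 1) : 0 < 1 - ‖z‖ ^ 2 := by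
  have := norm_lt_one_of_mem hz
  nlinarith [norm_nonneg z]

/-- A zero denominator would make `1 - ‖z‖²` equal to `-‖num x z‖² ≤ 0`. -/
theorem den_ne_zero (x : SU n) {z : E n} (hz : z ∈ ball (0 : E n) 1) : den x z ≠ 0 := by
  intro h
  have := den_normSq x z
  have h2 := one_sub_normSq_pos hz
  have h0 : ‖den x z‖ = 0 := by rw [h, norm_zero]
  rw [h0] at this
  nlinarith [sq_nonneg ‖num x z‖, den_normSq x z]

theorem one_sub_inner_act (x : SU n) {z w : E n} (hz : z ∈ ball (0 : E n) 1)
    (hw : w ∈ ball (0 : E n) 1) :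
    1 - inner ℂ (act x z) (act x w) = (1 - inner ℂ z w) / (conj (den x z) * den x w) := by
  have h1 := den_ne_zero x hz
  have h2 := den_ne_zero x hw
  have h1' : conj (den x z) ≠ 0 := by simpa using h1
  rw [act_eq, act_eq, inner_smul_left, inner_smul_right, ← form_num x z w, map_inv₀]
  field_simp

theorem one_sub_normSq_act (x : SU n) {z : E n} (hz : z ∈ ball (0 : E n) 1) :
    1 - ‖act x z‖ ^ 2 = (1 - ‖z‖ ^ 2) / ‖den x z‖ ^ 2 := by
  have h1 : ‖den x z‖ ≠ 0 := by simpa using den_ne_zero x hz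
  rw [act_eq, norm_smul, ← den_normSq x z, norm_inv]
  field_simp

theorem act_mem (x : SU n) {z : E n} (hz : z ∈ ball (0 : E n) 1) : act x z ∈ ball (0 : E n) 1 := by
  have h := one_sub_normSq_act x hz
  have h1 : 0 < ‖den x z‖ := by simpa using den_ne_zero x hz
  have h2 : 0 < 1 - ‖act x z‖ ^ 2 := by
    rw [h]
    exact div_pos (one_sub_normSq_pos hz) (by positivity)
  rw [mem_ball_zero_iff]
  nlinarith [norm_nonneg (act x z)]

theorem num_eq (x : SU n) {z : E n} (hz : z ∈ ball (0 : E n) 1) :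
    num x z = den x z • act x z := by
  rw [act_eq, smul_inv_smul₀ (den_ne_zero x hz)]

/-- On lifts to `ℂⁿ⁺¹` the action is linear, so numerator and denominator of a product are read off
from one matrix product; the scalar `den y z` records the choice of lift. -/
theorem num_den_mul (x y : SU n) {z : E n} (hz : z ∈ ball (0 : E n) 1) :
    num (x * y) z = den y z • num x (act y z) ∧ den (x * y) z = den y z * den x (act y z) := by
  apply hvec_inj
  have h2 : den y z • hvec (act y z) 1 = hvec (num y z) (den y z) := by
    rw [num_eq y hz, ← hvec_smul, mul_one]
  rw [← mulVec_hvec, hvec_smul, ← mulVec_hvec, ← Matrix.mulVec_smul, h2, ← mulVec_hvec,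
    Matrix.mulVec_mulVec]
  simp

theorem den_mul (x y : SU n) {z : E n} (hz : z ∈ ball (0 : E n) 1) :
    den (x * y) z = den y z * den x (act y z) := (num_den_mul x y hz).2

theorem act_mul (x y : SU n) {z : E n} (hz : z ∈ ball (0 : E n) 1) :
    act (x * y) z = act x (act y z) := by
  obtain ⟨h1, h2⟩ := num_den_mul x y hz
  rw [act_eq, act_eq x, h1, h2, smul_smul, mul_inv, mul_right_comm,
    inv_mul_cancel₀ (den_ne_zero y hz), one_mul]

theorem den_one (z : E n) : den (1 : SU n) z = 1 := by simp [den]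

theorem act_one (z : E n) : act (1 : SU n) z = z := by
  ext i
  simp [act, Matrix.one_apply]

theorem zero_mem : (0 : E n) ∈ ball (0 : E n) 1 := by simp

theorem act_inv_act (x : SU n) {z : E n} (hz : z ∈ ball (0 : E n) 1) :
    act x⁻¹ (act x z) = z := by
  rw [← act_mul _ _ hz, inv_mul_cancel, act_one]

theorem act_act_inv (x : SU n) {z : E n} (hz : z ∈ ball (0 : E n) 1) :
    act x (act x⁻¹ z) = z := by
  rw [← act_mul _ _ hz, mul_inv_cancel, act_one]

theorem den_zero (x : SU n) : den x 0 = x.1.1 (Sum.inr ()) (Sum.inr ()) := by simp [den]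

/-! ### The maximal compact subgroup -/

theorem kEmb_val (k : U n) : (kEmb k).1.1 =
    Matrix.fromBlocks k.1 0 0 (Matrix.of fun _ _ => star k.1.det) := rfl

theorem norm_det_unitary (k : U n) : ‖k.1.det‖ = 1 := by
  have h := congrArg Matrix.det (Matrix.mem_unitaryGroup_iff.mp k.2)
  rw [Matrix.det_mul, Matrix.star_eq_conjTranspose, Matrix.det_conjTranspose,
    Matrix.det_one] at h
  have h2 := congrArg norm h
  rw [norm_mul, norm_star, norm_one] at h2
  nlinarith [norm_nonneg k.1.det]

theorem den_kEmb (k : U n) (z : E n) : den (kEmb k) z = conj k.1.det := by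
  simp [den, kEmb_val]

theorem num_kEmb (k : U n) (z : E n) : num (kEmb k) z = WithLp.toLp 2 (k.1 *ᵥ z) := by
  ext i
  simp [num, kEmb_val, Matrix.mulVec, dotProduct]

/-- The last diagonal entry of `kEmb k` is `conj (det k)`, of modulus one, so dividing by it
multiplies by `det k`. Thus `k` acts by `det k • k` and not by `k` itself. -/
theorem act_kEmb (k : U n) (z : E n) :
    act (kEmb k) z = k.1.det • (WithLp.toLp 2 (k.1 *ᵥ z) : E n) := by
  have h : (conj k.1.det)⁻¹ = k.1.det := by
    refine inv_eq_of_mul_eq_one_right ?_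
    rw [← Complex.normSq_eq_conj_mul_self, Complex.normSq_eq_norm_sq, norm_det_unitary]
    simp
  rw [act_eq, den_kEmb, num_kEmb, h]

theorem norm_act_kEmb (k : U n) (z : E n) : ‖act (kEmb k) z‖ = ‖z‖ := by
  have h := den_normSq (kEmb k) z
  rw [act_eq, norm_smul, norm_inv, den_kEmb, RCLike.norm_conj, norm_det_unitary]
  rw [den_kEmb, RCLike.norm_conj, norm_det_unitary] at h
  have h1 : ‖num (kEmb k) z‖ = ‖z‖ := by
    rw [← abs_norm (num _ _), ← abs_norm z, ← sq_eq_sq_iff_abs_eq_abs]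
    linarith
  simp [h1]

/-- The embedding of `U(n)` as a homomorphism. -/
def kHom (n : ℕ) : U n →* SU n where
  toFun := kEmb
  map_one' := by
    apply Subtype.ext
    apply Subtype.ext
    rw [kEmb_val]
    ext i j
    rcases i with i | i <;> rcases j with j | j <;> simp [Matrix.one_apply]
  map_mul' k l := by
    apply Subtype.ext
    apply Subtype.ext
    change _ = (kEmb k).1.1 * (kEmb l).1.1
    rw [kEmb_val, kEmb_val, kEmb_val, Matrix.fromBlocks_multiply]
    ext i j
    rcases i with i | i <;> rcases j with j | j <;> simp [Matrix.mul_apply, mul_comm]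

theorem kEmb_mul (k l : U n) : kEmb (k * l) = kEmb k * kEmb l := (kHom n).map_mul k l
theorem kEmb_one : kEmb (1 : U n) = 1 := (kHom n).map_one
theorem continuous_entry (i j : Fin n ⊕ Unit) : Continuous fun x : SU n => x.1.1 i j := by
  have h1 : Continuous
      (Subtype.val : Matrix.SpecialLinearGroup (Fin n ⊕ Unit) ℂ → _) :=
    Matrix.SpecialLinearGroup.isClosedEmbedding_val.continuous
  have h2 : Continuous (Subtype.val : SU n → Matrix.SpecialLinearGroup (Fin n ⊕ Unit) ℂ) :=
    continuous_subtype_val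
  exact (h1.comp h2).matrix_elem i j

theorem continuous_SU_mk {X : Type*} [TopologicalSpace X] {f : X → SU n}
    (h : ∀ i j, Continuous fun t => (f t).1.1 i j) : Continuous f := by
  refine continuous_induced_rng.mpr
    (Matrix.SpecialLinearGroup.isClosedEmbedding_val.isInducing.continuous_iff.mpr ?_)
  exact continuous_pi fun i => continuous_pi fun j => h i j

theorem continuous_kEmb : Continuous (kEmb : U n → SU n) := by
  have h0 : Continuous fun k : U n => k.1 := continuous_subtype_val
  have h1 : Continuous fun k : U n => k.1.det := h0.matrix_det
  refine continuous_SU_mk fun i j => ?_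
  rcases i with i | i <;> rcases j with j | j <;> simp only [kEmb_val, Matrix.fromBlocks_apply₁₁,
    Matrix.fromBlocks_apply₁₂, Matrix.fromBlocks_apply₂₁, Matrix.fromBlocks_apply₂₂]
  · exact h0.matrix_elem i j
  · exact continuous_const
  · exact continuous_const
  · simpa using h1.star

theorem act_kEmb_zero (k : U n) : act (kEmb k) 0 = (0 : E n) := by
  have := norm_act_kEmb k 0
  simpa using this

theorem act_mul_kEmb_zero (x : SU n) (k : U n) : act (x * kEmb k) 0 = act x 0 := by
  rw [act_mul _ _ zero_mem, act_kEmb_zero]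

/-- The stabilizer of `0` is the image of `U(n)`. -/
theorem exists_kEmb_of_act_zero (x : SU n) (h : act x 0 = 0) : ∃ k, x = kEmb k := by
  have hd := den_ne_zero x (zero_mem (n := n))
  have hn := num_eq x (zero_mem (n := n))
  rw [h, smul_zero] at hn
  have hw : ∀ i, x.1.1 (Sum.inl i) (Sum.inr ()) = 0 := fun i => by
    have := congrArg (fun v : E n => v i) hn
    simpa [num] using this
  have hc := SU_cond x
  rw [← Matrix.fromBlocks_toBlocks x.1.1] at hc
  have hB : x.1.1.toBlocks₁₂ = 0 := by
    ext i j
    exact hw i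
  rw [hB, J, Matrix.fromBlocks_conjTranspose, Matrix.fromBlocks_multiply,
    Matrix.fromBlocks_multiply, Matrix.fromBlocks_inj] at hc
  simp only [Matrix.conjTranspose_zero, mul_zero, zero_mul, add_zero, zero_add, mul_neg, mul_one,
    neg_mul, neg_zero] at hc
  obtain ⟨h11, -, h21, -⟩ := hc
  -- With vanishing upper right block, the lower left block of `xᴴ J x = J` reads `conj d * C = 0`,
  -- and `d = den x 0` is nonzero.
  have hC : x.1.1.toBlocks₂₁ = 0 := by
    ext i j
    have h3 := congrFun (congrFun h21 i) j
    simp [Matrix.mul_apply] at h3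
    rcases h3 with h3 | h3
    · exact absurd h3 (by simpa [den_zero, Matrix.toBlocks₂₂] using hd)
    · exact h3
  simp only [hC] at h11
  have h11 : x.1.1.toBlocks₁₁ᴴ * x.1.1.toBlocks₁₁ = 1 := by
    simpa using h11
  have hU : x.1.1.toBlocks₁₁ ∈ U n := by
    rw [Matrix.mem_unitaryGroup_iff', Matrix.star_eq_conjTranspose]
    exact h11
  have hdet : x.1.1.det = 1 := x.1.2
  refine ⟨⟨_, hU⟩, ?_⟩
  have hnd := norm_det_unitary ⟨_, hU⟩
  apply Subtype.ext
  apply Subtype.ext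
  rw [kEmb_val]
  rw [← Matrix.fromBlocks_toBlocks x.1.1, hB, hC, Matrix.det_fromBlocks_zero₂₁] at hdet
  conv_lhs => rw [← Matrix.fromBlocks_toBlocks x.1.1, hB, hC]
  congr 1
  ext i j
  simp only [Matrix.det_unique] at hdet
  simp only [Matrix.of_apply]
  -- The last entry `d` satisfies `det A * d = 1`; as `det A` has modulus one, `d = conj (det A)`.
  have h5 : star (x.1.1.toBlocks₁₁).det * (x.1.1.toBlocks₁₁).det = 1 := by
    have : star (x.1.1.toBlocks₁₁).det * (x.1.1.toBlocks₁₁).det =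
      (‖(x.1.1.toBlocks₁₁).det‖ ^ 2 : ℝ) := by
      rw [← Complex.normSq_eq_norm_sq, Complex.normSq_eq_conj_mul_self]; rfl
    rw [this, hnd]; simp
  calc x.1.1.toBlocks₂₂ i j = (star (x.1.1.toBlocks₁₁).det * (x.1.1.toBlocks₁₁).det) *
        x.1.1.toBlocks₂₂ i j := by rw [h5, one_mul]
    _ = star (x.1.1.toBlocks₁₁).det := by
        rw [mul_assoc]
        have : x.1.1.toBlocks₂₂ i j = x.1.1.toBlocks₂₂ default default := rfl
        rw [this, hdet, mul_one]

theorem exists_kEmb_of_act_eq {x y : SU n} (h : act x 0 = act y 0) : ∃ k, y = x * kEmb k := by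
  obtain ⟨k, hk⟩ := exists_kEmb_of_act_zero (x⁻¹ * y) (by
    rw [act_mul _ _ zero_mem, ← h, act_inv_act _ zero_mem])
  exact ⟨k, by rw [← hk]; group⟩

end Action

/-! ### Transitivity, a continuous section of the orbit map, and `x⁻¹ ∈ K x K`. -/

section Transitivity

variable {n : ℕ}

instance : SecondCountableTopology (Matrix (Fin n ⊕ Unit) (Fin n ⊕ Unit) ℂ) :=
  inferInstanceAs (SecondCountableTopology (Fin n ⊕ Unit → Fin n ⊕ Unit → ℂ))

instance : SecondCountableTopology (SU n) := by
  have h1 : Topology.IsInducing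
      (Subtype.val : Matrix.SpecialLinearGroup (Fin n ⊕ Unit) ℂ → _) :=
    Matrix.SpecialLinearGroup.isClosedEmbedding_val.isInducing
  have h2 : Topology.IsInducing
      (Subtype.val : SU n → Matrix.SpecialLinearGroup (Fin n ⊕ Unit) ℂ) :=
    Topology.IsInducing.subtypeVal
  exact (h1.comp h2).secondCountableTopology

/-! ### Transitivity of `U(n)` on spheres -/

/-- The determinant twist is undone by taking `k = ζ⁻¹ u` with `ζ ^ (n + 1) = det u`: then `det k =
ζ`, so `det k • k = u`. -/
theorem exists_kEmb_act_eq_mulVec (u : U n) :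
    ∃ k : U n, ∀ z : E n, act (kEmb k) z = WithLp.toLp 2 (u.1 *ᵥ z) := by
  obtain ⟨ζ, hζ⟩ := IsAlgClosed.exists_pow_nat_eq u.1.det (Nat.succ_pos n)
  have hn : ‖ζ‖ = 1 := by
    have h := congrArg norm hζ
    rw [norm_pow, norm_det_unitary] at h
    exact (pow_eq_one_iff_of_nonneg (norm_nonneg _) (Nat.succ_ne_zero n)).mp h
  have h0 : ζ ≠ 0 := by
    rintro rfl
    simp at hn
  have h1 : conj ζ * ζ = 1 := by
    rw [← Complex.normSq_eq_conj_mul_self, Complex.normSq_eq_norm_sq, hn]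
    simp
  have h2 : conj ζ = ζ⁻¹ := eq_inv_of_mul_eq_one_left h1
  have hk : ζ⁻¹ • u.1 ∈ U n := by
    rw [Matrix.mem_unitaryGroup_iff', star_smul, smul_mul_smul_comm,
      Matrix.mem_unitaryGroup_iff'.mp u.2]
    have : star ζ⁻¹ * ζ⁻¹ = 1 := by
      rw [star_inv₀, show star ζ = ζ⁻¹ from h2, inv_inv, mul_inv_cancel₀ h0]
    rw [this, one_smul]
  refine ⟨⟨_, hk⟩, fun z => ?_⟩
  rw [act_kEmb]
  have hd : (ζ⁻¹ • u.1).det = ζ := by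
    rw [Matrix.det_smul, ← hζ, Fintype.card_fin, pow_succ, inv_pow]
    field_simp
  simp only [hd, Matrix.smul_mulVec]
  rw [WithLp.toLp_smul, smul_smul, mul_inv_cancel₀ h0, one_smul]

/-- A unit vector extends to an orthonormal basis, whose coordinate matrix is unitary with the given
vector in the chosen column. -/
theorem exists_unitary_mulVec_single (i₀ : Fin n) {w : E n} (hw : ‖w‖ = 1) :
    ∃ u : U n, u.1 *ᵥ Pi.single i₀ 1 = w := by
  have ho : Orthonormal ℂ (Set.domRestrict {i₀} fun _ : Fin n => w) := by
    rw [orthonormal_iff_ite]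
    rintro ⟨i, hi⟩ ⟨j, hj⟩
    have : i = j := by rw [Set.mem_singleton_iff.mp hi, Set.mem_singleton_iff.mp hj]
    simp [Set.domRestrict_apply, this, inner_self_eq_norm_sq_to_K, hw]
  obtain ⟨b, hb⟩ := ho.exists_orthonormalBasis_extension_of_card_eq (by simp)
  refine ⟨⟨_, (EuclideanSpace.basisFun (Fin n) ℂ).toMatrix_orthonormalBasis_mem_unitary b⟩, ?_⟩
  rw [Matrix.mulVec_single_one]
  ext i
  simp [Module.Basis.toMatrix_apply, Matrix.col, hb i₀ rfl]

theorem exists_kEmb_act_eq {z w : E n} (h : ‖z‖ = ‖w‖) : ∃ k : U n, act (kEmb k) z = w := by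
  rcases eq_or_ne z 0 with rfl | hz
  · have : w = 0 := by simpa using h.symm
    exact ⟨1, by rw [kEmb_one, act_one, this]⟩
  have hz' : (‖z‖ : ℂ) ≠ 0 := by simpa using hz
  obtain ⟨i₀, -⟩ : ∃ i, z i ≠ 0 := by
    by_contra! hc
    exact hz (by ext i; simpa using hc i)
  have hn : ∀ v : E n, ‖v‖ = ‖z‖ → ‖(‖z‖ : ℂ)⁻¹ • v‖ = 1 := fun v hv => by
    rw [norm_smul, norm_inv, Complex.norm_real, norm_norm, hv]
    exact inv_mul_cancel₀ (by simpa using hz)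
  obtain ⟨u₁, h1⟩ := exists_unitary_mulVec_single i₀ (hn z rfl)
  obtain ⟨u₂, h2⟩ := exists_unitary_mulVec_single i₀ (hn w h.symm)
  obtain ⟨k, hk⟩ := exists_kEmb_act_eq_mulVec (u₂ * u₁⁻¹)
  refine ⟨k, ?_⟩
  rw [hk]
  have e1 : (z : Fin n → ℂ) = (‖z‖ : ℂ) • (u₁.1 *ᵥ Pi.single i₀ 1) := by
    rw [h1]
    ext i
    simp [hz']
  have e2 : (u₂ * u₁⁻¹).1 = u₂.1 * star u₁.1 := rfl
  have e3 : star u₁.1 * u₁.1 = 1 := Matrix.mem_unitaryGroup_iff'.mp u₁.2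
  ext i
  simp only
  rw [e1, Matrix.mulVec_smul, Matrix.mulVec_mulVec, e2, Matrix.mul_assoc, e3, Matrix.mul_one, h2]
  simp [hz']

/-! ### A continuous section of `x ↦ x · 0` -/

/-- The hyperbolic cosine of the boost that moves `0` to `z`. -/
def coshB (z : E n) : ℝ := (Real.sqrt (1 - ‖z‖ ^ 2))⁻¹

theorem coshB_pos {z : E n} (hz : z ∈ ball (0 : E n) 1) : 0 < coshB z :=
  inv_pos.mpr (Real.sqrt_pos.mpr (one_sub_normSq_pos hz))

theorem coshB_sq {z : E n} (hz : z ∈ ball (0 : E n) 1) : coshB z ^ 2 * (1 - ‖z‖ ^ 2) = 1 := by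
  have h := one_sub_normSq_pos hz
  rw [coshB, inv_pow, Real.sq_sqrt h.le, inv_mul_cancel₀ h.ne']

/-- The Hermitian matrix of the boost that moves `0` to `z`. -/
def boostMat (z : E n) : Matrix (Fin n ⊕ Unit) (Fin n ⊕ Unit) ℂ :=
  Matrix.fromBlocks
    (1 + ((coshB z ^ 2 / (1 + coshB z) : ℝ) : ℂ) •
      (Matrix.replicateCol Unit z * (Matrix.replicateCol Unit z)ᴴ))
    ((coshB z : ℂ) • Matrix.replicateCol Unit z) ((coshB z : ℂ) • (Matrix.replicateCol Unit z)ᴴ)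
    ((coshB z : ℂ) • 1)

theorem conjTranspose_mul_replicateCol (z : E n) :
    (Matrix.replicateCol Unit z)ᴴ * Matrix.replicateCol Unit z =
      ((‖z‖ ^ 2 : ℝ) : ℂ) • (1 : Matrix Unit Unit ℂ) := by
  ext i j
  simp [Matrix.mul_apply, EuclideanSpace.norm_sq_eq, ← Complex.normSq_eq_norm_sq,
    Complex.normSq_eq_conj_mul_self]

/-- The Schur complement of the lower right entry `c` is a rank one perturbation of the identity,
and `det (1 + Z W) = det (1 + W Z)` reduces it to a scalar. That scalar is `1 / c`, because `c² (1 -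
‖z‖²) = 1`. -/
theorem det_boostMat {z : E n} (hz : z ∈ ball (0 : E n) 1) : (boostMat z).det = 1 := by
  have hc := coshB_pos hz
  have hs := coshB_sq hz
  have hc' : (coshB z : ℂ) ≠ 0 := by exact_mod_cast hc.ne'
  set c := coshB z with hcdef
  set a : ℝ := c ^ 2 / (1 + c) with ha
  set Z := Matrix.replicateCol Unit z
  let i1 : Invertible ((c : ℂ) • (1 : Matrix Unit Unit ℂ)) :=
    ⟨(c : ℂ)⁻¹ • 1,
      by rw [smul_mul_smul_comm, inv_mul_cancel₀ hc', one_smul, mul_one],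
      by rw [smul_mul_smul_comm, mul_inv_cancel₀ hc', one_smul, mul_one]⟩
  have hi : ⅟((c : ℂ) • (1 : Matrix Unit Unit ℂ)) = (c : ℂ)⁻¹ • 1 := rfl
  have e1 : (1 + (a : ℂ) • (Z * Zᴴ)) - ((c : ℂ) • Z) * ((c : ℂ)⁻¹ • (1 : Matrix Unit Unit ℂ)) *
      ((c : ℂ) • Zᴴ) = 1 + Z * (((a - c : ℝ) : ℂ) • Zᴴ) := by
    simp only [Matrix.smul_mul, Matrix.mul_smul, Matrix.mul_one, smul_smul, Complex.ofReal_sub,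
      sub_smul]
    rw [inv_mul_cancel₀ hc', mul_one, Matrix.mul_sub, Matrix.mul_smul, Matrix.mul_smul]
    abel
  rw [boostMat, Matrix.det_fromBlocks₂₂, hi, e1, Matrix.det_one_add_mul_comm, Matrix.smul_mul,
    conjTranspose_mul_replicateCol, smul_smul]
  simp only [Matrix.det_unique, Matrix.add_apply, Matrix.smul_apply, Matrix.one_apply_eq,
    smul_eq_mul, mul_one]
  rw [← Complex.ofReal_mul, ← Complex.ofReal_one, ← Complex.ofReal_add, ← Complex.ofReal_mul]
  congr 1
  have hs' : ‖z‖ ^ 2 = 1 - 1 / c ^ 2 := by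
    field_simp
    linarith
  rw [hs', ha]
  field_simp
  ring

/-- Since `Zᴴ Z = ‖z‖²`, each block becomes a scalar identity. The coefficient `a = c² / (1 + c)` is
the one with `(1 + a Z Zᴴ)² = 1 + c² Z Zᴴ`, which is `r1`. -/
theorem boostMat_form {z : E n} (hz : z ∈ ball (0 : E n) 1) :
    (boostMat z)ᴴ * J n * boostMat z = J n := by
  have hc := coshB_pos hz
  have hs := coshB_sq hz
  have h1 : (boostMat z)ᴴ = boostMat z := by
    rw [boostMat, Matrix.fromBlocks_conjTranspose]
    simp
  rw [h1, boostMat, J]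
  set c := coshB z with hcdef
  set a : ℝ := c ^ 2 / (1 + c) with ha
  set Z := Matrix.replicateCol Unit z with hZ
  have hP : Z * Zᴴ * (Z * Zᴴ) = ((‖z‖ ^ 2 : ℝ) : ℂ) • (Z * Zᴴ) := by
    rw [Matrix.mul_assoc, ← Matrix.mul_assoc Zᴴ, conjTranspose_mul_replicateCol]
    simp
  have hP2 : Z * Zᴴ * Z = ((‖z‖ ^ 2 : ℝ) : ℂ) • Z := by
    rw [Matrix.mul_assoc, conjTranspose_mul_replicateCol]
    simp
  have hP3 : Zᴴ * (Z * Zᴴ) = ((‖z‖ ^ 2 : ℝ) : ℂ) • Zᴴ := by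
    rw [← Matrix.mul_assoc, conjTranspose_mul_replicateCol]
    simp
  have hs' : ‖z‖ ^ 2 = 1 - 1 / c ^ 2 := by
    field_simp
    linarith
  have r1 : (a : ℂ) + (a : ℂ) * ((‖z‖ ^ 2 : ℝ) * a) + a = c * c := by
    rw [← Complex.ofReal_mul, ← Complex.ofReal_mul, ← Complex.ofReal_add, ← Complex.ofReal_add,
      ← Complex.ofReal_mul, hs', ha]
    congr 1
    field_simp
    ring
  have r2 : (c : ℂ) + a * ((‖z‖ ^ 2 : ℝ) * c) = c * c := by
    rw [← Complex.ofReal_mul, ← Complex.ofReal_mul, ← Complex.ofReal_add,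
      ← Complex.ofReal_mul, hs', ha]
    congr 1
    field_simp
    ring
  have r3 : -((c : ℂ) * (c * (‖z‖ ^ 2 : ℝ))) + c * c = 1 := by
    rw [← Complex.ofReal_mul, ← Complex.ofReal_mul, ← Complex.ofReal_mul, ← Complex.ofReal_neg,
      ← Complex.ofReal_add, hs', ← Complex.ofReal_one]
    congr 1
    field_simp
    ring
  rw [Matrix.fromBlocks_multiply, Matrix.fromBlocks_multiply]
  congr 1
  · simp only [Matrix.mul_neg, Matrix.mul_one, Matrix.mul_zero, add_zero, zero_add,
      Matrix.smul_mul, Matrix.mul_smul, Matrix.neg_mul, Matrix.add_mul, Matrix.mul_add,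
      Matrix.one_mul, hP, smul_smul]
    have : (c * c : ℂ) • (Z * Zᴴ) = ((a : ℂ) + (a : ℂ) * ((‖z‖ ^ 2 : ℝ) * a) + a) • (Z * Zᴴ) := by
      rw [r1]
    rw [this]
    module
  · simp only [Matrix.mul_neg, Matrix.mul_one, Matrix.mul_zero, add_zero, zero_add,
      Matrix.smul_mul, Matrix.mul_smul, Matrix.neg_mul, Matrix.add_mul, Matrix.mul_add,
      Matrix.one_mul, hP2, smul_smul]
    have : (c * c : ℂ) • Z = ((c : ℂ) + a * ((‖z‖ ^ 2 : ℝ) * c)) • Z := by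
      rw [r2]
    rw [this]
    module
  · simp only [Matrix.mul_neg, Matrix.mul_one, Matrix.mul_zero, add_zero, zero_add,
      Matrix.smul_mul, Matrix.mul_smul, Matrix.neg_mul, Matrix.add_mul, Matrix.mul_add,
      Matrix.one_mul, hP3, smul_smul]
    have : (c * c : ℂ) • Zᴴ = ((c : ℂ) + a * ((‖z‖ ^ 2 : ℝ) * c)) • Zᴴ := by
      rw [r2]
    rw [this]
    module
  · simp only [Matrix.mul_neg, Matrix.mul_one, Matrix.mul_zero, add_zero, zero_add,
      Matrix.smul_mul, Matrix.mul_smul, Matrix.neg_mul, Matrix.add_mul, Matrix.mul_add,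
      Matrix.one_mul, conjTranspose_mul_replicateCol, smul_smul]
    have hQ : Zᴴ * Z = ((‖z‖ ^ 2 : ℝ) : ℂ) • (1 : Matrix Unit Unit ℂ) :=
      conjTranspose_mul_replicateCol z
    have h3 : (-((c : ℂ) * (c * (‖z‖ ^ 2 : ℝ))) + c * c) • (1 : Matrix Unit Unit ℂ) = 1 := by
      rw [r3, one_smul]
    rw [hQ]
    conv_rhs => rw [← h3]
    module

open Classical in
/-- A section of `x ↦ x · 0`, continuous on the ball. -/
def sec (z : E n) : SU n :=
  if h : z ∈ ball (0 : E n) 1 then ⟨⟨boostMat z, det_boostMat h⟩, boostMat_form h⟩ else 1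

theorem sec_val {z : E n} (hz : z ∈ ball (0 : E n) 1) : (sec z).1.1 = boostMat z := by
  rw [sec, dif_pos hz]

theorem act_sec {z : E n} (hz : z ∈ ball (0 : E n) 1) : act (sec z) 0 = z := by
  have hc' : (coshB z : ℂ) ≠ 0 := by exact_mod_cast (coshB_pos hz).ne'
  ext i
  simp [act, sec_val hz, boostMat, hc']

theorem continuousOn_sec : ContinuousOn (sec : E n → SU n) (ball 0 1) := by
  have hc : Continuous fun z : ball (0 : E n) 1 => (coshB z.1 : ℂ) := by
    refine Complex.continuous_ofReal.comp ?_
    refine Continuous.inv₀ (by fun_prop) fun z => ?_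
    exact (Real.sqrt_pos.mpr (one_sub_normSq_pos z.2)).ne'
  have ha : Continuous fun z : ball (0 : E n) 1 =>
      ((coshB z.1 ^ 2 / (1 + coshB z.1) : ℝ) : ℂ) := by
    have h : ∀ z : ball (0 : E n) 1, (1 + (coshB z.1 : ℂ)) ≠ 0 := fun z => by
      have := coshB_pos z.2
      exact_mod_cast (by linarith : 1 + coshB z.1 ≠ 0)
    simp only [Complex.ofReal_div, Complex.ofReal_pow, Complex.ofReal_add, Complex.ofReal_one]
    exact (hc.pow 2).div (continuous_const.add hc) h
  rw [continuousOn_iff_continuous_domRestrict]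
  refine continuous_SU_mk fun i j => ?_
  have he : ∀ i : Fin n, Continuous fun z : ball (0 : E n) 1 => z.1 i := fun i => by fun_prop
  simp only [Set.domRestrict_apply]
  have : (fun z : ball (0 : E n) 1 => (sec z.1).1.1 i j) = fun z => boostMat z.1 i j := by
    ext z
    rw [sec_val z.2]
  rw [this]
  rcases i with i | i <;> rcases j with j | j <;>
    simp only [boostMat, Matrix.fromBlocks_apply₁₁, Matrix.fromBlocks_apply₁₂,
      Matrix.fromBlocks_apply₂₁, Matrix.fromBlocks_apply₂₂, Matrix.add_apply, Matrix.smul_apply,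
      Matrix.mul_apply, Matrix.conjTranspose_apply, Matrix.replicateCol_apply, smul_eq_mul]
  · refine continuous_const.add (ha.mul (continuous_finsetSum _ fun _ _ => (he i).mul (he j).star))
  · exact hc.mul (he i)
  · exact hc.mul (he j).star
  · exact hc.mul continuous_const

/-- The Cartan-type decomposition of `G`: a boost times an element of `K`. -/
theorem exists_eq_sec_mul (x : SU n) : ∃ k : U n, x = sec (act x 0) * kEmb k :=
  exists_kEmb_of_act_eq (act_sec (act_mem x zero_mem))

/-! ### Continuity of the action, and the Gelfand pair property -/

theorem continuous_den : Continuous fun p : SU n × E n => den p.1 p.2 := by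
  unfold den
  refine (continuous_finsetSum _ fun j _ => ?_).add ((continuous_entry _ _).comp continuous_fst)
  exact ((continuous_entry _ _).comp continuous_fst).mul (by fun_prop)

theorem continuous_num : Continuous fun p : SU n × E n => num p.1 p.2 := by
  unfold num
  refine (PiLp.continuous_toLp 2 _).comp (continuous_pi fun i => ?_)
  refine (continuous_finsetSum _ fun j _ => ?_).add ((continuous_entry _ _).comp continuous_fst)
  exact ((continuous_entry _ _).comp continuous_fst).mul (by fun_prop)

theorem continuousOn_act :
    ContinuousOn (fun p : SU n × E n => act p.1 p.2) (Set.univ ×ˢ ball 0 1) := by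
  simp only [act_eq]
  exact (continuous_den.continuousOn.inv₀ fun p hp => den_ne_zero p.1 hp.2).smul
    continuous_num.continuousOn

theorem measurable_act : Measurable fun p : SU n × E n => act p.1 p.2 := by
  simp only [act_eq]
  exact continuous_den.measurable.inv.smul continuous_num.measurable

theorem continuous_act_left {z : E n} (hz : z ∈ ball (0 : E n) 1) :
    Continuous fun x : SU n => act x z :=
  continuousOn_act.comp_continuous (f := fun x => (x, z)) (by fun_prop) fun x => ⟨trivial, hz⟩

/-- As `1 - ‖x · 0‖² = ‖den x 0‖⁻²`, it suffices that `den x 0` and `den x⁻¹ 0` have equal modulus.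
Both are inverse in modulus to `den x (x⁻¹ · 0)`: one by invariance of the form at the points `x⁻¹ ·
0` and `0`, the other by the cocycle rule for `x x⁻¹ = 1`. -/
theorem norm_act_inv_zero (x : SU n) : ‖act x⁻¹ 0‖ = ‖act x 0‖ := by
  have h1 := one_sub_inner_act x (act_mem x⁻¹ (zero_mem (n := n))) zero_mem
  rw [act_act_inv _ zero_mem, inner_zero_left, inner_zero_right, sub_zero] at h1
  have h2 := den_mul x x⁻¹ (zero_mem (n := n))
  rw [mul_inv_cancel, den_one] at h2
  have h3 := congrArg norm h1
  have h4 := congrArg norm h2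
  rw [norm_div, norm_mul, RCLike.norm_conj, norm_one, eq_div_iff (by
    have := den_ne_zero x (act_mem x⁻¹ (zero_mem (n := n)))
    have := den_ne_zero x (zero_mem (n := n))
    positivity), one_mul] at h3
  rw [norm_mul, norm_one] at h4
  have h5 : ‖den x⁻¹ 0‖ = ‖den x 0‖ := by
    have h0 : ‖den x (act x⁻¹ 0)‖ ≠ 0 := by
      simpa using den_ne_zero x (act_mem x⁻¹ (zero_mem (n := n)))
    apply mul_left_cancel₀ h0
    rw [h3, mul_comm, ← h4]
  have h6 := one_sub_normSq_act x (zero_mem (n := n))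
  have h7 := one_sub_normSq_act x⁻¹ (zero_mem (n := n))
  rw [h5, ← h6] at h7
  rw [← abs_norm, ← abs_norm (act x 0), ← sq_eq_sq_iff_abs_eq_abs]
  linarith

/-- The points `x · 0` and `x⁻¹ · 0` have the same norm, hence lie in one `K`-orbit. This is the
Gelfand pair property; it yields unimodularity of `G` and invariance of all bi-`K`-invariant
functions under inversion. -/
theorem exists_inv_eq (x : SU n) : ∃ k k' : U n, x⁻¹ = kEmb k * x * kEmb k' := by
  obtain ⟨k, hk⟩ := exists_kEmb_act_eq (norm_act_inv_zero x).symm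
  rw [← act_mul _ _ zero_mem] at hk
  obtain ⟨k', hk'⟩ := exists_kEmb_of_act_eq hk
  exact ⟨k, k', hk'⟩

/-- Compactness of `K` and continuity of the section make the orbit map proper over smaller closed
balls. This gives the test set `smallSet` finite Haar measure. -/
theorem isCompact_norm_act_le {r : ℝ} (hr : r < 1) :
    IsCompact {x : SU n | ‖act x 0‖ ≤ r} := by
  have h : {x : SU n | ‖act x 0‖ ≤ r} =
      (fun p : E n × U n => sec p.1 * kEmb p.2) '' (closedBall 0 r ×ˢ Set.univ) := by
    ext x
    constructor
    · intro hx
      obtain ⟨k, hk⟩ := exists_eq_sec_mul x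
      exact ⟨(act x 0, k), ⟨by simpa using hx, trivial⟩, hk.symm⟩
    · rintro ⟨⟨z, k⟩, ⟨hz, -⟩, rfl⟩
      have hz' : z ∈ ball (0 : E n) 1 := closedBall_subset_ball hr hz
      simpa [act_mul_kEmb_zero, act_sec hz'] using hz
  rw [h]
  refine ((isCompact_closedBall _ _).prod isCompact_univ).image_of_continuousOn ?_
  refine ContinuousOn.mul ?_ (continuous_kEmb.comp continuous_snd).continuousOn
  exact continuousOn_sec.comp continuousOn_fst fun p hp => closedBall_subset_ball hr hp.1

end Transitivity

/-! ### The Möbius invariant measure and the normalization of Haar measure. -/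

section Measures

variable {n : ℕ}

/-! ### The derivative of the action and the invariance of `λ` -/

/-- The matrix of the complex derivative of `z ↦ x · z`. -/
def actDerivMat (x : SU n) (z : E n) : Matrix (Fin n) (Fin n) ℂ :=
  (den x z)⁻¹ • (x.1.1.toBlocks₁₁ -
    Matrix.replicateCol Unit (num x z) * ((den x z)⁻¹ • (1 : Matrix Unit Unit ℂ)) *
      x.1.1.toBlocks₂₁)

/-- The derivative matrix is `q⁻¹` times a Schur complement in `x` multiplied by a unipotent matrix,
with `q = den x z`. That product has determinant one, so the Schur complement contributes `q⁻¹` and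
the scalar factor `q⁻ⁿ`. -/
theorem det_actDerivMat (x : SU n) {z : E n} (hz : z ∈ ball (0 : E n) 1) :
    (actDerivMat x z).det = ((den x z) ^ (n + 1))⁻¹ := by
  have hq := den_ne_zero x hz
  set q := den x z with hqd
  let i1 : Invertible (q • (1 : Matrix Unit Unit ℂ)) :=
    ⟨q⁻¹ • 1, by rw [smul_mul_smul_comm, inv_mul_cancel₀ hq, one_smul, mul_one],
      by rw [smul_mul_smul_comm, mul_inv_cancel₀ hq, one_smul, mul_one]⟩
  have hi : ⅟(q • (1 : Matrix Unit Unit ℂ)) = q⁻¹ • 1 := rfl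
  have h1 : x.1.1 * Matrix.fromBlocks 1 (Matrix.replicateCol Unit z) 0 1 =
      Matrix.fromBlocks x.1.1.toBlocks₁₁ (Matrix.replicateCol Unit (num x z)) x.1.1.toBlocks₂₁
        (q • 1) := by
    conv_lhs => rw [← Matrix.fromBlocks_toBlocks x.1.1]
    rw [Matrix.fromBlocks_multiply]
    congr 1
    · simp
    · ext i j
      simp [num, Matrix.mul_apply, Matrix.toBlocks₁₁, Matrix.toBlocks₁₂]
    · simp
    · ext i j
      simp [hqd, den, Matrix.mul_apply, Matrix.toBlocks₂₁, Matrix.toBlocks₂₂]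
  have h2 := congrArg Matrix.det h1
  have hx : x.1.1.det = 1 := x.1.2
  rw [Matrix.det_mul, hx, Matrix.det_fromBlocks_zero₂₁, Matrix.det_fromBlocks₂₂, hi] at h2
  simp only [Matrix.det_one, mul_one, Matrix.det_unique, Matrix.smul_apply, Matrix.one_apply_eq,
    smul_eq_mul] at h2
  rw [actDerivMat, Matrix.det_smul, Fintype.card_fin, pow_succ, mul_inv, inv_pow]
  congr 1
  exact eq_inv_of_mul_eq_one_right h2.symm

theorem hasFDerivAt_den (x : SU n) (z : E n) :
    HasFDerivAt (den x) (∑ j, x.1.1 (Sum.inr ()) (Sum.inl j) •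
      (EuclideanSpace.proj j : E n →L[ℂ] ℂ)) z := by
  unfold den
  refine HasFDerivAt.add_const _ (HasFDerivAt.fun_sum fun j _ => ?_)
  exact ((EuclideanSpace.proj j : E n →L[ℂ] ℂ).hasFDerivAt).const_mul _

theorem hasFDerivAt_num (x : SU n) (z : E n) :
    HasFDerivAt (num x) (Matrix.toEuclideanCLM (𝕜 := ℂ) x.1.1.toBlocks₁₁ : E n →L[ℂ] E n) z := by
  have h : num x = fun z => Matrix.toEuclideanCLM (𝕜 := ℂ) x.1.1.toBlocks₁₁ z + num x 0 := by
    ext z i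
    simp [num, Matrix.mulVec, dotProduct, Matrix.toBlocks₁₁, Matrix.ofLp_toEuclideanCLM]
  rw [h]
  exact (ContinuousLinearMap.hasFDerivAt _).add_const _

theorem hasFDerivAt_act (x : SU n) {z : E n} (hz : z ∈ ball (0 : E n) 1) :
    HasFDerivAt (act x) (Matrix.toEuclideanCLM (𝕜 := ℂ) (actDerivMat x z) : E n →L[ℂ] E n) z := by
  have hq := den_ne_zero x hz
  have h : act x = fun z => (den x z)⁻¹ • num x z := funext (act_eq x)
  rw [h]
  have h1 := ((hasDerivAt_inv hq).comp_hasFDerivAt z (hasFDerivAt_den x z)).smul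
    (hasFDerivAt_num x z)
  refine h1.congr_fderiv ?_
  ext v i
  simp [actDerivMat, Matrix.ofLp_toEuclideanCLM, Matrix.smul_mulVec, Matrix.sub_mulVec,
    Matrix.mulVec, dotProduct, Matrix.mul_apply, Matrix.toBlocks₂₁, Finset.mul_sum, Finset.sum_mul,
    Finset.sum_sub_distrib, mul_sub, sub_mul]
  rw [sub_eq_add_neg]
  congr 2
  refine Finset.sum_congr rfl fun j _ => ?_
  field_simp

theorem differentiableOn_act (x : SU n) : DifferentiableOn ℂ (act x) (ball (0 : E n) 1) :=
  fun _ hz => (hasFDerivAt_act x hz).differentiableAt.differentiableWithinAt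

/-- The real determinant of a complex linear map is the squared modulus of its complex determinant.
-/
theorem abs_det_actDeriv (x : SU n) {z : E n} (hz : z ∈ ball (0 : E n) 1) :
    |((Matrix.toEuclideanCLM (𝕜 := ℂ) (actDerivMat x z) : E n →L[ℂ] E n).restrictScalars ℝ).det| =
      ((‖den x z‖ ^ 2) ^ (n + 1))⁻¹ := by
  have h1 : LinearMap.det ((Matrix.toEuclideanCLM (𝕜 := ℂ) (actDerivMat x z) : E n →L[ℂ] E n) :
      E n →ₗ[ℂ] E n) = (actDerivMat x z).det := by
    have : ((Matrix.toEuclideanCLM (𝕜 := ℂ) (actDerivMat x z) : E n →L[ℂ] E n) :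
      E n →ₗ[ℂ] E n) = Matrix.toLin (EuclideanSpace.basisFun (Fin n) ℂ).toBasis
        (EuclideanSpace.basisFun (Fin n) ℂ).toBasis (actDerivMat x z) := by
      rw [← Matrix.toEuclideanLin_eq_toLin_orthonormal]
      rfl
    rw [this, LinearMap.det_toLin]
  have h2 : ((Matrix.toEuclideanCLM (𝕜 := ℂ) (actDerivMat x z) : E n →L[ℂ] E n).restrictScalars
      ℝ).det = Algebra.norm ℝ (LinearMap.det ((Matrix.toEuclideanCLM (𝕜 := ℂ) (actDerivMat x z) :
        E n →L[ℂ] E n) : E n →ₗ[ℂ] E n)) := LinearMap.det_restrictScalars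
  rw [h2, h1, det_actDerivMat x hz, Algebra.norm_complex_apply, Complex.normSq_eq_norm_sq,
    abs_of_nonneg (by positivity), norm_inv, norm_pow, inv_pow, ← pow_mul, ← pow_mul, mul_comm]

theorem act_injOn (x : SU n) : Set.InjOn (act x) (ball (0 : E n) 1) := fun z hz w hw h => by
  rw [← act_inv_act x hz, ← act_inv_act x hw, h]

theorem act_image_ball (x : SU n) : act x '' ball (0 : E n) 1 = ball 0 1 := by
  apply Set.Subset.antisymm
  · rintro _ ⟨z, hz, rfl⟩
    exact act_mem x hz
  · exact fun z hz => ⟨act x⁻¹ z, act_mem _ hz, act_act_inv x hz⟩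

theorem measurable_act_left (x : SU n) : Measurable fun z : E n => act x z := by
  have h : Measurable fun z : E n => ((x, z) : SU n × E n) := measurable_prodMk_left
  exact (measurable_act.comp h :)

theorem measurable_act_right (z : E n) : Measurable fun x : SU n => act x z := by
  have h : Measurable fun x : SU n => ((x, z) : SU n × E n) := measurable_prodMk_right
  exact (measurable_act.comp h :)

theorem measurable_orbit : Measurable fun x : SU n => act x (0 : E n) := measurable_act_right 0

/-- The volume of the unit ball. -/
def vball (n : ℕ) : ℝ≥0∞ := (volume : Measure (E n)) (ball 0 1)

theorem vball_ne_zero : vball n ≠ 0 := (measure_ball_pos _ _ one_pos).ne'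
theorem vball_ne_top : vball n ≠ ∞ := measure_ball_lt_top.ne

theorem measurable_invDensity :
    Measurable fun z : E n => ENNReal.ofReal (((1 - ‖z‖ ^ 2) ^ (n + 1))⁻¹) := by
  fun_prop

theorem lintegral_invMeasure {f : E n → ℝ≥0∞} (hf : Measurable f) :
    ∫⁻ z, f z ∂invMeasure n = (vball n)⁻¹ *
      ∫⁻ z in ball (0 : E n) 1, ENNReal.ofReal (((1 - ‖z‖ ^ 2) ^ (n + 1))⁻¹) * f z := by
  rw [invMeasure, lintegral_withDensity_eq_lintegral_mul _ measurable_invDensity hf, lebBall,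
    lintegral_smul_measure]
  rfl

/-- In the change of variables the Jacobian `‖den x z‖^(-2(n+1))` cancels the factor by which `(1 -
‖z‖²)^(-(n+1))` changes under the action. -/
theorem measurePreserving_act (x : SU n) :
    MeasurePreserving (act x) (invMeasure n) (invMeasure n) := by
  refine ⟨measurable_act_left x, Measure.ext_of_lintegral _ fun f hf => ?_⟩
  rw [lintegral_map hf (measurable_act_left x), lintegral_invMeasure hf,
    lintegral_invMeasure (f := fun z => f (act x z)) (hf.comp (measurable_act_left x))]
  congr 1
  have h := lintegral_image_eq_lintegral_abs_det_fderiv_mul (volume : Measure (E n))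
    (measurableSet_ball (x := 0) (ε := 1))
    (fun z hz => ((hasFDerivAt_act x hz).restrictScalars ℝ).hasFDerivWithinAt) (act_injOn x)
    (fun z => ENNReal.ofReal (((1 - ‖z‖ ^ 2) ^ (n + 1))⁻¹) * f z)
  rw [act_image_ball] at h
  rw [h]
  refine setLIntegral_congr_fun measurableSet_ball fun z hz => ?_
  rw [abs_det_actDeriv x hz, ← mul_assoc, ← ENNReal.ofReal_mul (by positivity),
    one_sub_normSq_act x hz]
  congr 2
  have : ‖den x z‖ ≠ 0 := by simpa using den_ne_zero x hz
  rw [div_pow, inv_div]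
  field_simp

theorem ae_mem_ball_lebBall : ∀ᵐ z ∂lebBall n, z ∈ ball (0 : E n) 1 := by
  rw [lebBall]
  exact Measure.ae_smul_measure (ae_restrict_mem measurableSet_ball) _

theorem ae_mem_ball_inv : ∀ᵐ z ∂invMeasure n, z ∈ ball (0 : E n) 1 :=
  (withDensity_absolutelyContinuous _ _).ae_le ae_mem_ball_lebBall

instance : IsProbabilityMeasure (lebBall n) := by
  constructor
  rw [lebBall, Measure.smul_apply, Measure.restrict_apply_univ, smul_eq_mul]
  exact ENNReal.inv_mul_cancel vball_ne_zero vball_ne_top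

instance : SigmaFinite (invMeasure n) := by
  unfold invMeasure
  exact SigmaFinite.withDensity_ofReal _

theorem invMeasure_ball_lt_top {r : ℝ} (hr : r < 1) : invMeasure n (closedBall 0 r) < ∞ := by
  rw [invMeasure, withDensity_apply _ measurableSet_closedBall]
  rcases lt_or_ge r 0 with h0 | h0
  · simp [closedBall_eq_empty.mpr h0]
  have h : ∀ z ∈ closedBall (0 : E n) r, ENNReal.ofReal (((1 - ‖z‖ ^ 2) ^ (n + 1))⁻¹) ≤
      ENNReal.ofReal (((1 - r ^ 2) ^ (n + 1))⁻¹) := fun z hz => by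
    have hz' : ‖z‖ ≤ r := by simpa using hz
    have h1 : 0 < 1 - r ^ 2 := by nlinarith
    apply ENNReal.ofReal_le_ofReal
    gcongr
  calc _ ≤ ∫⁻ _ in closedBall (0 : E n) r, ENNReal.ofReal (((1 - r ^ 2) ^ (n + 1))⁻¹) ∂lebBall n :=
        setLIntegral_mono measurable_const h
    _ < ∞ := by
        rw [lintegral_const]
        exact ENNReal.mul_lt_top ENNReal.ofReal_lt_top (measure_lt_top _ _)

theorem invMeasure_pos_of_isOpen {s : Set (E n)} (hs : IsOpen s) (h1 : s ⊆ ball 0 1)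
    (hne : s.Nonempty) : 0 < invMeasure n s := by
  rw [pos_iff_ne_zero, invMeasure, Ne, withDensity_apply_eq_zero' measurable_invDensity.aemeasurable]
  have h2 : {z : E n | ENNReal.ofReal (((1 - ‖z‖ ^ 2) ^ (n + 1))⁻¹) ≠ 0} ∩ s = s := by
    refine Set.inter_eq_right.mpr fun z hz => ?_
    have := one_sub_normSq_pos (h1 hz)
    simp only [Set.mem_ofPred_eq, ne_eq, ENNReal.ofReal_eq_zero, not_le]
    positivity
  rw [h2, lebBall, Measure.smul_apply, Measure.restrict_apply hs.measurableSet,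
    Set.inter_eq_left.mpr h1, smul_eq_mul]
  exact mul_ne_zero (ENNReal.inv_ne_zero.mpr vball_ne_top) (hs.measure_pos _ hne).ne'

/-! ### `G` is unimodular -/

/-- The points of `G` that move `0` by less than `1/2`. -/
def smallSet (n : ℕ) : Set (SU n) := {x | act x 0 ∈ ball (0 : E n) (1 / 2)}

theorem isOpen_smallSet : IsOpen (smallSet n) :=
  isOpen_ball.preimage (continuous_act_left zero_mem)

theorem haar_smallSet_pos : 0 < (Measure.haar : Measure (SU n)) (smallSet n) :=
  isOpen_smallSet.measure_pos _ ⟨1, by simp [smallSet, act_one]⟩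

theorem haar_smallSet_lt_top : (Measure.haar : Measure (SU n)) (smallSet n) < ∞ := by
  refine lt_of_le_of_lt (measure_mono fun x hx => ?_)
    (isCompact_norm_act_le (n := n) (r := 1 / 2) (by norm_num)).measure_lt_top
  have : ‖act x (0 : E n)‖ < 1 / 2 := by simpa [smallSet] using hx
  exact this.le

/-- Right translation by `K` fixes `smallSet`, whose Haar measure is positive and finite. -/
theorem modularCharacterFun_kEmb (k : U n) : Measure.modularCharacterFun (kEmb k) = 1 := by
  have h := Measure.map_right_mul_eq_modularCharacterFun_smul (Measure.haar : Measure (SU n))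
    (kEmb k)
  have h1 := congrArg (fun m : Measure (SU n) => m (smallSet n)) h
  simp only [Measure.smul_apply] at h1
  rw [Measure.map_apply (measurable_mul_const _) isOpen_smallSet.measurableSet] at h1
  have h2 : (fun x => x * kEmb k) ⁻¹' smallSet n = smallSet n := by
    ext x
    simp [smallSet, act_mul_kEmb_zero]
  rw [h2] at h1
  have h3 : (1 : ℝ≥0∞) * (Measure.haar : Measure (SU n)) (smallSet n) =
      (Measure.modularCharacterFun (kEmb k) : ℝ≥0∞) * Measure.haar (smallSet n) := by
    rw [one_mul]
    exact h1
  have h4 := (ENNReal.mul_left_inj haar_smallSet_pos.ne' haar_smallSet_lt_top.ne).mp h3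
  exact_mod_cast h4.symm

/-- From `x⁻¹ = k x k'` the modular character takes the same value at `x` and `x⁻¹`, so its square
is one. -/
theorem modularCharacterFun_eq_one (x : SU n) : Measure.modularCharacterFun x = 1 := by
  obtain ⟨k, k', h⟩ := exists_inv_eq x
  have h1 := congrArg Measure.modularCharacterFun h
  rw [Measure.modularCharacterFun_map_mul, Measure.modularCharacterFun_map_mul,
    modularCharacterFun_kEmb, modularCharacterFun_kEmb, one_mul, mul_one] at h1
  have h2 : Measure.modularCharacterFun (x⁻¹ * x) = 1 := by
    rw [inv_mul_cancel, Measure.modularCharacterFun_map_one]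
  rw [Measure.modularCharacterFun_map_mul, h1, ← sq] at h2
  exact (pow_eq_one_iff_of_nonneg zero_le two_ne_zero).mp h2

instance : (Measure.haar : Measure (SU n)).IsMulRightInvariant := by
  refine ⟨fun g => ?_⟩
  rw [Measure.map_right_mul_eq_modularCharacterFun_smul, modularCharacterFun_eq_one, one_smul]

/-- The inverted measure is again left invariant, hence a multiple of Haar measure. The factor is
one because `smallSet` is stable under inversion. -/
instance : (Measure.haar : Measure (SU n)).IsInvInvariant := by
  refine ⟨?_⟩
  have hf : IsFiniteMeasureOnCompacts (Measure.haar : Measure (SU n)).inv :=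
    ⟨fun K hK => by
      rw [Measure.inv_apply]
      exact hK.inv.measure_lt_top⟩
  have h := Measure.isMulLeftInvariant_eq_smul (Measure.haar : Measure (SU n)).inv Measure.haar
  set c := Measure.haarScalarFactor (Measure.haar : Measure (SU n)).inv Measure.haar
  have h1 := congrArg (fun m : Measure (SU n) => m (smallSet n)) h
  simp only [Measure.smul_apply, Measure.inv_apply] at h1
  have h2 : (smallSet n)⁻¹ = smallSet n := by
    ext x
    simp [smallSet, norm_act_inv_zero]
  rw [h2] at h1
  have h3 : (1 : ℝ≥0∞) * (Measure.haar : Measure (SU n)) (smallSet n) =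
      (c : ℝ≥0∞) * Measure.haar (smallSet n) := by
    rw [one_mul]
    exact h1
  have h4 := (ENNReal.mul_left_inj haar_smallSet_pos.ne' haar_smallSet_lt_top.ne).mp h3
  have h5 : c = 1 := by exact_mod_cast h4.symm
  rw [h, h5, one_smul]

/-- The normalizing factor of `μ_G`. -/
def haarFactor (n : ℕ) : ℝ≥0∞ :=
  invMeasure n (ball 0 (1 / 2)) / (Measure.haar : Measure (SU n)) (smallSet n)

theorem muG_eq : muG n = haarFactor n • Measure.haar := rfl

theorem invMeasure_half_pos : 0 < invMeasure n (ball 0 (1 / 2)) :=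
  invMeasure_pos_of_isOpen isOpen_ball (ball_subset_ball (by norm_num)) ⟨0, by simp⟩

theorem invMeasure_half_lt_top : invMeasure n (ball 0 (1 / 2)) < ∞ :=
  lt_of_le_of_lt (measure_mono ball_subset_closedBall) (invMeasure_ball_lt_top (by norm_num))

theorem haarFactor_ne_zero : haarFactor n ≠ 0 :=
  ENNReal.div_ne_zero.mpr ⟨invMeasure_half_pos.ne', haar_smallSet_lt_top.ne⟩

theorem haarFactor_ne_top : haarFactor n ≠ ∞ :=
  ENNReal.div_ne_top invMeasure_half_lt_top.ne haar_smallSet_pos.ne'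

instance : (muG n).IsHaarMeasure := by
  rw [muG_eq]
  exact Measure.IsHaarMeasure.smul _ haarFactor_ne_zero haarFactor_ne_top

instance : (muG n).IsMulRightInvariant := by
  refine ⟨fun g => ?_⟩
  rw [muG_eq, Measure.map_smul, map_mul_right_eq_self]

instance : (muG n).IsInvInvariant := by
  refine ⟨?_⟩
  rw [muG_eq, Measure.inv, Measure.map_smul, Measure.map_inv_eq_self]

theorem lintegral_haar_act {f : E n → ℝ≥0∞} {z : E n} (hz : z ∈ ball (0 : E n) 1) :
    ∫⁻ x : SU n, f (act x z) ∂Measure.haar = ∫⁻ x : SU n, f (act x 0) ∂Measure.haar := by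
  have h := lintegral_mul_right_eq_self (μ := (Measure.haar : Measure (SU n)))
    (fun x => f (act x 0)) (sec z)
  rw [← h]
  simp only [act_mul _ _ zero_mem, act_sec hz]

/-- The uniqueness argument for invariant measures: the double integral of `f(x · z) g(z)` is
evaluated in both orders. One order uses right invariance of Haar measure to replace `z` by `0`; the
other moves `x` onto `g` by invariance of `λ` and then inverts `x`. -/
theorem lintegral_orbit_mul {f g : E n → ℝ≥0∞} (hf : Measurable f) (hg : Measurable g) :
    (∫⁻ x : SU n, f (act x 0) ∂Measure.haar) * ∫⁻ z, g z ∂invMeasure n =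
      (∫⁻ z, f z ∂invMeasure n) * ∫⁻ x : SU n, g (act x 0) ∂Measure.haar := by
  have hm : Measurable fun p : E n × SU n => act p.2 p.1 :=
    (measurable_act.comp measurable_swap :)
  have hm0 : Measurable fun p : E n × SU n => ((p.2⁻¹, p.1) : SU n × E n) :=
    (measurable_snd.inv).prodMk measurable_fst
  have hm' : Measurable fun p : E n × SU n => act p.2⁻¹ p.1 :=
    (measurable_act.comp hm0 :)
  calc _ = ∫⁻ z, (∫⁻ x : SU n, f (act x z) ∂Measure.haar) * g z ∂invMeasure n := by
        rw [← lintegral_const_mul _ hg]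
        refine lintegral_congr_ae ?_
        filter_upwards [ae_mem_ball_inv] with z hz
        rw [lintegral_haar_act hz]
    _ = ∫⁻ z, ∫⁻ x : SU n, f (act x z) * g z ∂Measure.haar ∂invMeasure n := by
        refine lintegral_congr fun z => ?_
        have h : Measurable fun x : SU n => f (act x z) := hf.comp (measurable_act_right z)
        rw [lintegral_mul_const _ h]
    _ = ∫⁻ x : SU n, ∫⁻ z, f (act x z) * g z ∂invMeasure n ∂Measure.haar :=
        lintegral_lintegral_swap (((hf.comp hm).mul (hg.comp measurable_fst)).aemeasurable)
    _ = ∫⁻ x : SU n, ∫⁻ z, f z * g (act x⁻¹ z) ∂invMeasure n ∂Measure.haar := by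
        refine lintegral_congr fun x => ?_
        rw [← (measurePreserving_act x).lintegral_comp (f := fun z => f z * g (act x⁻¹ z))
          (hf.mul (hg.comp (measurable_act_left _)))]
        refine lintegral_congr_ae ?_
        filter_upwards [ae_mem_ball_inv] with z hz
        rw [act_inv_act x hz]
    _ = ∫⁻ z, ∫⁻ x : SU n, f z * g (act x⁻¹ z) ∂Measure.haar ∂invMeasure n :=
        (lintegral_lintegral_swap
          (((hf.comp measurable_fst).mul (hg.comp hm')).aemeasurable)).symm
    _ = ∫⁻ z, f z * ∫⁻ x : SU n, g (act x 0) ∂Measure.haar ∂invMeasure n := by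
        refine lintegral_congr_ae ?_
        filter_upwards [ae_mem_ball_inv] with z hz
        have h : Measurable fun x : SU n => g (act x⁻¹ z) :=
          hg.comp ((measurable_act_right z).comp measurable_inv)
        rw [lintegral_const_mul _ h,
          lintegral_inv_eq_self (μ := (Measure.haar : Measure (SU n))) (fun x => g (act x z)),
          lintegral_haar_act hz]
    _ = _ := lintegral_mul_const _ hf

/-- The defining property `∫_G f(x · 0) dμ_G(x) = ∫_𝔹 f dλ` of `μ_G`. -/
theorem measurePreserving_orbit :
    MeasurePreserving (fun x : SU n => act x 0) (muG n) (invMeasure n) := by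
  refine ⟨measurable_orbit, Measure.ext_of_lintegral _ fun f hf => ?_⟩
  rw [lintegral_map hf measurable_orbit, muG_eq, lintegral_smul_measure, smul_eq_mul, haarFactor]
  -- Comparison with the indicator of the ball of radius `1/2`, the set on which `μ_G` was
  -- normalized.
  have h := lintegral_orbit_mul hf
    ((measurable_indicator_const_iff (1 : ℝ≥0∞)).mpr
      (measurableSet_ball (x := (0 : E n)) (ε := 1 / 2)))
  have h1 : ∫⁻ x : SU n, (ball (0 : E n) (1 / 2)).indicator (fun _ => (1 : ℝ≥0∞)) (act x 0)
      ∂Measure.haar = Measure.haar (smallSet n) := by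
    rw [← lintegral_indicator_one isOpen_smallSet.measurableSet]
    rfl
  rw [h1, lintegral_indicator_const measurableSet_ball, one_mul] at h
  rw [ENNReal.div_eq_inv_mul, mul_assoc, mul_comm (invMeasure n _), h,
    mul_comm _ (Measure.haar _), ← mul_assoc,
    ENNReal.inv_mul_cancel haar_smallSet_pos.ne' haar_smallSet_lt_top.ne, one_mul]

end Measures

/-! ### The measures `μ_ν`, polar coordinates and beta integrals. -/

section RadialMoments

variable {n : ℕ} {ν : ℝ}

/-! ### The probability measures `μ_ν` -/

theorem cNu_pos (hν : (n : ℝ) < ν) : 0 < cNu n ν := by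
  have h0 : (0 : ℝ) ≤ n := Nat.cast_nonneg n
  have h1 := Real.Gamma_pos_of_pos (show 0 < ν by linarith)
  have h2 := Real.Gamma_pos_of_pos (show 0 < ν - n by linarith)
  have h3 : (0 : ℝ) < n.factorial := by exact_mod_cast n.factorial_pos
  unfold cNu
  positivity

theorem measurable_muDensity (a b : ℝ) :
    Measurable fun z : E n => ENNReal.ofReal (a * (1 - ‖z‖ ^ 2) ^ b) := by
  fun_prop

/-- Relative to `λ` the weight has exponent `(ν - n - 1) + (n + 1) = ν`; in this form the invariance
of `λ` can be used. -/
theorem muNu_eq_withDensity (hν : (n : ℝ) < ν) : muNu n ν =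
    (invMeasure n).withDensity fun z => ENNReal.ofReal (cNu n ν * (1 - ‖z‖ ^ 2) ^ ν) := by
  rw [muNu, invMeasure, ← withDensity_mul _ measurable_invDensity (measurable_muDensity _ _)]
  refine withDensity_congr_ae ?_
  filter_upwards [ae_mem_ball_lebBall] with z hz
  have h := one_sub_normSq_pos hz
  have hc := cNu_pos hν
  rw [Pi.mul_apply, ← ENNReal.ofReal_mul (by positivity)]
  congr 1
  rw [show ν - n - 1 = ν - ((n + 1 : ℕ) : ℝ) by push_cast; ring, Real.rpow_sub h,
    Real.rpow_natCast]
  field_simp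

theorem ae_mem_ball_mu : ∀ᵐ z ∂muNu n ν, z ∈ ball (0 : E n) 1 :=
  (withDensity_absolutelyContinuous _ _).ae_le ae_mem_ball_lebBall

theorem lintegral_muNu (hν : (n : ℝ) < ν) {f : E n → ℝ≥0∞} (hf : Measurable f) :
    ∫⁻ z, f z ∂muNu n ν =
      ∫⁻ z, ENNReal.ofReal (cNu n ν * (1 - ‖z‖ ^ 2) ^ ν) * f z ∂invMeasure n := by
  rw [muNu_eq_withDensity hν,
    lintegral_withDensity_eq_lintegral_mul _ (measurable_muDensity _ _) hf]
  rfl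

theorem integral_muNu (hν : (n : ℝ) < ν) (f : E n → ℂ) :
    ∫ z, f z ∂muNu n ν = ∫ z, ((cNu n ν * (1 - ‖z‖ ^ 2) ^ ν : ℝ) : ℂ) * f z ∂invMeasure n := by
  rw [muNu_eq_withDensity hν, integral_withDensity_eq_integral_toReal_smul
    (measurable_muDensity _ _) (Filter.Eventually.of_forall fun _ => ENNReal.ofReal_lt_top)]
  refine integral_congr_ae ?_
  filter_upwards [ae_mem_ball_inv] with z hz
  have h := one_sub_normSq_pos hz
  have hc := cNu_pos hν
  rw [ENNReal.toReal_ofReal (by positivity), Complex.real_smul]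

theorem restrict_absolutelyContinuous_muNu (hν : (n : ℝ) < ν) :
    (volume : Measure (E n)).restrict (ball 0 1) ≪ muNu n ν := by
  have h1 : (volume : Measure (E n)).restrict (ball 0 1) ≪ lebBall n :=
    Measure.absolutelyContinuous_smul (ENNReal.inv_ne_zero.mpr vball_ne_top)
  refine h1.trans (withDensity_absolutelyContinuous' (measurable_muDensity _ _).aemeasurable ?_)
  filter_upwards [ae_mem_ball_lebBall] with z hz
  have h := one_sub_normSq_pos hz
  have hc := cNu_pos hν
  simp only [ne_eq, ENNReal.ofReal_eq_zero, not_le]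
  positivity

theorem eqOn_ball_of_ae_eq (hν : (n : ℝ) < ν) {X : Type*} [TopologicalSpace X] [T2Space X]
    {f g : E n → X} (h : f =ᵐ[muNu n ν] g) (hf : ContinuousOn f (ball 0 1))
    (hg : ContinuousOn g (ball 0 1)) : Set.EqOn f g (ball 0 1) :=
  Measure.eqOn_open_of_ae_eq ((restrict_absolutelyContinuous_muNu hν).ae_le h) isOpen_ball hf hg

theorem measurePreserving_kEmb_mu (hν : (n : ℝ) < ν) (k : U n) :
    MeasurePreserving (act (kEmb k)) (muNu n ν) (muNu n ν) := by
  refine ⟨measurable_act_left _, Measure.ext_of_lintegral _ fun f hf => ?_⟩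
  have hf' : Measurable fun z => f (act (kEmb k) z) := hf.comp (measurable_act_left _)
  rw [lintegral_map hf (measurable_act_left _), lintegral_muNu hν hf, lintegral_muNu hν hf',
    ← (measurePreserving_act (kEmb k)).lintegral_comp
      (f := fun z => ENNReal.ofReal (cNu n ν * (1 - ‖z‖ ^ 2) ^ ν) * f z)
      ((measurable_muDensity _ _).mul hf)]
  simp only [norm_act_kEmb]

/-! ### Polar coordinates -/

theorem finrank_E : Module.finrank ℝ (E n) = 2 * n := by
  rw [← Module.finrank_mul_finrank ℝ ℂ (E n), Complex.finrank_real_complex]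
  simp

theorem nontrivial_E (hn : 1 ≤ n) : Nontrivial (E n) := by
  have : NeZero n := ⟨by omega⟩
  infer_instance

/-- For a product of an angular and a radial factor, Fubini in polar coordinates separates the
integral; the exponent is the real dimension `2n` less one. -/
theorem integral_polar (hn : 1 ≤ n) {F H : E n → ℂ} {a : ℝ → ℂ}
    (h : ∀ r : ℝ, 0 < r → ∀ ζ : E n, ‖ζ‖ = 1 → F (r • ζ) = a r * H ζ) :
    ∫ z, F z = (∫ ζ : sphere (0 : E n) 1, H ζ ∂(volume : Measure (E n)).toSphere) *
      ∫ r in Set.Ioi (0 : ℝ), ((r ^ (2 * n - 1) : ℝ) : ℂ) * a r := by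
  have := nontrivial_E hn
  set μ : Measure (E n) := volume
  calc ∫ z, F z ∂μ = ∫ z : ({(0)}ᶜ : Set (E n)), F z.1 ∂(μ.comap (↑)) := by
        rw [integral_subtype_comap (measurableSet_singleton _).compl fun x => F x,
          restrict_compl_singleton]
    _ = ∫ p : sphere (0 : E n) 1 × Set.Ioi (0 : ℝ), F ((p.2 : ℝ) • (p.1 : E n))
          ∂(μ.toSphere.prod (Measure.volumeIoiPow (Module.finrank ℝ (E n) - 1))) := by
        rw [← (μ.measurePreserving_homeomorphUnitSphereProd).integral_comp
          (Homeomorph.measurableEmbedding _)]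
        refine integral_congr_ae (Filter.Eventually.of_forall fun z => ?_)
        have hz : ‖z.1‖ ≠ 0 := norm_ne_zero_iff.mpr z.2
        simp only [homeomorphUnitSphereProd_apply_snd_coe, homeomorphUnitSphereProd_apply_fst_coe]
        rw [smul_smul, mul_inv_cancel₀ hz, one_smul]
    _ = ∫ p : sphere (0 : E n) 1 × Set.Ioi (0 : ℝ), H p.1 * a p.2
          ∂(μ.toSphere.prod (Measure.volumeIoiPow (Module.finrank ℝ (E n) - 1))) := by
        refine integral_congr_ae (Filter.Eventually.of_forall fun p => ?_)
        simp only
        rw [h p.2 p.2.2 p.1 (by simp), mul_comm]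
    _ = (∫ ζ : sphere (0 : E n) 1, H ζ ∂μ.toSphere) *
          ∫ r : Set.Ioi (0 : ℝ), a r ∂Measure.volumeIoiPow (Module.finrank ℝ (E n) - 1) :=
        integral_prod_mul (fun ζ : sphere (0 : E n) 1 => H ζ) fun r : Set.Ioi (0 : ℝ) => a r
    _ = _ := by
        congr 1
        simp only [Measure.volumeIoiPow, ENNReal.ofReal]
        rw [integral_withDensity_eq_integral_smul, ← integral_subtype_comap measurableSet_Ioi
          fun r : ℝ => ((r ^ (2 * n - 1) : ℝ) : ℂ) * a r]
        · refine integral_congr_ae (Filter.Eventually.of_forall fun r => ?_)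
          have hr : (0 : ℝ) < r := r.2
          simp only [finrank_E, NNReal.smul_def, Real.coe_toNNReal _ (pow_nonneg hr.le _)]
          rw [Complex.real_smul]
        · exact (measurable_subtype_coe.pow_const _).real_toNNReal

/-- The moment `∫₀¹ ψ(t) t^(n + m - 1) (1 - t)^(ν - n - 1) dt`. -/
def radialMoment (n : ℕ) (ν : ℝ) (m : ℕ) (ψ : ℝ → ℂ) : ℂ :=
  ∫ t in (0 : ℝ)..1, ψ t * ((t ^ (n + m - 1) * (1 - t) ^ (ν - n - 1) : ℝ) : ℂ)

theorem integral_lebBall (f : E n → ℂ) :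
    ∫ z, f z ∂lebBall n = ((vball n).toReal⁻¹ : ℝ) * ∫ z in ball (0 : E n) 1, f z := by
  rw [lebBall, integral_smul_measure, ENNReal.toReal_inv, Complex.real_smul]
  rfl

theorem integral_muNu_leb (hν : (n : ℝ) < ν) (f : E n → ℂ) :
    ∫ z, f z ∂muNu n ν = ((vball n).toReal⁻¹ : ℝ) *
      ∫ z in ball (0 : E n) 1, ((cNu n ν * (1 - ‖z‖ ^ 2) ^ (ν - n - 1) : ℝ) : ℂ) * f z := by
  rw [muNu, integral_withDensity_eq_integral_toReal_smul
    (measurable_muDensity _ _) (Filter.Eventually.of_forall fun _ => ENNReal.ofReal_lt_top),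
    ← integral_lebBall]
  refine integral_congr_ae ?_
  filter_upwards [ae_mem_ball_lebBall] with z hz
  have h := one_sub_normSq_pos hz
  have hc := cNu_pos hν
  rw [ENNReal.toReal_ofReal (by positivity), Complex.real_smul]

/-- Substitution `t = r²`: `r^(2n-1) r^(2m) dr` becomes `t^(n+m-1) dt / 2`, the source of the factor
`1/2`. -/
theorem integral_Ioi_sq (hn : 1 ≤ n) (m : ℕ) (ψ : ℝ → ℂ) (c : ℂ) :
    ∫ r in Set.Ioi (0 : ℝ), ((r ^ (2 * n - 1) : ℝ) : ℂ) * (if r < 1 then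
      c * (((1 - r ^ 2) ^ (ν - n - 1) : ℝ) : ℂ) * (ψ (r ^ 2) * ((r ^ (2 * m) : ℝ) : ℂ)) else 0) =
      c / 2 * radialMoment n ν m ψ := by
  set g : ℝ → ℂ := fun t => (if t < 1 then
      c / 2 * (ψ t * ((t ^ (n + m - 1) * (1 - t) ^ (ν - n - 1) : ℝ) : ℂ)) else 0) with hg
  have h1 := integral_comp_rpow_Ioi_of_pos (g := g) (p := 2) (by norm_num)
  have h2 : ∫ t in Set.Ioi (0 : ℝ), g t = c / 2 * radialMoment n ν m ψ := by
    rw [radialMoment, intervalIntegral.integral_of_le zero_le_one,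
      integral_Ioc_eq_integral_Ioo, ← integral_const_mul]
    have : g = (Set.Iio 1).indicator fun t =>
        c / 2 * (ψ t * ((t ^ (n + m - 1) * (1 - t) ^ (ν - n - 1) : ℝ) : ℂ)) := by
      ext t
      simp [hg, Set.indicator_apply]
    rw [this, setIntegral_indicator measurableSet_Iio, Set.Ioi_inter_Iio]
  rw [← h2, ← h1]
  refine setIntegral_congr_fun measurableSet_Ioi fun r hr => ?_
  have hr : (0 : ℝ) < r := hr
  have hlt : r ^ 2 < 1 ↔ r < 1 := by
    rw [sq_lt_one_iff₀ hr.le]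
  simp only [hg, Real.rpow_two, hlt, show (2 : ℝ) - 1 = 1 by norm_num, Real.rpow_one]
  split_ifs with h
  · rw [Complex.real_smul]
    obtain ⟨l, rfl⟩ : ∃ l, n = l + 1 := ⟨n - 1, by omega⟩
    have e1 : 2 * (l + 1) - 1 = 2 * l + 1 := by omega
    have e2 : l + 1 + m - 1 = l + m := by omega
    rw [e1, e2]
    push_cast
    ring
  · simp

/-- The prefactor does not involve `ψ`. Later only the quotient with the case `ψ = 1` matters, so
the integral over the sphere need not be computed. -/
theorem exists_integral_radial_mul_homogeneous (hn : 1 ≤ n) (hν : (n : ℝ) < ν) (m : ℕ)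
    {H : E n → ℂ} (hH : ∀ r : ℝ, 0 < r → ∀ ζ : E n, H (r • ζ) = ((r ^ (2 * m) : ℝ) : ℂ) * H ζ)
    (ψ : ℝ → ℂ) :
    ∫ z, ψ (‖z‖ ^ 2) * H z ∂muNu n ν =
      (((vball n).toReal⁻¹ : ℝ) * (∫ ζ : sphere (0 : E n) 1, H ζ
        ∂(volume : Measure (E n)).toSphere) * (cNu n ν / 2)) * radialMoment n ν m ψ := by
  rw [integral_muNu_leb hν, ← integral_indicator measurableSet_ball, integral_polar hn (H := H)
    (a := fun r => if r < 1 then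
      (cNu n ν : ℂ) * (((1 - r ^ 2) ^ (ν - n - 1) : ℝ) : ℂ) *
        (ψ (r ^ 2) * ((r ^ (2 * m) : ℝ) : ℂ)) else 0), integral_Ioi_sq hn]
  · ring
  · intro r hr ζ hζ
    have hnr : ‖r • ζ‖ = r := by rw [norm_smul, hζ, mul_one, Real.norm_of_nonneg hr.le]
    by_cases h1 : r < 1
    · rw [Set.indicator_of_mem (by simpa [hnr] using h1), if_pos h1, hH r hr, hnr]
      push_cast
      ring
    · rw [Set.indicator_of_notMem (by simpa [hnr] using h1), if_neg h1, zero_mul]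

/-- This is the beta integral `B(n + m, ν - n)`. -/
theorem radialMoment_one (hn : 1 ≤ n) (hν : (n : ℝ) < ν) (m : ℕ) :
    radialMoment n ν m (fun _ => 1) =
      ((n + m - 1).factorial * Real.Gamma (ν - n) / Real.Gamma (m + ν) : ℝ) := by
  have hb := Complex.Gamma_mul_Gamma_eq_betaIntegral (s := ((n + m : ℕ) : ℂ))
    (t := ((ν - n : ℝ) : ℂ)) (by rw [Complex.natCast_re]; exact_mod_cast (by omega))
    (by simpa using hν)
  have h1 : radialMoment n ν m (fun _ => 1) =
      Complex.betaIntegral ((n + m : ℕ) : ℂ) ((ν - n : ℝ) : ℂ) := by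
    unfold radialMoment Complex.betaIntegral
    refine intervalIntegral.integral_congr fun t ht => ?_
    rw [Set.uIcc_of_le zero_le_one] at ht
    simp only [one_mul]
    rw [Complex.ofReal_mul]
    congr 1
    · rw [Complex.ofReal_pow, ← Complex.cpow_natCast]
      congr 1
      rw [Nat.cast_sub (by omega)]
      simp
    · rw [Complex.ofReal_cpow (by linarith [ht.2])]
      push_cast
      rfl
  have h2 : ((n + m : ℕ) : ℂ) + ((ν - n : ℝ) : ℂ) = ((m + ν : ℝ) : ℂ) := by
    push_cast
    ring
  have h3 : Complex.Gamma ((n + m : ℕ) : ℂ) = ((n + m - 1).factorial : ℂ) := by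
    rw [← Complex.Gamma_nat_eq_factorial]
    congr 1
    rw [Nat.cast_sub (by omega)]
    simp
  rw [h2, h3, Complex.Gamma_ofReal, Complex.Gamma_ofReal, ← h1] at hb
  have h4 : (Real.Gamma (m + ν) : ℂ) ≠ 0 := by
    have h0 : (0 : ℝ) ≤ n := Nat.cast_nonneg n
    have h0 : (0 : ℝ) ≤ m := Nat.cast_nonneg m
    exact_mod_cast (Real.Gamma_pos_of_pos (show 0 < m + ν by linarith)).ne'
  push_cast
  rw [eq_div_iff h4, mul_comm, ← hb]

/-- The sphere has area `2n` times the volume of the ball, and the moment with `m = 0` is a beta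
value; `c_ν` is the constant that cancels both. -/
theorem integral_one_muNu (hn : 1 ≤ n) (hν : (n : ℝ) < ν) : ∫ _, (1 : ℂ) ∂muNu n ν = 1 := by
  have h := exists_integral_radial_mul_homogeneous hn hν 0 (H := fun _ => 1) (by simp)
    (fun _ => 1)
  simp only [mul_one] at h
  rw [h, radialMoment_one hn hν]
  have h0 : (0 : ℝ) ≤ n := Nat.cast_nonneg n
  have h1 := Real.Gamma_pos_of_pos (show 0 < ν by linarith)
  have h2 := Real.Gamma_pos_of_pos (show 0 < ν - n by linarith)
  have hs : ∫ _ : sphere (0 : E n) 1, (1 : ℂ) ∂(volume : Measure (E n)).toSphere =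
      ((2 * n * (vball n).toReal : ℝ) : ℂ) := by
    rw [integral_const, Measure.toSphere_real_apply_univ, finrank_E, Complex.real_smul, mul_one]
    push_cast
    rfl
  have hv : (vball n).toReal ≠ 0 := ENNReal.toReal_ne_zero.mpr ⟨vball_ne_zero, vball_ne_top⟩
  rw [hs, cNu]
  obtain ⟨l, rfl⟩ : ∃ l, n = l + 1 := ⟨n - 1, by omega⟩
  have hf : (l.factorial : ℝ) ≠ 0 := by exact_mod_cast l.factorial_ne_zero
  rw [show l + 1 + 0 - 1 = l by omega, Nat.factorial_succ]
  norm_cast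
  rw [zero_add]
  push_cast
  have : (l : ℝ) + 1 ≠ 0 := by positivity
  push_cast at h2
  field_simp

theorem isProbabilityMeasure_muNu (hn : 1 ≤ n) (hν : (n : ℝ) < ν) :
    IsProbabilityMeasure (muNu n ν) := by
  have h := integral_one_muNu hn hν
  have hfin : IsFiniteMeasure (muNu n ν) := by
    -- A non-integrable function has Bochner integral `0`, so the value `1` already forces
    -- finiteness.
    by_contra hc
    have : ¬ Integrable (fun _ : E n => (1 : ℂ)) (muNu n ν) := by
      rw [integrable_const_iff]
      simpa using hc
    rw [integral_undef this] at h
    exact zero_ne_one h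
  constructor
  rw [integral_const, Complex.real_smul, mul_one] at h
  have h' : (muNu n ν).real Set.univ = 1 := by exact_mod_cast h
  rw [measureReal_def] at h'
  exact (ENNReal.toReal_eq_one_iff _).mp h'

end RadialMoments

/-! ### Holomorphic representatives, the mean value property and kernel functions. -/

section BergmanSpace

variable {n : ℕ} {ν : ℝ} [hn : Fact (1 ≤ n)] [hν : Fact ((n : ℝ) < ν)]

instance : IsProbabilityMeasure (muNu n ν) := isProbabilityMeasure_muNu hn.out hν.out

instance instInnerBergman : Inner ℂ (bergman n ν) := InnerProductSpace.toInner

theorem bergman_inner_smul_left (f g : bergman n ν) (c : ℂ) :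
    inner ℂ (c • f) g = conj c * inner ℂ f g :=
  inner_smul_left (𝕜 := ℂ) (E := bergman n ν) f g c

theorem bergman_inner_smul_right (f g : bergman n ν) (c : ℂ) :
    inner ℂ f (c • g) = c * inner ℂ f g :=
  inner_smul_right (𝕜 := ℂ) (E := bergman n ν) f g c

/-! ### Holomorphic representatives -/

/-- The holomorphic representative of an element of the Bergman space. -/
def rep (g : bergman n ν) : E n → ℂ := g.2.choose

theorem rep_differentiableOn (g : bergman n ν) : DifferentiableOn ℂ (rep g) (ball 0 1) :=
  g.2.choose_spec.1

theorem coe_ae_eq_rep (g : bergman n ν) : ((g : Lp ℂ 2 (muNu n ν)) : E n → ℂ) =ᵐ[muNu n ν] rep g :=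
  g.2.choose_spec.2

theorem rep_eqOn {g : bergman n ν} {F : E n → ℂ} (hF : DifferentiableOn ℂ F (ball 0 1))
    (h : ((g : Lp ℂ 2 (muNu n ν)) : E n → ℂ) =ᵐ[muNu n ν] F) : Set.EqOn (rep g) F (ball 0 1) :=
  eqOn_ball_of_ae_eq hν.out ((coe_ae_eq_rep g).symm.trans h) (rep_differentiableOn g).continuousOn
    hF.continuousOn

theorem rep_add (f g : bergman n ν) {z : E n} (hz : z ∈ ball (0 : E n) 1) :
    rep (f + g) z = rep f z + rep g z := by
  have h : (((f + g : bergman n ν) : Lp ℂ 2 (muNu n ν)) : E n → ℂ) =ᵐ[muNu n ν]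
      fun z => rep f z + rep g z := by
    rw [Submodule.coe_add]
    filter_upwards [Lp.coeFn_add (f : Lp ℂ 2 (muNu n ν)) g, coe_ae_eq_rep f, coe_ae_eq_rep g]
      with z h1 h2 h3
    rw [h1, Pi.add_apply, h2, h3]
  have h' := rep_eqOn ((rep_differentiableOn f).fun_add (rep_differentiableOn g)) h
  exact h' hz

theorem rep_smul (c : ℂ) (g : bergman n ν) {z : E n} (hz : z ∈ ball (0 : E n) 1) :
    rep (c • g) z = c * rep g z := by
  have h : (((c • g : bergman n ν) : Lp ℂ 2 (muNu n ν)) : E n → ℂ) =ᵐ[muNu n ν]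
      fun z => c * rep g z := by
    rw [Submodule.coe_smul]
    filter_upwards [Lp.coeFn_smul c (g : Lp ℂ 2 (muNu n ν)), coe_ae_eq_rep g] with z h1 h2
    rw [h1, Pi.smul_apply, h2, smul_eq_mul]
  have h' := rep_eqOn ((rep_differentiableOn g).const_mul c) h
  exact h' hz

theorem memLp_rep (g : bergman n ν) : MemLp (rep g) 2 (muNu n ν) :=
  (memLp_congr_ae (coe_ae_eq_rep g)).mp (Lp.memLp _)

theorem bergman_ext {f g : bergman n ν} (h : Set.EqOn (rep f) (rep g) (ball 0 1)) : f = g := by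
  apply Subtype.ext
  apply Lp.ext
  filter_upwards [coe_ae_eq_rep f, coe_ae_eq_rep g, ae_mem_ball_mu] with z h1 h2 hz
  rw [h1, h2, h hz]

/-- The element of the Bergman space given by a holomorphic function. -/
def ofHol (F : E n → ℂ) (hF : DifferentiableOn ℂ F (ball 0 1)) (hL : MemLp F 2 (muNu n ν)) :
    bergman n ν :=
  ⟨hL.toLp F, F, hF, hL.coeFn_toLp⟩

theorem rep_ofHol {F : E n → ℂ} (hF : DifferentiableOn ℂ F (ball 0 1))
    (hL : MemLp F 2 (muNu n ν)) : Set.EqOn (rep (ofHol F hF hL)) F (ball 0 1) :=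
  rep_eqOn hF hL.coeFn_toLp

theorem inner_eq_integral (f g : bergman n ν) :
    inner ℂ f g = ∫ z, conj (rep f z) * rep g z ∂muNu n ν := by
  rw [Submodule.coe_inner, L2.inner_def]
  refine integral_congr_ae ?_
  filter_upwards [coe_ae_eq_rep f, coe_ae_eq_rep g] with z h1 h2
  rw [h1, h2, RCLike.inner_apply, mul_comm]

theorem aestronglyMeasurable_of_continuousOn {F : E n → ℂ} (hF : ContinuousOn F (ball 0 1)) :
    AEStronglyMeasurable F (muNu n ν) := by
  rw [← Measure.restrict_eq_self_of_ae_mem (ae_mem_ball_mu (n := n) (ν := ν))]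
  exact hF.aestronglyMeasurable measurableSet_ball

/-- `μ_ν` and the invariant measure `λ` have the same null sets. -/
theorem ae_act (x : SU n) {P : E n → Prop} (h : ∀ᵐ z ∂muNu n ν, P z) :
    ∀ᵐ z ∂muNu n ν, P (act x z) := by
  have h1 : invMeasure n ≪ muNu n ν := by
    rw [muNu_eq_withDensity hν.out]
    refine withDensity_absolutelyContinuous' (measurable_muDensity _ _).aemeasurable ?_
    filter_upwards [ae_mem_ball_inv] with z hz
    have h := one_sub_normSq_pos hz
    have hc := cNu_pos hν.out
    simp only [ne_eq, ENNReal.ofReal_eq_zero, not_le]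
    positivity
  have h2 : muNu n ν ≪ invMeasure n := by
    rw [muNu_eq_withDensity hν.out]
    exact withDensity_absolutelyContinuous _ _
  exact h2.ae_le ((measurePreserving_act x).quasiMeasurePreserving.ae (h1.ae_le h))

/-! ### The mean value property -/

theorem exists_kEmb_rotation {c : ℂ} (hc : ‖c‖ = 1) : ∃ k : U n, ∀ z : E n, act (kEmb k) z = c • z := by
  have hu : c • (1 : Matrix (Fin n) (Fin n) ℂ) ∈ U n := by
    rw [Matrix.mem_unitaryGroup_iff, star_smul, smul_mul_smul_comm, star_one, mul_one]
    have : c * star c = 1 := by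
      rw [mul_comm]
      change conj c * c = 1
      rw [← Complex.normSq_eq_conj_mul_self, Complex.normSq_eq_norm_sq, hc]
      simp
    rw [this, one_smul]
  obtain ⟨k, hk⟩ := exists_kEmb_act_eq_mulVec ⟨_, hu⟩
  refine ⟨k, fun z => ?_⟩
  rw [hk]
  ext i
  simp [Matrix.smul_mulVec]

theorem measurePreserving_rotation {c : ℂ} (hc : ‖c‖ = 1) :
    MeasurePreserving (fun z : E n => c • z) (muNu n ν) (muNu n ν) := by
  obtain ⟨k, hk⟩ := exists_kEmb_rotation (n := n) hc
  rw [show (fun z : E n => c • z) = act (kEmb k) from funext fun z => (hk z).symm]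
  exact measurePreserving_kEmb_mu hν.out k

theorem measurable_indicator_ball {F : E n → ℂ} (hF : ContinuousOn F (ball 0 1)) :
    Measurable ((ball (0 : E n) 1).indicator F) := by
  classical
  rw [← Set.piecewise_eq_indicator]
  exact hF.measurable_piecewise continuousOn_const measurableSet_ball

theorem circleAverage_slice {F : E n → ℂ} (hF : DifferentiableOn ℂ F (ball 0 1)) {z : E n}
    (hz : z ∈ ball (0 : E n) 1) :
    (2 * Real.pi)⁻¹ • ∫ θ in (0 : ℝ)..2 * Real.pi, F (circleMap 0 1 θ • z) = F 0 := by
  have hd : DifferentiableOn ℂ (fun ζ : ℂ => F (ζ • z)) (closedBall 0 1) := by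
    refine hF.comp (by fun_prop) fun ζ hζ => ?_
    rw [mem_ball_zero_iff, norm_smul]
    have h1 : ‖ζ‖ ≤ 1 := by simpa using hζ
    have h2 := norm_lt_one_of_mem hz
    nlinarith [norm_nonneg ζ, norm_nonneg z]
  have h := (hd.diffContOnCl_ball (U := closedBall (0 : ℂ) 1) (c := 0) (R := |1|)
    (by simp)).circleAverage
  rw [Real.circleAverage_def] at h
  simpa using h

/-- Circle rotations preserve `μ_ν`, so `F` may be averaged over them; by Fubini the average is
taken first on each disc `ζ ↦ F (ζ • z)`, where the one-variable mean value property gives `F 0`. -/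
theorem integral_eq_value_zero {F : E n → ℂ} (hF : DifferentiableOn ℂ F (ball 0 1))
    (hi : Integrable F (muNu n ν)) : ∫ z, F z ∂muNu n ν = F 0 := by
  -- `F` is controlled only on the ball; cutting it off there gives a measurable function without
  -- changing integrals.
  set G := (ball (0 : E n) 1).indicator F with hG
  have hGm : Measurable G := measurable_indicator_ball hF.continuousOn
  have hGF : G =ᵐ[muNu n ν] F := by
    filter_upwards [ae_mem_ball_mu] with z hz
    rw [hG, Set.indicator_of_mem hz]
  have hGi : Integrable G (muNu n ν) := hi.congr hGF.symm
  have hnc : ∀ θ : ℝ, ‖circleMap 0 1 θ‖ = 1 := fun θ => by simp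
  have hrot : ∀ θ : ℝ, ∫ z, G (circleMap 0 1 θ • z) ∂muNu n ν = ∫ z, G z ∂muNu n ν := fun θ => by
    have hp := measurePreserving_rotation (n := n) (ν := ν) (hnc θ)
    rw [← integral_map hp.measurable.aemeasurable hGm.aestronglyMeasurable, hp.map_eq]
  have hmeas : Measurable fun p : ℝ × E n => G (circleMap 0 1 p.1 • p.2) := by
    have hc : Continuous fun p : ℝ × E n => circleMap 0 1 p.1 • p.2 :=
      ((continuous_circleMap 0 1).comp continuous_fst).smul continuous_snd
    exact hGm.comp hc.measurable
  have hint : Integrable (Function.uncurry fun (θ : ℝ) (z : E n) => G (circleMap 0 1 θ • z))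
      ((volume.restrict (Set.Ioc 0 (2 * Real.pi))).prod (muNu n ν)) := by
    have hm' : AEStronglyMeasurable (Function.uncurry fun (θ : ℝ) (z : E n) =>
        G (circleMap 0 1 θ • z)) ((volume.restrict (Set.Ioc 0 (2 * Real.pi))).prod (muNu n ν)) :=
      hmeas.aestronglyMeasurable
    rw [integrable_prod_iff hm']
    have h2 : ∀ θ : ℝ, ∫ z, ‖G (circleMap 0 1 θ • z)‖ ∂muNu n ν = ∫ z, ‖G z‖ ∂muNu n ν := fun θ => by
      have hp := measurePreserving_rotation (n := n) (ν := ν) (hnc θ)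
      rw [← integral_map (f := fun z => ‖G z‖) hp.measurable.aemeasurable
        hGm.norm.aestronglyMeasurable, hp.map_eq]
    refine ⟨Filter.Eventually.of_forall fun θ => ?_, ?_⟩
    · exact (measurePreserving_rotation (hnc θ)).integrable_comp_of_integrable hGi
    · simp only [Function.uncurry_apply_pair, h2]
      exact integrable_const _
  have h1 := integral_integral_swap hint
  simp only [hrot] at h1
  have h3 : ∀ᵐ z ∂muNu n ν, ∫ θ in Set.Ioc 0 (2 * Real.pi), G (circleMap 0 1 θ • z) =
      (2 * Real.pi : ℝ) • F 0 := by
    filter_upwards [ae_mem_ball_mu] with z hz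
    rw [← circleAverage_slice hF hz, smul_smul, mul_inv_cancel₀ (by positivity), one_smul,
      intervalIntegral.integral_of_le (by positivity)]
    refine integral_congr_ae (Filter.Eventually.of_forall fun θ => ?_)
    simp only [hG]
    rw [Set.indicator_of_mem]
    rw [mem_ball_zero_iff, norm_smul, hnc, one_mul]
    exact norm_lt_one_of_mem hz
  rw [integral_congr_ae h3, integral_const, integral_const] at h1
  simp only [probReal_univ, one_smul] at h1
  have h4 : (volume.restrict (Set.Ioc 0 (2 * Real.pi))).real Set.univ = 2 * Real.pi := by
    simp [measureReal_def, Real.pi_pos.le]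
  rw [h4] at h1
  rw [← integral_congr_ae hGF]
  exact smul_right_injective ℂ (show (2 * Real.pi : ℝ) ≠ 0 by positivity) h1

/-! ### Kernel functions -/

theorem one_sub_inner_re_pos {z w : E n} (hz : z ∈ ball (0 : E n) 1) (hw : ‖w‖ ≤ 1) :
    0 < (1 - inner ℂ w z : ℂ).re := by
  have h1 : ‖(inner ℂ w z : ℂ)‖ ≤ ‖w‖ * ‖z‖ := norm_inner_le_norm w z
  have h2 := norm_lt_one_of_mem hz
  have h3 := Complex.re_le_norm (inner ℂ w z : ℂ)
  rw [Complex.sub_re, Complex.one_re]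
  nlinarith [norm_nonneg z, norm_nonneg w]

theorem one_sub_inner_mem_slitPlane {z w : E n} (hz : z ∈ ball (0 : E n) 1) (hw : ‖w‖ ≤ 1) :
    (1 - inner ℂ w z : ℂ) ∈ Complex.slitPlane := Or.inl (one_sub_inner_re_pos hz hw)

theorem differentiableOn_kerNu {w : E n} (hw : ‖w‖ ≤ 1) :
    DifferentiableOn ℂ (fun z => kerNu n ν z w) (ball 0 1) := by
  unfold kerNu
  refine DifferentiableOn.cpow ?_ (differentiableOn_const _)
    fun z hz => one_sub_inner_mem_slitPlane hz hw
  exact (differentiableOn_const _).sub (innerSL ℂ w).differentiable.differentiableOn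

theorem differentiableOn_nkerNu {w : E n} (hw : ‖w‖ ≤ 1) :
    DifferentiableOn ℂ (nkerNu n ν w) (ball 0 1) :=
  (differentiableOn_kerNu hw).const_mul _

theorem norm_kerNu (z w : E n) : ‖kerNu n ν z w‖ = ‖(1 - inner ℂ w z : ℂ)‖ ^ (-ν) := by
  rw [kerNu, ← Complex.ofReal_neg, Complex.norm_cpow_real]

theorem norm_nkerNu_orbit (x : SU n) {w : E n} (hw : w ∈ ball (0 : E n) 1) :
    ‖nkerNu n ν (act x 0) (act x w)‖ = ‖den x w‖ ^ ν := by
  have h0 := act_mem x (zero_mem (n := n))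
  have hp := one_sub_normSq_pos h0
  have hd0 : 0 < ‖den x 0‖ := by simpa using den_ne_zero x (zero_mem (n := n))
  have hdw : 0 < ‖den x w‖ := by simpa using den_ne_zero x hw
  rw [nkerNu, norm_mul, norm_kerNu, one_sub_inner_act x zero_mem hw, inner_zero_left, sub_zero,
    norm_div, norm_one, norm_mul, RCLike.norm_conj, Complex.norm_real,
    Real.norm_of_nonneg (by positivity), one_sub_normSq_act x zero_mem, norm_zero, one_div,
    Real.inv_rpow (by positivity), Real.rpow_neg (by positivity), inv_inv,
    Real.mul_rpow hd0.le hdw.le]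
  have : (1 - (0 : ℝ) ^ 2) / ‖den x 0‖ ^ 2 = ‖den x 0‖ ^ (-2 : ℝ) := by
    rw [Real.rpow_neg hd0.le, Real.rpow_two]
    simp
  rw [this, ← Real.rpow_mul hd0.le, ← mul_assoc, ← Real.rpow_add hd0]
  rw [show -2 * (ν / 2) + ν = 0 by ring, Real.rpow_zero, one_mul]

/-- Parametrizing `z = x · w`, both the kernel and the weight are expressed by `den x w`, and the
powers cancel. So `|k_{x·0}|²` is the density that makes weighted composition with `x⁻¹` isometric
on `L²(μ_ν)`. -/
theorem norm_nkerNu_sq (x : SU n) {z : E n} (hz : z ∈ ball (0 : E n) 1) :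
    (1 - ‖z‖ ^ 2) ^ ν * ‖nkerNu n ν (act x 0) z‖ ^ 2 = (1 - ‖act x⁻¹ z‖ ^ 2) ^ ν := by
  obtain ⟨w, hw, rfl⟩ : ∃ w ∈ ball (0 : E n) 1, z = act x w :=
    ⟨act x⁻¹ z, act_mem _ hz, (act_act_inv x hz).symm⟩
  have hdw : 0 < ‖den x w‖ := by simpa using den_ne_zero x hw
  have hp := one_sub_normSq_pos hw
  rw [norm_nkerNu_orbit x hw, act_inv_act x hw, one_sub_normSq_act x hw,
    Real.div_rpow hp.le (by positivity)]
  have : (‖den x w‖ ^ 2) ^ ν = (‖den x w‖ ^ ν) ^ 2 := by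
    rw [← Real.rpow_natCast, ← Real.rpow_natCast, ← Real.rpow_mul hdw.le, ← Real.rpow_mul hdw.le,
      mul_comm]
  rw [this]
  field_simp

end BergmanSpace

/-! ### The projective representation, the reproducing kernel and completeness. -/

section Representation

variable {n : ℕ} {ν : ℝ} [hn : Fact (1 ≤ n)] [hν : Fact ((n : ℝ) < ν)]

/-! ### The projective representation -/

variable (ν) in
/-- The weighted composition `F ↦ k_{x · 0} (F ∘ x⁻¹)`. -/
def wcomp (x : SU n) (F : E n → ℂ) (z : E n) : ℂ := nkerNu n ν (act x 0) z * F (act x⁻¹ z)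

theorem measurable_nkerNu (w : E n) : Measurable (nkerNu n ν w) := by
  unfold nkerNu kerNu
  exact ((measurable_const.sub (innerSL ℂ w).continuous.measurable).pow_const _).const_mul _

theorem measurable_wcomp (x : SU n) {F : E n → ℂ} (hF : Measurable F) :
    Measurable (wcomp ν x F) :=
  (measurable_nkerNu _).mul (hF.comp (measurable_act_left _))

theorem lintegral_wcomp (x : SU n) {F : E n → ℂ} (hF : Measurable F) :
    ∫⁻ z, ‖wcomp ν x F z‖ₑ ^ 2 ∂muNu n ν = ∫⁻ z, ‖F z‖ₑ ^ 2 ∂muNu n ν := by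
  have hm : Measurable fun z : E n => ‖F z‖ₑ ^ 2 := hF.enorm.pow_const 2
  rw [lintegral_muNu hν.out hm, lintegral_muNu hν.out ((measurable_wcomp x hF).enorm.pow_const 2),
    ← (measurePreserving_act x⁻¹).lintegral_comp
      (f := fun z => ENNReal.ofReal (cNu n ν * (1 - ‖z‖ ^ 2) ^ ν) * ‖F z‖ₑ ^ 2)
      ((measurable_muDensity _ _).mul hm)]
  refine lintegral_congr_ae ?_
  filter_upwards [ae_mem_ball_inv] with z hz
  have hc := cNu_pos hν.out
  have hp := one_sub_normSq_pos hz
  rw [wcomp, enorm_mul, mul_pow, ← mul_assoc, ← norm_nkerNu_sq x hz, ← mul_assoc,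
    ENNReal.ofReal_mul (by positivity) (q := ‖nkerNu n ν (act x 0) z‖ ^ 2),
    ENNReal.ofReal_pow (norm_nonneg _), ofReal_norm]

theorem eLpNorm_wcomp (x : SU n) {F : E n → ℂ} (hF : Measurable F) :
    eLpNorm (wcomp ν x F) 2 (muNu n ν) = eLpNorm F 2 (muNu n ν) := by
  rw [eLpNorm_eq_lintegral_rpow_enorm_toReal two_ne_zero ENNReal.ofNat_ne_top,
    eLpNorm_eq_lintegral_rpow_enorm_toReal two_ne_zero ENNReal.ofNat_ne_top]
  have := lintegral_wcomp (ν := ν) x hF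
  simp only [ENNReal.toReal_ofNat, ENNReal.rpow_ofNat]
  rw [this]

theorem wcomp_congr_ae (x : SU n) {F H : E n → ℂ} (h : F =ᵐ[muNu n ν] H) :
    wcomp ν x F =ᵐ[muNu n ν] wcomp ν x H := by
  filter_upwards [ae_act x⁻¹ h] with z hz
  rw [wcomp, wcomp, hz]

theorem differentiableOn_wcomp (x : SU n) {F : E n → ℂ} (hF : DifferentiableOn ℂ F (ball 0 1)) :
    DifferentiableOn ℂ (wcomp ν x F) (ball 0 1) :=
  (differentiableOn_nkerNu (norm_lt_one_of_mem (act_mem x zero_mem)).le).mul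
    (hF.comp (differentiableOn_act x⁻¹) fun _ hz => act_mem _ hz)

theorem measurable_coe_bergman (g : bergman n ν) :
    Measurable ((g : Lp ℂ 2 (muNu n ν)) : E n → ℂ) := (Lp.stronglyMeasurable _).measurable

theorem eLpNorm_wcomp_rep (x : SU n) (g : bergman n ν) :
    eLpNorm (wcomp ν x (rep g)) 2 (muNu n ν) =
      eLpNorm ((g : Lp ℂ 2 (muNu n ν)) : E n → ℂ) 2 (muNu n ν) := by
  rw [← eLpNorm_wcomp x (measurable_coe_bergman g)]
  exact (eLpNorm_congr_ae (wcomp_congr_ae x (coe_ae_eq_rep g))).symm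

theorem memLp_wcomp_rep (x : SU n) (g : bergman n ν) : MemLp (wcomp ν x (rep g)) 2 (muNu n ν) := by
  refine ⟨aestronglyMeasurable_of_continuousOn
    (differentiableOn_wcomp x (rep_differentiableOn g)).continuousOn, ?_⟩
  rw [eLpNorm_wcomp_rep]
  exact Lp.eLpNorm_lt_top _

/-- An operator is determined by its values almost everywhere, so the chosen operator is any one
realizing the formula. -/
theorem opOf_eq {T : (E n → ℂ) → E n → ℂ} {V : Op n ν}
    (h : ∀ g : bergman n ν, ((V g : Lp ℂ 2 (muNu n ν)) : E n → ℂ) =ᵐ[muNu n ν]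
      T ((g : Lp ℂ 2 (muNu n ν)) : E n → ℂ)) : opOf n ν T = V := by
  have h1 : ∃ V : Op n ν, ∀ g : bergman n ν, ((V g : Lp ℂ 2 (muNu n ν)) : E n → ℂ) =ᵐ[muNu n ν]
      T ((g : Lp ℂ 2 (muNu n ν)) : E n → ℂ) := ⟨V, h⟩
  have h2 := Classical.epsilon_spec h1
  ext g : 1
  apply Subtype.ext
  apply Lp.ext
  exact (h2 g).trans (h g).symm

variable (n ν) in
/-- The projective representation as a linear isometry. -/
def piLI (x : SU n) : bergman n ν →ₗᵢ[ℂ] bergman n ν where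
  toFun g := ofHol (wcomp ν x (rep g)) (differentiableOn_wcomp x (rep_differentiableOn g))
    (memLp_wcomp_rep x g)
  map_add' f g := by
    apply bergman_ext
    intro z hz
    rw [rep_add _ _ hz, rep_ofHol _ _ hz, rep_ofHol _ _ hz, rep_ofHol _ _ hz, wcomp, wcomp, wcomp,
      rep_add _ _ (act_mem _ hz), mul_add]
  map_smul' c g := by
    apply bergman_ext
    intro z hz
    rw [RingHom.id_apply, rep_smul _ _ hz, rep_ofHol _ _ hz, rep_ofHol _ _ hz, wcomp, wcomp,
      rep_smul _ _ (act_mem _ hz), mul_left_comm]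
  norm_map' g := by
    change ‖(memLp_wcomp_rep x g).toLp _‖ = ‖(g : Lp ℂ 2 (muNu n ν))‖
    rw [Lp.norm_toLp, Lp.norm_def, eLpNorm_wcomp_rep]

theorem piNu_eq (x : SU n) : piNu n ν x = (piLI n ν x).toContinuousLinearMap := by
  refine opOf_eq fun g => ?_
  have h1 : (((piLI n ν x).toContinuousLinearMap g : Lp ℂ 2 (muNu n ν)) : E n → ℂ) =ᵐ[muNu n ν]
      wcomp ν x (rep g) := (memLp_wcomp_rep x g).coeFn_toLp
  exact h1.trans (wcomp_congr_ae x (coe_ae_eq_rep g)).symm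

theorem rep_piNu (x : SU n) (g : bergman n ν) {z : E n} (hz : z ∈ ball (0 : E n) 1) :
    rep (piNu n ν x g) z = nkerNu n ν (act x 0) z * rep g (act x⁻¹ z) := by
  rw [piNu_eq]
  exact rep_ofHol (differentiableOn_wcomp x (rep_differentiableOn g)) (memLp_wcomp_rep x g) hz

theorem norm_piNu (x : SU n) (g : bergman n ν) : ‖piNu n ν x g‖ = ‖g‖ := by
  rw [piNu_eq]
  exact (piLI n ν x).norm_map g

theorem inner_piNu (x : SU n) (f g : bergman n ν) :
    inner ℂ (piNu n ν x f) (piNu n ν x g) = inner ℂ f g := by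
  rw [piNu_eq]
  exact (piLI n ν x).inner_map_map f g

theorem nkerNu_ne_zero {w z : E n} (hw : w ∈ ball (0 : E n) 1) (hz : z ∈ ball (0 : E n) 1) :
    nkerNu n ν w z ≠ 0 := by
  have hp := one_sub_normSq_pos hw
  refine mul_ne_zero ?_ ?_
  · exact_mod_cast (Real.rpow_pos_of_pos hp _).ne'
  · rw [kerNu, Ne, Complex.cpow_eq_zero_iff]
    rintro ⟨h, -⟩
    have := one_sub_inner_re_pos hz (norm_lt_one_of_mem hw).le
    rw [h] at this
    simp at this

/-- The quotient of the two sides is holomorphic and, by `norm_nkerNu_sq`, of modulus one on the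
ball; the maximum principle makes it constant. This avoids any comparison of branches of the complex
powers. -/
theorem nkerNu_cocycle (x y : SU n) : ∃ c : ℂ, ‖c‖ = 1 ∧ ∀ z ∈ ball (0 : E n) 1,
    nkerNu n ν (act x 0) z * nkerNu n ν (act y 0) (act x⁻¹ z) = c * nkerNu n ν (act (x * y) 0) z := by
  set r : E n → ℂ := fun z => nkerNu n ν (act x 0) z * nkerNu n ν (act y 0) (act x⁻¹ z) *
    (nkerNu n ν (act (x * y) 0) z)⁻¹ with hr
  have hne : ∀ z ∈ ball (0 : E n) 1, nkerNu n ν (act (x * y) 0) z ≠ 0 :=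
    fun z hz => nkerNu_ne_zero (act_mem _ zero_mem) hz
  have hd : DifferentiableOn ℂ r (ball 0 1) :=
    (differentiableOn_wcomp x
      (differentiableOn_nkerNu (norm_lt_one_of_mem (act_mem y zero_mem)).le)).mul
      ((differentiableOn_nkerNu (norm_lt_one_of_mem (act_mem _ zero_mem)).le).inv hne)
  have hn1 : ∀ z ∈ ball (0 : E n) 1, ‖r z‖ = 1 := fun z hz => by
    have h1 := norm_nkerNu_sq (ν := ν) x hz
    have h2 := norm_nkerNu_sq (ν := ν) y (act_mem x⁻¹ hz)
    have h3 := norm_nkerNu_sq (ν := ν) (x * y) hz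
    rw [_root_.mul_inv_rev, act_mul _ _ hz, ← h2, ← h1, mul_assoc] at h3
    have hp := Real.rpow_pos_of_pos (one_sub_normSq_pos hz) ν
    have h4 := mul_left_cancel₀ hp.ne' h3
    have hpos : 0 < ‖nkerNu n ν (act (x * y) 0) z‖ := norm_pos_iff.mpr (hne z hz)
    simp only [hr]
    rw [norm_mul, norm_inv, ← div_eq_mul_inv, norm_mul, div_eq_one_iff_eq hpos.ne', ← abs_of_nonneg hpos.le,
      ← abs_of_nonneg (mul_nonneg (norm_nonneg (nkerNu n ν (act x 0) z)) (norm_nonneg _)),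
      ← sq_eq_sq_iff_abs_eq_abs, h4, mul_pow]
  have hc := Complex.eqOn_of_isPreconnected_of_isMaxOn_norm
    (convex_ball (0 : E n) 1).isPreconnected isOpen_ball hd zero_mem (fun z hz => by
      simp [hn1 z hz, hn1 0 zero_mem])
  refine ⟨r 0, hn1 0 zero_mem, fun z hz => ?_⟩
  have := hc hz
  rw [Function.const_apply] at this
  rw [← this]
  simp only [hr]
  rw [inv_mul_cancel_right₀ (hne z hz)]

theorem piNu_mul (x y : SU n) : ∃ c : ℂ, ‖c‖ = 1 ∧
    piNu n ν x ∘L piNu n ν y = c • piNu n ν (x * y) := by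
  obtain ⟨c, hc, h⟩ := nkerNu_cocycle (ν := ν) x y
  refine ⟨c, hc, ?_⟩
  ext g : 1
  apply bergman_ext
  intro z hz
  rw [ContinuousLinearMap.comp_apply, _root_.smul_apply, rep_smul _ _ hz,
    rep_piNu _ _ hz, rep_piNu _ _ (act_mem _ hz), rep_piNu _ _ hz, ← mul_assoc, h z hz,
    _root_.mul_inv_rev, act_mul _ _ hz, mul_assoc]

theorem nkerNu_zero (z : E n) : nkerNu n ν 0 z = 1 := by simp [nkerNu, kerNu]

theorem nkerNu_apply_zero (w : E n) : nkerNu n ν w 0 = (((1 - ‖w‖ ^ 2) ^ (ν / 2) : ℝ) : ℂ) := by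
  simp [nkerNu, kerNu]

theorem kerNu_self {w : E n} (hw : w ∈ ball (0 : E n) 1) :
    kerNu n ν w w = (((1 - ‖w‖ ^ 2) ^ (-ν) : ℝ) : ℂ) := by
  have hp := one_sub_normSq_pos hw
  rw [kerNu, inner_self_eq_norm_sq_to_K, Complex.ofReal_cpow hp.le]
  push_cast
  rfl

/-- For the pair `x, x⁻¹` the unimodular constant is found at `z = 0`, where the exponents `ν/2`,
`ν/2` and `-ν` add up to zero. Thus `π(x⁻¹)` is the exact inverse of `π(x)`, not only up to a phase.
-/
theorem piNu_piNu_inv (x : SU n) : piNu n ν x ∘L piNu n ν x⁻¹ = ContinuousLinearMap.id ℂ _ := by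
  obtain ⟨c, hc, h⟩ := nkerNu_cocycle (ν := ν) x x⁻¹
  have h0 := h 0 zero_mem
  have hm := act_mem x (zero_mem (n := n))
  have hp := one_sub_normSq_pos hm
  have hc1 : c = 1 := by
    rw [mul_inv_cancel, act_one, nkerNu_zero, mul_one, nkerNu_apply_zero, nkerNu,
      kerNu_self (act_mem _ zero_mem), norm_act_inv_zero, ← Complex.ofReal_mul,
      ← Complex.ofReal_mul, ← Real.rpow_add hp, ← Real.rpow_add hp] at h0
    rw [← h0, show ν / 2 + (ν / 2 + -ν) = 0 by ring, Real.rpow_zero, Complex.ofReal_one]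
  ext g : 1
  apply bergman_ext
  intro z hz
  rw [ContinuousLinearMap.comp_apply, rep_piNu _ _ hz, rep_piNu _ _ (act_mem _ hz), ← mul_assoc,
    h z hz, hc1, mul_inv_cancel, act_one, nkerNu_zero, one_mul, one_mul, inv_inv,
    act_act_inv _ hz]
  rfl

theorem piNu_apply_piNu_inv (x : SU n) (g : bergman n ν) :
    piNu n ν x (piNu n ν x⁻¹ g) = g := by
  rw [← ContinuousLinearMap.comp_apply, piNu_piNu_inv]
  rfl

theorem inner_piNu_left (x : SU n) (f g : bergman n ν) :
    inner ℂ (piNu n ν x f) g = inner ℂ f (piNu n ν x⁻¹ g) := by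
  conv_lhs => rw [← piNu_apply_piNu_inv x g]
  rw [inner_piNu]

theorem inner_piNu_right (x : SU n) (f g : bergman n ν) :
    inner ℂ f (piNu n ν x g) = inner ℂ (piNu n ν x⁻¹ f) g := by
  rw [inner_piNu_left, inv_inv]

theorem adj_piNu (x : SU n) : adj (piNu n ν x) = piNu n ν x⁻¹ := by
  have h1 : ∃ V : Op n ν, ∀ g h, inner ℂ (piNu n ν x g) h = inner ℂ g (V h) :=
    ⟨_, fun g h => inner_piNu_left x g h⟩
  have h2 := Classical.epsilon_spec h1
  ext g : 1
  refine ext_inner_left ℂ fun f => ?_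
  rw [← inner_piNu_left x f g]
  exact (h2 f g).symm

theorem translate_eq (x : SU n) (A : Op n ν) :
    translate x A = piNu n ν x ∘L A ∘L piNu n ν x⁻¹ := by
  rw [translate, adj_piNu]

/-- The phase of the projective representation cancels against its conjugate under conjugation of
operators. -/
theorem translate_mul (x y : SU n) (A : Op n ν) :
    translate (x * y) A = translate x (translate y A) := by
  obtain ⟨c, hc, h1⟩ := piNu_mul (ν := ν) x y
  have hc0 : c ≠ 0 := by
    rintro rfl
    simp at hc
  ext g : 1
  refine ext_inner_left ℂ fun f => ?_
  have h1' : ∀ f : bergman n ν, piNu n ν (x * y) f = c⁻¹ • piNu n ν x (piNu n ν y f) := fun f => by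
    have := congrArg (fun T : Op n ν => T f) h1
    simp only [ContinuousLinearMap.comp_apply, _root_.smul_apply] at this
    rw [this, smul_smul, inv_mul_cancel₀ hc0, one_smul]
  have h2 : ∀ f : bergman n ν, piNu n ν (x * y)⁻¹ f = c • piNu n ν y⁻¹ (piNu n ν x⁻¹ f) := fun f => by
    refine ext_inner_left ℂ fun v => ?_
    rw [← inner_piNu_left, h1', bergman_inner_smul_left, inner_piNu_left, inner_piNu_left, bergman_inner_smul_right]
    congr 1
    rw [map_inv₀]
    refine inv_eq_of_mul_eq_one_right ?_
    rw [← Complex.normSq_eq_conj_mul_self, Complex.normSq_eq_norm_sq, hc]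
    simp
  rw [translate_eq, translate_eq, translate_eq]
  simp only [ContinuousLinearMap.comp_apply]
  rw [h2, h1', map_smul, map_smul, map_smul, smul_smul, inv_mul_cancel₀ hc0, one_smul]

/-! ### The reproducing kernel -/

variable (n ν) in
/-- The constant function `1` in the Bergman space. -/
def oneB : bergman n ν := ofHol (fun _ => 1) (differentiableOn_const 1) (memLp_const 1)

theorem rep_oneB {z : E n} (hz : z ∈ ball (0 : E n) 1) : rep (oneB n ν) z = 1 :=
  rep_ofHol (differentiableOn_const 1) (memLp_const 1) hz

theorem integrable_rep (g : bergman n ν) : Integrable (rep g) (muNu n ν) :=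
  (memLp_rep g).integrable one_le_two

/-- The mean value property is the reproducing property at the origin; unitarity of `π` transports
it to every other point. -/
theorem inner_oneB (g : bergman n ν) : inner ℂ (oneB n ν) g = rep g 0 := by
  rw [inner_eq_integral, ← integral_eq_value_zero (rep_differentiableOn g) (integrable_rep g)]
  refine integral_congr_ae ?_
  filter_upwards [ae_mem_ball_mu] with z hz
  rw [rep_oneB hz, map_one, one_mul]

theorem norm_oneB : ‖oneB n ν‖ = 1 := by
  have h := inner_oneB (oneB n ν)
  rw [rep_oneB zero_mem, inner_self_eq_norm_sq_to_K] at h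
  have h1 : ((‖oneB n ν‖ ^ 2 : ℝ) : ℂ) = ((1 : ℝ) : ℂ) := by
    rw [Complex.ofReal_pow, Complex.ofReal_one]
    exact h
  have h' := Complex.ofReal_injective h1
  nlinarith [norm_nonneg (oneB n ν)]

theorem rep_piNu_oneB (x : SU n) {z : E n} (hz : z ∈ ball (0 : E n) 1) :
    rep (piNu n ν x (oneB n ν)) z = nkerNu n ν (act x 0) z := by
  rw [rep_piNu _ _ hz, rep_oneB (act_mem _ hz), mul_one]

theorem inner_piNu_oneB (x : SU n) (g : bergman n ν) : inner ℂ (piNu n ν x (oneB n ν)) g =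
    (((1 - ‖act x 0‖ ^ 2) ^ (ν / 2) : ℝ) : ℂ) * rep g (act x 0) := by
  rw [inner_piNu_left, inner_oneB, rep_piNu _ _ zero_mem, nkerNu_apply_zero, norm_act_inv_zero,
    inv_inv]

variable (ν) in
/-- The reproducing kernel function `K_w` as an element of the Bergman space. -/
def kerVec (w : E n) : bergman n ν :=
  (((1 - ‖w‖ ^ 2) ^ (-(ν / 2)) : ℝ) : ℂ) • piNu n ν (sec w) (oneB n ν)

theorem rep_kerVec {w z : E n} (hw : w ∈ ball (0 : E n) 1) (hz : z ∈ ball (0 : E n) 1) :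
    rep (kerVec ν w) z = kerNu n ν z w := by
  have hp := one_sub_normSq_pos hw
  rw [kerVec, rep_smul _ _ hz, rep_piNu_oneB _ hz, act_sec hw, nkerNu, ← mul_assoc,
    ← Complex.ofReal_mul, ← Real.rpow_add hp, neg_add_cancel, Real.rpow_zero, Complex.ofReal_one,
    one_mul]

theorem inner_kerVec {w : E n} (hw : w ∈ ball (0 : E n) 1) (g : bergman n ν) :
    inner ℂ (kerVec ν w) g = rep g w := by
  have hp := one_sub_normSq_pos hw
  rw [kerVec, bergman_inner_smul_left, inner_piNu_oneB, act_sec hw, Complex.conj_ofReal, ← mul_assoc,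
    ← Complex.ofReal_mul, ← Real.rpow_add hp, neg_add_cancel, Real.rpow_zero, Complex.ofReal_one,
    one_mul]

theorem norm_kerVec {w : E n} (hw : w ∈ ball (0 : E n) 1) :
    ‖kerVec ν w‖ = (1 - ‖w‖ ^ 2) ^ (-(ν / 2)) := by
  have hp := one_sub_normSq_pos hw
  rw [kerVec, norm_smul, norm_piNu, norm_oneB, mul_one, Complex.norm_real,
    Real.norm_of_nonneg (by positivity)]

theorem conj_kerNu {z w : E n} (hz : z ∈ ball (0 : E n) 1) (hw : w ∈ ball (0 : E n) 1) :
    conj (kerNu n ν z w) = kerNu n ν w z := by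
  have h := Complex.conj_cpow (1 - inner ℂ w z : ℂ) (-(ν : ℂ))
    (Complex.slitPlane_arg_ne_pi (one_sub_inner_mem_slitPlane hz (norm_lt_one_of_mem hw).le))
  have h2 : conj (-(ν : ℂ)) = -(ν : ℂ) := by simp
  rw [h2] at h
  rw [kerNu, ← h, kerNu]
  congr 1
  simp

/-! ### Completeness -/

theorem hasFDerivAt_kerNu {z w : E n} (hz : z ∈ ball (0 : E n) 1) (hw : ‖w‖ ≤ 1) :
    HasFDerivAt (fun z => kerNu n ν z w)
      (((ν : ℂ) * (1 - inner ℂ w z) ^ (-(ν : ℂ) - 1)) • innerSL ℂ w) z := by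
  have h1 : HasFDerivAt (fun z : E n => (1 - inner ℂ w z : ℂ)) (-(innerSL ℂ w)) z := by
    have := ((innerSL ℂ w).hasFDerivAt (x := z)).const_sub 1
    exact this
  have h2 := ((hasDerivAt_id (1 - inner ℂ w z : ℂ)).cpow_const (c := -(ν : ℂ))
    (one_sub_inner_mem_slitPlane hz hw)).comp_hasFDerivAt z h1
  refine h2.congr_fderiv ?_
  simp

/-- For `‖z‖ < r < 1` one has `|1 - ⟨z, w⟩| ≥ 1 - r` uniformly in `w`, which dominates the kernel
and its derivative, so the integral may be differentiated under the sign. -/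
theorem differentiableOn_integral_kerNu {g : E n → ℂ} (hg : Integrable g (muNu n ν)) :
    DifferentiableOn ℂ (fun z => ∫ w, g w * kerNu n ν z w ∂muNu n ν) (ball 0 1) := by
  intro z₀ hz₀
  obtain ⟨r, hr0, hr1⟩ := exists_between (norm_lt_one_of_mem hz₀)
  have hsub : ball (0 : E n) r ⊆ ball 0 1 := ball_subset_ball hr1.le
  have hz₀r : z₀ ∈ ball (0 : E n) r := by simpa using hr0
  have hr0' : 0 < r := lt_of_le_of_lt (norm_nonneg _) hr0
  have hν0 : 0 < ν := lt_of_le_of_lt (Nat.cast_nonneg n) hν.out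
  have hlow : ∀ w ∈ ball (0 : E n) 1, ∀ z ∈ ball (0 : E n) r, 1 - r ≤ ‖(1 - inner ℂ w z : ℂ)‖ := by
    intro w hw z hz
    have h1 : ‖(inner ℂ w z : ℂ)‖ ≤ ‖w‖ * ‖z‖ := norm_inner_le_norm w z
    have h2 := norm_lt_one_of_mem hw
    have h3 : ‖z‖ < r := by simpa using hz
    have h4 := norm_sub_norm_le (1 : ℂ) (inner ℂ w z)
    rw [norm_one] at h4
    nlinarith [norm_nonneg w, norm_nonneg z]
  have hker : ∀ z ∈ ball (0 : E n) 1, ContinuousOn (fun w => kerNu n ν z w) (ball 0 1) := by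
    intro z hz
    have : ContinuousOn (fun w => (starRingEnd ℂ) (kerNu n ν w z)) (ball 0 1) :=
      Complex.continuous_conj.comp_continuousOn
        (differentiableOn_kerNu (norm_lt_one_of_mem hz).le).continuousOn
    exact this.congr fun w hw => (conj_kerNu hw hz).symm
  have hmeas : ∀ z ∈ ball (0 : E n) 1,
      AEStronglyMeasurable (fun w => g w * kerNu n ν z w) (muNu n ν) := fun z hz =>
    hg.aestronglyMeasurable.mul (aestronglyMeasurable_of_continuousOn (hker z hz))
  refine (hasFDerivAt_integral_of_dominated_of_fderiv_le (𝕜 := ℂ)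
    (F' := fun z w => g w • (((ν : ℂ) * (1 - inner ℂ w z) ^ (-(ν : ℂ) - 1)) • innerSL ℂ w))
    (bound := fun w => ‖g w‖ * (ν * (1 - r) ^ (-ν - 1))) (s := ball 0 r)
    (isOpen_ball.mem_nhds hz₀r) ?_ ?_ ?_ ?_ ?_ ?_).differentiableAt.differentiableWithinAt
  · filter_upwards [isOpen_ball.mem_nhds hz₀] with z hz using hmeas z hz
  · refine (hg.norm.mul_const ((1 - r) ^ (-ν))).mono (hmeas z₀ hz₀) ?_
    filter_upwards [ae_mem_ball_mu] with w hw
    have h0 : 0 < 1 - r := by linarith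
    rw [norm_mul, norm_kerNu, norm_mul, norm_norm, Real.norm_of_nonneg (by positivity)]
    gcongr ?_ * ?_
    exact Real.rpow_le_rpow_of_nonpos h0 (hlow w hw z₀ hz₀r) (by linarith)
  · refine hg.aestronglyMeasurable.smul (aestronglyMeasurable_of_continuousOn
      (F := fun w => ((ν : ℂ) * (1 - inner ℂ w z₀) ^ (-(ν : ℂ) - 1))) ?_ |>.smul
        (innerSL ℂ).continuous.aestronglyMeasurable)
    refine continuousOn_const.mul (ContinuousOn.cpow ?_ continuousOn_const fun w hw =>
      one_sub_inner_mem_slitPlane hz₀ (norm_lt_one_of_mem hw).le)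
    fun_prop
  · filter_upwards [ae_mem_ball_mu] with w hw z hz
    have h0 : 0 < 1 - r := by linarith
    have h1 : ‖(1 - inner ℂ w z : ℂ) ^ (-(ν : ℂ) - 1)‖ = ‖(1 - inner ℂ w z : ℂ)‖ ^ (-ν - 1) := by
      rw [← Complex.norm_cpow_real]
      push_cast
      rfl
    rw [norm_smul, norm_smul, norm_mul, h1, Complex.norm_real, Real.norm_of_nonneg hν0.le,
      innerSL_apply_norm]
    have h2 : ‖(1 - inner ℂ w z : ℂ)‖ ^ (-ν - 1) ≤ (1 - r) ^ (-ν - 1) :=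
      Real.rpow_le_rpow_of_nonpos h0 (hlow w hw z hz) (by linarith)
    have h3 := norm_lt_one_of_mem hw
    calc ‖g w‖ * (ν * ‖(1 - inner ℂ w z : ℂ)‖ ^ (-ν - 1) * ‖w‖)
        ≤ ‖g w‖ * (ν * (1 - r) ^ (-ν - 1) * 1) := by gcongr
      _ = _ := by ring
  · exact hg.norm.mul_const _
  · filter_upwards [ae_mem_ball_mu] with w hw z hz
    exact (hasFDerivAt_kerNu (hsub hz) (norm_lt_one_of_mem hw).le).const_mul (g w)

theorem inner_kerVec_eq_integral {z : E n} (hz : z ∈ ball (0 : E n) 1) (f : Lp ℂ 2 (muNu n ν)) :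
    inner ℂ (kerVec ν z : Lp ℂ 2 (muNu n ν)) f = ∫ w, f w * kerNu n ν z w ∂muNu n ν := by
  rw [L2.inner_def]
  refine integral_congr_ae ?_
  filter_upwards [coe_ae_eq_rep (kerVec ν z), ae_mem_ball_mu] with w h1 hw
  rw [h1, rep_kerVec hz hw, RCLike.inner_apply, conj_kerNu hw hz]

/-- An `L²` limit agrees almost everywhere with its pairings against the kernel functions: a
subsequence converges pointwise, and point evaluations are inner products. Those pairings form a
holomorphic function by `differentiableOn_integral_kerNu`. -/
theorem isClosed_bergman : IsClosed (bergman n ν : Set (Lp ℂ 2 (muNu n ν))) := by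
  refine IsSeqClosed.isClosed fun u g hu hg => ?_
  have hgi : Integrable (g : E n → ℂ) (muNu n ν) := (Lp.memLp g).integrable one_le_two
  refine ⟨_, differentiableOn_integral_kerNu hgi, ?_⟩
  have hm := (tendstoInMeasure_of_tendsto_Lp hg)
  obtain ⟨ns, hns, hae⟩ := hm.exists_seq_tendsto_ae
  have hall : ∀ᵐ z ∂muNu n ν, ∀ k, (u k : E n → ℂ) z = rep (⟨u k, hu k⟩ : bergman n ν) z :=
    ae_all_iff.mpr fun k => coe_ae_eq_rep (⟨u k, hu k⟩ : bergman n ν)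
  filter_upwards [hae, hall, ae_mem_ball_mu] with z h1 h2 hz
  refine tendsto_nhds_unique h1 ?_
  have h3 : Filter.Tendsto (fun k => inner ℂ (kerVec ν z : Lp ℂ 2 (muNu n ν)) (u (ns k)))
      Filter.atTop (nhds (inner ℂ (kerVec ν z : Lp ℂ 2 (muNu n ν)) g)) :=
    (tendsto_const_nhds.inner hg).comp hns.tendsto_atTop
  rw [inner_kerVec_eq_integral hz] at h3
  refine h3.congr fun k => ?_
  rw [h2]
  exact inner_kerVec hz (⟨u (ns k), hu (ns k)⟩ : bergman n ν)

instance : CompleteSpace (bergman n ν) := isClosed_bergman.completeSpace_coe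

end Representation

/-! ### Traces of nuclear operators, strong continuity of `π_ν`, and `P₀`. -/

section TraceClass

/-! ### Traces and bounded forms on a Hilbert space -/

section Hilbert

variable {H : Type*} [NormedAddCommGroup H] [InnerProductSpace ℂ H]

local instance instInnerHilbert : Inner ℂ H := InnerProductSpace.toInner

theorem IsNuclearRep.hasSum {A : H →L[ℂ] H} {u v : ℕ → H} (h : IsNuclearRep A u v) (g : H) :
    HasSum (fun k => (inner ℂ (v k) g : ℂ) • u k) (A g) := h.2 g

theorem trace_eq_tsum (A : H →L[ℂ] H) :
    trace A = ∑' e : onBasis H, (inner ℂ (e : H) (A e) : ℂ) := rfl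

theorem orthonormal_onBasis : Orthonormal ℂ ((↑) : onBasis H → H) :=
  (exists_maximal_orthonormal (𝕜 := ℂ) (s := (∅ : Set H)) (by simp)).choose_spec.2.1

variable [CompleteSpace H]

variable (H) in
/-- The Hilbert basis given by the orthonormal set `onBasis H`. -/
def hbasis : HilbertBasis (onBasis H) ℂ H :=
  HilbertBasis.mkOfOrthogonalEqBot (orthonormal_onBasis (H := H)) (by
    rw [Subtype.range_coe]
    refine (maximal_orthonormal_iff_orthogonalComplement_eq_bot (𝕜 := ℂ)
      (v := onBasis H) orthonormal_onBasis).mp ?_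
    exact (exists_maximal_orthonormal (𝕜 := ℂ) (s := (∅ : Set H)) (by simp)).choose_spec.2.2)

theorem hbasis_apply (e : onBasis H) : hbasis H e = e := by
  simp [hbasis]

theorem hasSum_inner_mul_onBasis (x y : H) :
    HasSum (fun e : onBasis H => (inner ℂ x (e : H) : ℂ) * inner ℂ (e : H) y) (inner ℂ x y) := by
  have := (hbasis H).hasSum_inner_mul_inner x y
  simpa only [hbasis_apply] using this

/-- Parseval's identity for both vectors together with the Cauchy-Schwarz inequality. -/
theorem tsum_norm_inner_mul_le (x y : H) :
    Summable (fun e : onBasis H => ‖(inner ℂ x (e : H) : ℂ)‖ * ‖(inner ℂ (e : H) y : ℂ)‖) ∧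
    ∑' e : onBasis H, ‖(inner ℂ x (e : H) : ℂ)‖ * ‖(inner ℂ (e : H) y : ℂ)‖ ≤ ‖x‖ * ‖y‖ := by
  have key : ∀ z : H, HasSum (fun e : onBasis H => ‖(inner ℂ (e : H) z : ℂ)‖ ^ 2) (‖z‖ ^ 2) := by
    intro z
    have h := hasSum_inner_mul_onBasis z z
    rw [inner_self_eq_norm_sq_to_K] at h
    have h2 := Complex.hasSum_re h
    have e1 : (fun e : onBasis H => ((inner ℂ z (e : H) : ℂ) * inner ℂ (e : H) z).re) =
        fun e : onBasis H => ‖(inner ℂ (e : H) z : ℂ)‖ ^ 2 := by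
      funext e
      rw [← inner_conj_symm z (e : H), ← Complex.normSq_eq_conj_mul_self,
        Complex.normSq_eq_norm_sq, Complex.ofReal_re]
    rw [e1] at h2
    convert h2 using 1
    change _ = (((‖z‖ : ℂ)) ^ 2).re
    rw [← Complex.ofReal_pow, Complex.ofReal_re]
  have hx := key x
  have hy := key y
  have hx' : ∀ e : onBasis H, ‖(inner ℂ x (e : H) : ℂ)‖ = ‖(inner ℂ (e : H) x : ℂ)‖ :=
    fun e => norm_inner_symm _ _
  simp only [hx']
  have hx2 : HasSum (fun e : onBasis H => ‖(inner ℂ (e : H) x : ℂ)‖ ^ (2 : ℝ)) (‖x‖ ^ (2 : ℝ)) := by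
    simpa only [Real.rpow_two] using hx
  have hy2 : HasSum (fun e : onBasis H => ‖(inner ℂ (e : H) y : ℂ)‖ ^ (2 : ℝ)) (‖y‖ ^ (2 : ℝ)) := by
    simpa only [Real.rpow_two] using hy
  obtain ⟨C, hC0, hC, hs⟩ := Real.inner_le_Lp_mul_Lq_hasSum_of_nonneg
    (f := fun e : onBasis H => ‖(inner ℂ (e : H) x : ℂ)‖)
    (g := fun e : onBasis H => ‖(inner ℂ (e : H) y : ℂ)‖) Real.HolderConjugate.two_two
    (norm_nonneg x) (norm_nonneg y) (fun _ => norm_nonneg _) (fun _ => norm_nonneg _) hx2 hy2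
  exact ⟨hs.summable, hs.tsum_eq ▸ hC⟩

/-- The trace of a nuclear operator times a bounded one. -/
theorem hasSum_trace_comp {A : H →L[ℂ] H} {u v : ℕ → H} (h : IsNuclearRep A u v)
    (X : H →L[ℂ] H) : HasSum (fun k => (inner ℂ (v k) (X (u k)) : ℂ)) (trace (A ∘L X)) := by
  set Y := ContinuousLinearMap.adjoint X with hY
  have hXY : ∀ a b : H, (inner ℂ a (X b) : ℂ) = inner ℂ (Y a) b := fun a b => by
    rw [hY, ContinuousLinearMap.adjoint_inner_left]
  have hYn : ∀ a, ‖Y a‖ ≤ ‖X‖ * ‖a‖ := fun a => by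
    have := Y.le_opNorm a
    rwa [hY, LinearIsometryEquiv.norm_map] at this
  -- Expanding the rank one terms in the basis gives a double series. It converges absolutely, so it
  -- may be summed over the basis first; in particular the result is the same for every nuclear
  -- representation.
  let f : onBasis H → ℕ → ℂ := fun e k => (inner ℂ (Y (v k)) (e : H) : ℂ) * inner ℂ (e : H) (u k)
  have hs : Summable (Function.uncurry fun (k : ℕ) (e : onBasis H) => f e k) := by
    refine Summable.of_norm ?_
    rw [summable_prod_of_nonneg fun _ => norm_nonneg _]
    refine ⟨fun k => ?_, ?_⟩
    · simpa [f] using (tsum_norm_inner_mul_le (Y (v k)) (u k)).1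
    · refine Summable.of_nonneg_of_le (fun k => tsum_nonneg fun _ => norm_nonneg _) (fun k => ?_)
        (h.1.mul_left ‖X‖)
      have h1 := (tsum_norm_inner_mul_le (Y (v k)) (u k)).2
      simp only [Function.uncurry_apply_pair, f, norm_mul]
      refine h1.trans ?_
      have := hYn (v k)
      nlinarith [norm_nonneg (u k), norm_nonneg (v k)]
  have h1 : ∀ e : onBasis H, HasSum (f e) (inner ℂ (e : H) ((A ∘L X) e)) := fun e => by
    have h2 := (h.hasSum (X e)).mapL (innerSL ℂ (e : H))
    refine h2.congr_fun ?_
    intro k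
    simp [f, inner_smul_right, hXY]
  have h2 : ∀ k, HasSum (fun e => f e k) (inner ℂ (v k) (X (u k))) := fun k => by
    rw [hXY]
    exact hasSum_inner_mul_onBasis _ _
  have h3 : trace (A ∘L X) = ∑' e, ∑' k, f e k := by
    rw [trace_eq_tsum]
    exact tsum_congr fun e => (h1 e).tsum_eq.symm
  have h4 : ∑' e, ∑' k, f e k = ∑' k, ∑' e, f e k := hs.tsum_comm
  rw [h3, h4]
  have h5 : Summable fun k => ∑' e, f e k := hs.prod
  refine h5.hasSum.congr_fun ?_
  intro k
  exact (h2 k).tsum_eq.symm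

theorem norm_trace_comp_le {A : H →L[ℂ] H} (hA : IsTraceClass A) (X : H →L[ℂ] H) :
    ‖trace (A ∘L X)‖ ≤ ‖X‖ * traceNorm A := by
  have key : ∀ u v : ℕ → H, IsNuclearRep A u v →
      ‖trace (A ∘L X)‖ ≤ ‖X‖ * ∑' k, ‖u k‖ * ‖v k‖ := fun u v h => by
    rw [← (hasSum_trace_comp h X).tsum_eq, ← tsum_mul_left]
    refine tsum_of_norm_bounded (h.1.mul_left ‖X‖).hasSum fun k => ?_
    refine (norm_inner_le_norm _ _).trans ?_
    have := X.le_opNorm (u k)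
    nlinarith [norm_nonneg (u k), norm_nonneg (v k)]
  rcases (norm_nonneg X).eq_or_lt with h0 | h0
  · obtain ⟨u, v, h⟩ := hA
    have := key u v h
    rwa [← h0, zero_mul] at this ⊢
  · rw [mul_comm, ← div_le_iff₀ h0]
    obtain ⟨u, v, h⟩ := hA
    refine le_csInf ⟨_, u, v, h, rfl⟩ ?_
    rintro t ⟨u', v', h', rfl⟩
    rw [div_le_iff₀ h0, mul_comm]
    exact key u' v' h'

/-- Parseval applies directly, so `A` need only be bounded. -/
theorem trace_comp_rankOne {P : H →L[ℂ] H} {p q : H} (hP : ∀ g, P g = (inner ℂ q g : ℂ) • p)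
    (A : H →L[ℂ] H) : trace (A ∘L P) = inner ℂ q (A p) := by
  rw [trace_eq_tsum, ← (hasSum_inner_mul_onBasis q (A p)).tsum_eq]
  refine tsum_congr fun e => ?_
  rw [ContinuousLinearMap.comp_apply, hP, map_smul, inner_smul_right]

theorem isNuclearRep_rankOne {P : H →L[ℂ] H} {p q : H} (hP : ∀ g, P g = (inner ℂ q g : ℂ) • p) :
    IsNuclearRep P (fun k => if k = 0 then p else 0) (fun k => if k = 0 then q else 0) := by
  refine ⟨?_, fun g => ?_⟩
  · refine summable_of_ne_finset_zero (s := {0}) fun k hk => ?_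
    rw [Finset.mem_singleton] at hk
    simp [hk]
  · rw [hP]
    have h := hasSum_single (f := fun k : ℕ => (inner ℂ (if k = 0 then q else 0) g : ℂ) •
      (if k = 0 then p else (0 : H))) 0 fun k hk => by simp [hk]
    simpa using h

/-- A bounded sesquilinear form is given by a bounded operator. -/
theorem exists_op_of_form {b : H → H → ℂ} {C : ℝ}
    (add_left : ∀ f f' g, b (f + f') g = b f g + b f' g)
    (smul_left : ∀ (c : ℂ) f g, b (c • f) g = conj c * b f g)
    (add_right : ∀ f g g', b f (g + g') = b f g + b f g')
    (smul_right : ∀ (c : ℂ) f g, b f (c • g) = c * b f g)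
    (bound : ∀ f g, ‖b f g‖ ≤ C * (‖f‖ * ‖g‖)) :
    ∃ V : H →L[ℂ] H, ∀ f g, inner ℂ f (V g) = b f g := by
  have h1 : ∀ g, ∃ r : H, ∀ f, inner ℂ f r = b f g := fun g => by
    let l : H →L[ℂ] ℂ := LinearMap.mkContinuous
      { toFun := fun f => conj (b f g)
        map_add' := fun f f' => by rw [add_left, map_add]
        map_smul' := fun c f => by rw [smul_left, map_mul, Complex.conj_conj]; rfl } (C * ‖g‖)
      fun f => by
        change ‖conj (b f g)‖ ≤ _
        rw [RCLike.norm_conj]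
        exact (bound f g).trans_eq (by ring)
    refine ⟨(InnerProductSpace.toDual ℂ H).symm l, fun f => ?_⟩
    rw [← inner_conj_symm, InnerProductSpace.toDual_symm_apply]
    exact Complex.conj_conj _
  choose V hV using h1
  let L : H →ₗ[ℂ] H :=
    { toFun := V
      map_add' := fun g g' => ext_inner_left ℂ fun f => by
        rw [inner_add_right, hV, hV, hV, add_right]
      map_smul' := fun c g => ext_inner_left ℂ fun f => by
        rw [RingHom.id_apply, inner_smul_right, hV, hV, smul_right] }
  refine ⟨L.mkContinuous C fun g => ?_, fun f g => hV g f⟩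
  have h2 : ‖V g‖ ^ 2 ≤ C * (‖V g‖ * ‖g‖) := by
    have h3 := bound (V g) g
    rw [← hV, inner_self_eq_norm_sq_to_K, norm_pow, RCLike.norm_ofReal, abs_norm] at h3
    exact h3
  change ‖V g‖ ≤ C * ‖g‖
  rcases (norm_nonneg (V g)).eq_or_lt with h0 | h0
  -- No sign is assumed for `C`; the bound at `(g, g)` excludes `C * ‖g‖ < 0`.
  · rw [← h0]
    by_contra! hneg
    have h3 := bound g g
    have h4 : 0 < ‖g‖ := norm_pos_iff.mpr fun h => by simp [h] at hneg
    have := norm_nonneg (b g g)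
    nlinarith
  · nlinarith

end Hilbert

variable {n : ℕ} {ν : ℝ} [hn : Fact (1 ≤ n)] [hν : Fact ((n : ℝ) < ν)]

/-! ### Density of the kernel functions and strong continuity -/

theorem eq_zero_of_inner_kerVec {g : bergman n ν}
    (h : ∀ w ∈ ball (0 : E n) 1, inner ℂ (kerVec ν w) g = 0) : g = 0 := by
  apply bergman_ext
  intro w hw
  have h0 := inner_kerVec (ν := ν) hw 0
  rw [inner_zero_right] at h0
  rw [← inner_kerVec hw, h w hw, h0]

/-- A vector orthogonal to every kernel function vanishes at every point of the ball. -/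
theorem dense_span_kerVec :
    Dense (Submodule.span ℂ (kerVec ν '' ball (0 : E n) 1) : Set (bergman n ν)) := by
  rw [Submodule.dense_iff_topologicalClosure_eq_top,
    Submodule.topologicalClosure_eq_top_iff, Submodule.eq_bot_iff]
  intro g hg
  refine eq_zero_of_inner_kerVec fun w hw => ?_
  exact (Submodule.mem_orthogonal _ _).mp hg _ (Submodule.subset_span ⟨w, hw, rfl⟩)

theorem continuous_nkerNu_orbit {z : E n} (hz : z ∈ ball (0 : E n) 1) :
    Continuous fun x : SU n => nkerNu n ν (act x 0) z := by
  have h0 : Continuous fun x : SU n => act x (0 : E n) := continuous_act_left zero_mem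
  unfold nkerNu kerNu
  refine Continuous.mul (Complex.continuous_ofReal.comp (Continuous.rpow_const (by fun_prop)
    fun x => Or.inl (one_sub_normSq_pos (act_mem x zero_mem)).ne')) ?_
  refine Continuous.cpow (by fun_prop) continuous_const fun x =>
    one_sub_inner_mem_slitPlane hz (norm_lt_one_of_mem (act_mem x zero_mem)).le

theorem continuous_rep_piNu (g : bergman n ν) {z : E n} (hz : z ∈ ball (0 : E n) 1) :
    Continuous fun x : SU n => rep (piNu n ν x g) z := by
  have h1 : (fun x : SU n => rep (piNu n ν x g) z) =
      fun x => nkerNu n ν (act x 0) z * rep g (act x⁻¹ z) := funext fun x => rep_piNu x g hz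
  rw [h1]
  refine (continuous_nkerNu_orbit hz).mul ?_
  exact (rep_differentiableOn g).continuousOn.comp_continuous
    ((continuous_act_left hz).comp continuous_inv) fun x => act_mem _ hz

/-- For `f` in the span of the kernels the coefficient is a combination of point evaluations of
`π(x) g`, which are explicit and continuous. Since `π(x)` is isometric, approximating `f` is uniform
in `x`. -/
theorem continuous_inner_piNu (f g : bergman n ν) :
    Continuous fun x : SU n => (inner ℂ f (piNu n ν x g) : ℂ) := by
  have hspan : ∀ f ∈ Submodule.span ℂ (kerVec ν '' ball (0 : E n) 1),
      Continuous fun x : SU n => (inner ℂ f (piNu n ν x g) : ℂ) := by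
    intro f hf
    induction hf using Submodule.span_induction with
    | mem f hf =>
      obtain ⟨w, hw, rfl⟩ := hf
      simp only [inner_kerVec hw]
      exact continuous_rep_piNu g hw
    | zero => simp only [inner_zero_left]; exact continuous_const
    | add f f' _ _ h h' => simp only [inner_add_left]; exact h.add h'
    | smul c f _ h => simp only [bergman_inner_smul_left]; exact continuous_const.mul h
  refine continuous_of_uniform_approx_of_continuous fun U hU => ?_
  obtain ⟨ε, hε, hεU⟩ := Metric.mem_uniformity_dist.mp hU
  obtain ⟨f', hf', hd⟩ := Metric.dense_iff.mp (dense_span_kerVec (n := n) (ν := ν)) f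
    (ε / (‖g‖ + 1)) (by positivity)
  refine ⟨_, hspan f' hd, fun x => hεU ?_⟩
  rw [dist_eq_norm, ← inner_sub_left]
  refine (norm_inner_le_norm _ _).trans_lt ?_
  have hd' : ‖f - f'‖ < ε / (‖g‖ + 1) := by
    rw [← dist_eq_norm, dist_comm]
    exact hf'
  rw [norm_piNu]
  rw [lt_div_iff₀ (by positivity)] at hd'
  nlinarith [norm_nonneg (f - f')]

/-- Weak continuity together with constant norm gives norm continuity of orbits. -/
theorem continuous_piNu (g : bergman n ν) : Continuous fun x : SU n => piNu n ν x g := by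
  refine continuous_iff_continuousAt.mpr fun x₀ => ?_
  rw [ContinuousAt, tendsto_iff_norm_sub_tendsto_zero]
  have h1 : ∀ x : SU n, ‖piNu n ν x g - piNu n ν x₀ g‖ =
      Real.sqrt (2 * ‖g‖ ^ 2 - 2 * (inner ℂ (piNu n ν x₀ g) (piNu n ν x g) : ℂ).re) := fun x => by
    have h2 := norm_sub_sq (𝕜 := ℂ) (piNu n ν x₀ g) (piNu n ν x g)
    rw [norm_sub_rev, norm_piNu, norm_piNu] at h2
    rw [← Real.sqrt_sq (norm_nonneg (piNu n ν x g - piNu n ν x₀ g)), h2]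
    congr 1
    change ‖g‖ ^ 2 - 2 * (inner ℂ (piNu n ν x₀ g) (piNu n ν x g) : ℂ).re + ‖g‖ ^ 2 = _
    ring
  have h3 : Continuous fun x : SU n =>
      Real.sqrt (2 * ‖g‖ ^ 2 - 2 * (inner ℂ (piNu n ν x₀ g) (piNu n ν x g) : ℂ).re) :=
    (continuous_const.sub (continuous_const.mul
      (Complex.continuous_re.comp (continuous_inner_piNu _ g)))).sqrt
  have h4 := h3.tendsto x₀
  simp only [← h1, sub_self, norm_zero] at h4
  exact h4

/-! ### The projection onto the constants -/

theorem P0_apply (g : bergman n ν) : P0 n ν g = (inner ℂ (oneB n ν) g : ℂ) • oneB n ν := by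
  have h : P0 n ν = (innerSL ℂ (oneB n ν)).smulRight (oneB n ν) := by
    refine opOf_eq fun g => ?_
    have h1 : ∫ w, (g : Lp ℂ 2 (muNu n ν)) w ∂muNu n ν = inner ℂ (oneB n ν) g := by
      rw [inner_oneB, ← integral_eq_value_zero (rep_differentiableOn g) (integrable_rep g)]
      exact integral_congr_ae (coe_ae_eq_rep g)
    filter_upwards [coe_ae_eq_rep ((innerSL ℂ (oneB n ν)).smulRight (oneB n ν) g),
      ae_mem_ball_mu] with z hz hzb
    rw [hz, h1, ContinuousLinearMap.smulRight_apply, rep_smul _ _ hzb, rep_oneB hzb, mul_one]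
    rfl
  rw [h]
  rfl

theorem translate_P0_apply (x : SU n) (g : bergman n ν) : translate x (P0 n ν) g =
    (inner ℂ (piNu n ν x (oneB n ν)) g : ℂ) • piNu n ν x (oneB n ν) := by
  rw [translate_eq, ContinuousLinearMap.comp_apply, ContinuousLinearMap.comp_apply, P0_apply,
    map_smul, ← inner_piNu_left]

/-- The translate of `P₀` is the projection onto `π(x) 1`, the normalized kernel at `x · 0`; so `A *
P₀` is the Berezin transform of `A`. -/
theorem opConv_P0 (A : Op n ν) (x : SU n) : opConv A (P0 n ν) x =
    inner ℂ (piNu n ν x (oneB n ν)) (A (piNu n ν x (oneB n ν))) :=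
  trace_comp_rankOne (translate_P0_apply x) A

theorem piNu_kEmb_oneB (k : U n) : piNu n ν (kEmb k) (oneB n ν) = oneB n ν := by
  apply bergman_ext
  intro z hz
  rw [rep_piNu_oneB _ hz, act_kEmb_zero, nkerNu_zero, rep_oneB hz]

theorem P0_mem_T1K : P0 n ν ∈ T1K n ν := by
  refine ⟨⟨_, _, isNuclearRep_rankOne P0_apply⟩, fun k => ?_⟩
  ext g : 1
  rw [translate_P0_apply, piNu_kEmb_oneB, P0_apply]

theorem IsNuclearRep.translate {A : Op n ν} {u v : ℕ → bergman n ν} (h : IsNuclearRep A u v)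
    (x : SU n) : IsNuclearRep (BergmanQHA.translate x A) (fun k => piNu n ν x (u k))
      (fun k => piNu n ν x (v k)) := by
  refine ⟨by simpa only [norm_piNu] using h.1, fun g => ?_⟩
  rw [translate_eq, ContinuousLinearMap.comp_apply, ContinuousLinearMap.comp_apply]
  have h1 := (h.hasSum (piNu n ν x⁻¹ g)).mapL (piNu n ν x)
  refine h1.congr_fun fun k => ?_
  change inner ℂ (piNu n ν x (v k)) g • piNu n ν x (u k) = _
  rw [map_smul, ← inner_piNu_left]

theorem norm_translate_apply_le (x : SU n) (A : Op n ν) (g : bergman n ν) :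
    ‖translate x A g‖ ≤ ‖A‖ * ‖g‖ := by
  rw [translate_eq, ContinuousLinearMap.comp_apply, ContinuousLinearMap.comp_apply, norm_piNu]
  refine (A.le_opNorm _).trans ?_
  rw [norm_piNu]

theorem inner_translate (x : SU n) (A : Op n ν) (f g : bergman n ν) :
    inner ℂ f (translate x A g) = inner ℂ (piNu n ν x⁻¹ f) (A (piNu n ν x⁻¹ g)) := by
  rw [translate_eq, ContinuousLinearMap.comp_apply, ContinuousLinearMap.comp_apply,
    inner_piNu_right]

theorem continuous_inner_translate (A : Op n ν) (f g : bergman n ν) :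
    Continuous fun x : SU n => (inner ℂ f (translate x A g) : ℂ) := by
  simp only [inner_translate]
  exact ((continuous_piNu f).comp continuous_inv).inner
    (A.continuous.comp ((continuous_piNu g).comp continuous_inv))

end TraceClass

/-! ### Holomorphic parameter integrals and polarization. -/

section Polarization

/-! ### Holomorphic parameter integrals and polarization -/

/-- No dominating function is assumed, only a locally bounded `L¹` norm. Fubini carries Cauchy's
formula for each `f x` over to the integral, and a Cauchy integral is analytic. -/
theorem differentiableOn_integral_param {X : Type*} [MeasurableSpace X] {μ : Measure X}
    [SFinite μ] {D : Set ℂ} (hD : IsOpen D) {f : X → ℂ → ℂ} (hf : ∀ x, DifferentiableOn ℂ (f x) D)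
    (hm : ∀ ζ ∈ D, Measurable fun x => f x ζ) {B : ℂ → ℝ} (hB : ContinuousOn B D)
    (hb : ∀ ζ ∈ D, ∫⁻ x, ‖f x ζ‖ₑ ∂μ ≤ ENNReal.ofReal (B ζ)) :
    DifferentiableOn ℂ (fun ζ => ∫ x, f x ζ ∂μ) D := by
  intro c hc
  obtain ⟨r, hr, hrD⟩ := Metric.nhds_basis_closedBall.mem_iff.mp (hD.mem_nhds hc)
  lift r to NNReal using hr.le
  have hr' : (0 : ℝ) < r := hr
  obtain ⟨M, hM⟩ := (isCompact_closedBall c (r : ℝ)).bddAbove_image (hB.mono hrD)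
  set T : Measure ℝ := volume.restrict (Set.Ioc 0 (2 * Real.pi)) with hT
  have hmem : ∀ θ, circleMap c r θ ∈ closedBall c (r : ℝ) := fun θ =>
    circleMap_mem_closedBall c hr'.le θ
  -- Continuity in the angle and measurability in `x` suffice for joint measurability.
  have hcm : Measurable (Function.uncurry fun (θ : ℝ) (x : X) => f x (circleMap c r θ)) := by
    refine measurable_uncurry_of_continuous_of_measurable (fun x => ?_)
      fun θ => hm _ (hrD (hmem θ))
    exact (hf x).continuousOn.comp_continuous (continuous_circleMap c r) fun θ => hrD (hmem θ)
  have hint : Integrable (Function.uncurry fun (θ : ℝ) (x : X) => f x (circleMap c r θ))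
      (T.prod μ) := by
    refine ⟨hcm.aestronglyMeasurable, ?_⟩
    rw [hasFiniteIntegral_iff_enorm, lintegral_prod _ hcm.enorm.aemeasurable]
    refine (lintegral_mono (g := fun _ => ENNReal.ofReal M) fun θ => ?_).trans_lt ?_
    · refine (hb _ (hrD (hmem θ))).trans (ENNReal.ofReal_le_ofReal ?_)
      exact hM ⟨_, hmem θ, rfl⟩
    · rw [lintegral_const]
      refine ENNReal.mul_lt_top ENNReal.ofReal_lt_top ?_
      simp only [hT, MeasurableSet.univ, Measure.restrict_apply, Set.univ_inter,
        Real.volume_Ioc]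
      exact ENNReal.ofReal_lt_top
  set g : ℂ → ℂ := fun ζ => ∫ x, f x ζ ∂μ with hg
  have hgc : CircleIntegrable g c r := by
    rw [CircleIntegrable, intervalIntegrable_iff_integrableOn_Ioc_of_le (by positivity)]
    exact hint.integral_prod_left
  have hcauchy : ∀ ζ ∈ ball c (r : ℝ), (2 * Real.pi * Complex.I : ℂ)⁻¹ •
      ∮ z in C(c, r), (z - ζ)⁻¹ • g z = g ζ := by
    intro ζ hζ
    have hne : ∀ θ, circleMap c r θ - ζ ≠ 0 := fun θ => by
      refine sub_ne_zero.mpr fun h => ?_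
      rw [← h, mem_ball, dist_eq_norm, circleMap_sub_center, norm_circleMap_zero] at hζ
      simp at hζ
    have hwc : Continuous fun θ : ℝ => deriv (circleMap c r) θ * (circleMap c r θ - ζ)⁻¹ := by
      simp only [deriv_circleMap]
      exact ((continuous_circleMap 0 r).mul continuous_const).mul
        (((continuous_circleMap c r).sub continuous_const).inv₀ hne)
    obtain ⟨K, hK⟩ := (isCompact_Icc (a := (0 : ℝ)) (b := 2 * Real.pi)).bddAbove_image
      hwc.norm.continuousOn
    have hint2 : Integrable (Function.uncurry fun (θ : ℝ) (x : X) =>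
        deriv (circleMap c r) θ * (circleMap c r θ - ζ)⁻¹ * f x (circleMap c r θ)) (T.prod μ) := by
      refine hint.bdd_mul (c := K) (hwc.comp_aestronglyMeasurable
        measurable_fst.aestronglyMeasurable) ?_
      have h1 : ∀ᵐ θ ∂T, ‖deriv (circleMap c r) θ * (circleMap c r θ - ζ)⁻¹‖ ≤ K := by
        filter_upwards [ae_restrict_mem measurableSet_Ioc] with θ hθ
        exact hK ⟨θ, ⟨hθ.1.le, hθ.2⟩, rfl⟩
      exact Measure.quasiMeasurePreserving_fst.ae h1
    have hswap := integral_integral_swap hint2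
    rw [circleIntegral, intervalIntegral.integral_of_le (by positivity)]
    have h1 : ∀ θ, deriv (circleMap c r) θ • (circleMap c r θ - ζ)⁻¹ • g (circleMap c r θ) =
        ∫ x, deriv (circleMap c r) θ * (circleMap c r θ - ζ)⁻¹ * f x (circleMap c r θ) ∂μ :=
      fun θ => by rw [integral_const_mul, smul_eq_mul, smul_eq_mul, mul_assoc]
    simp only [h1]
    rw [hswap, smul_eq_mul, ← integral_const_mul]
    refine integral_congr_ae (Filter.Eventually.of_forall fun x => ?_)
    have h2 := ((hf x).mono hrD).diffContOnCl_ball (U := closedBall c (r : ℝ)) (c := c) (R := r)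
      subset_rfl |>.two_pi_i_inv_smul_circleIntegral_sub_inv_smul hζ
    rw [circleIntegral, intervalIntegral.integral_of_le (by positivity)] at h2
    simp only [smul_eq_mul, ← mul_assoc] at h2 ⊢
    exact h2
  have hps := hasFPowerSeriesOn_cauchy_integral hgc hr
  have hd := hps.analyticAt.differentiableAt
  refine (hd.congr_of_eventuallyEq ?_).differentiableWithinAt
  filter_upwards [ball_mem_nhds c hr'] with ζ hζ
  exact (hcauchy ζ hζ).symm

variable {n : ℕ}

/-- The parameters for which both `p + ζ a` and `p + conj ζ a` lie in the ball. -/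
def polDomain (p a : E n) : Set ℂ :=
  {ζ | p + ζ • a ∈ ball (0 : E n) 1 ∧ p + conj ζ • a ∈ ball (0 : E n) 1}

theorem isOpen_polDomain (p a : E n) : IsOpen (polDomain p a) := by
  refine (isOpen_ball.preimage ?_).inter (isOpen_ball.preimage ?_)
  · fun_prop
  · have := Complex.continuous_conj
    fun_prop

theorem convex_polDomain (p a : E n) : Convex ℝ (polDomain p a) := by
  intro ζ hζ ξ hξ s t hs ht hst
  have hc := convex_ball (0 : E n) 1
  have e1 : p = (s : ℂ) • p + (t : ℂ) • p := by
    rw [← add_smul, ← Complex.ofReal_add, hst, Complex.ofReal_one, one_smul]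
  constructor
  · have h := hc hζ.1 hξ.1 hs ht hst
    convert h using 1
    conv_lhs => rw [e1]
    simp only [smul_add, ← Complex.coe_smul, smul_smul, add_smul, smul_eq_mul]
    abel
  · have h := hc hζ.2 hξ.2 hs ht hst
    convert h using 1
    conv_lhs => rw [e1]
    simp only [smul_add, ← Complex.coe_smul, smul_smul, add_smul, smul_eq_mul, map_add, map_mul,
      Complex.conj_ofReal]
    abel

/-- A sesquiholomorphic function that vanishes on the diagonal vanishes. -/
theorem eq_zero_of_diagonal {F : E n → E n → ℂ}
    (hF : ∀ p a : E n, DifferentiableOn ℂ (fun ζ : ℂ => F (p + ζ • a) (p + conj ζ • a))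
      (polDomain p a))
    (h0 : ∀ z ∈ ball (0 : E n) 1, F z z = 0) {z w : E n} (hz : z ∈ ball (0 : E n) 1)
    (hw : w ∈ ball (0 : E n) 1) : F z w = 0 := by
  -- The parametrized pair `(p + ζ a, p + conj ζ a)` is chosen to be `(z, w)` at `ζ = i` and to lie
  -- on the diagonal for real `ζ`.
  set p : E n := (2⁻¹ : ℂ) • (z + w) with hp
  set a : E n := (-(Complex.I / 2) : ℂ) • (z - w) with ha
  have ez : p + Complex.I • a = z := by
    rw [hp, ha, smul_smul]
    have : Complex.I * -(Complex.I / 2) = 2⁻¹ := by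
      linear_combination (-(1 : ℂ) / 2) * Complex.I_mul_I
    rw [this, ← smul_add, add_add_sub_cancel, ← two_smul ℂ z, smul_smul]
    norm_num
  have ew : p + conj Complex.I • a = w := by
    rw [hp, ha, smul_smul, Complex.conj_I]
    have : -Complex.I * -(Complex.I / 2) = -2⁻¹ := by
      linear_combination ((1 : ℂ) / 2) * Complex.I_mul_I
    rw [this, neg_smul, ← smul_neg, ← smul_add, neg_sub, add_comm z w, add_add_sub_cancel,
      ← two_smul ℂ w, smul_smul]
    norm_num
  have hI : Complex.I ∈ polDomain p a := ⟨by rwa [ez], by rwa [ew]⟩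
  -- The domain is stable under conjugation, so by convexity it contains `0`, the midpoint of `i`
  -- and `-i`.
  have hI' : -Complex.I ∈ polDomain p a := by
    rw [← Complex.conj_I]
    exact ⟨hI.2, by rw [Complex.conj_conj]; exact hI.1⟩
  have h00 : (0 : ℂ) ∈ polDomain p a := by
    have h := convex_polDomain p a hI hI' (by norm_num : (0 : ℝ) ≤ 1 / 2)
      (by norm_num : (0 : ℝ) ≤ 1 / 2) (by norm_num)
    simpa using h
  have han := (hF p a).analyticOnNhd (isOpen_polDomain p a)
  -- Real parameters accumulate at `0` and give zeros, so the identity theorem applies on the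
  -- connected domain.
  have hfreq : ∃ᶠ ζ in nhdsWithin (0 : ℂ) {0}ᶜ, F (p + ζ • a) (p + conj ζ • a) = 0 := by
    have ht : Filter.Tendsto (fun t : ℝ => (t : ℂ)) (nhdsWithin 0 {0}ᶜ) (nhdsWithin 0 {0}ᶜ) := by
      refine tendsto_nhdsWithin_of_tendsto_nhds_of_eventually_within _ ?_ ?_
      · exact (Complex.continuous_ofReal.tendsto' 0 0 (by simp)).mono_left nhdsWithin_le_nhds
      · filter_upwards [self_mem_nhdsWithin] with t ht
        simpa using ht
    refine ht.frequently (Filter.Eventually.frequently ?_)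
    have hev : ∀ᶠ t : ℝ in nhds 0, (t : ℂ) ∈ polDomain p a :=
      (Complex.continuous_ofReal.tendsto' 0 0 (by simp)).eventually
        ((isOpen_polDomain p a).mem_nhds h00)
    filter_upwards [nhdsWithin_le_nhds hev] with t ht
    have h1 := h0 _ ht.1
    rwa [Complex.conj_ofReal]
  have h := han.eqOn_zero_of_preconnected_of_frequently_eq_zero
    (convex_polDomain p a).isPreconnected h00 hfreq hI
  simp only [Pi.zero_apply] at h
  rwa [ez, ew] at h

end Polarization

/-! ### Square integrability of matrix coefficients; the formal degree is `c_ν`. -/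

section OrbitIntegrals

variable {n : ℕ} {ν : ℝ} [hn : Fact (1 ≤ n)] [hν : Fact ((n : ℝ) < ν)]

/-! ### The formal degree -/

theorem integrable_orbit {W : E n → ℂ} (hW : Integrable W (invMeasure n)) :
    Integrable (fun x : SU n => W (act x 0)) (muG n) :=
  (measurePreserving_orbit.integrable_comp_of_integrable hW :)

theorem integral_orbit {X : Type*} [NormedAddCommGroup X] [NormedSpace ℝ X] {W : E n → X}
    (hW : AEStronglyMeasurable W (invMeasure n)) :
    ∫ x : SU n, W (act x 0) ∂muG n = ∫ z, W z ∂invMeasure n := by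
  have h := measurePreserving_orbit (n := n)
  have hW' := hW
  rw [← h.map_eq] at hW' ⊢
  exact (integral_map measurable_orbit.aemeasurable hW').symm

theorem integrable_weight {F : E n → ℂ} (hF : Integrable F (muNu n ν)) :
    Integrable (fun z => (((1 - ‖z‖ ^ 2) ^ ν : ℝ) : ℂ) * F z) (invMeasure n) := by
  have hc := cNu_pos hν.out
  rw [muNu_eq_withDensity hν.out, integrable_withDensity_iff_integrable_smul'
    (measurable_muDensity _ _) (Filter.Eventually.of_forall fun _ => ENNReal.ofReal_lt_top)] at hF
  refine (hF.const_mul (cNu n ν : ℂ)⁻¹).congr ?_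
  filter_upwards [ae_mem_ball_inv] with z hz
  have h := one_sub_normSq_pos hz
  have hc0 : (cNu n ν : ℂ) ≠ 0 := by exact_mod_cast hc.ne'
  rw [ENNReal.toReal_ofReal (by positivity), Complex.real_smul, Complex.ofReal_mul, mul_assoc,
    inv_mul_cancel_left₀ hc0]

theorem integral_weight (F : E n → ℂ) :
    ∫ z, (((1 - ‖z‖ ^ 2) ^ ν : ℝ) : ℂ) * F z ∂invMeasure n =
      (cNu n ν : ℂ)⁻¹ * ∫ z, F z ∂muNu n ν := by
  have hc0 : (cNu n ν : ℂ) ≠ 0 := by exact_mod_cast (cNu_pos hν.out).ne'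
  rw [integral_muNu hν.out, ← integral_const_mul]
  congr 1
  funext z
  rw [Complex.ofReal_mul, mul_assoc, inv_mul_cancel_left₀ hc0]

theorem integrable_orbit_weight {F : E n → ℂ} (hF : Integrable F (muNu n ν)) :
    Integrable (fun x : SU n => (((1 - ‖act x 0‖ ^ 2) ^ ν : ℝ) : ℂ) * F (act x 0)) (muG n) :=
  integrable_orbit (W := fun z => (((1 - ‖z‖ ^ 2) ^ ν : ℝ) : ℂ) * F z) (integrable_weight hF)

theorem integral_orbit_weight {F : E n → ℂ} (hF : Integrable F (muNu n ν)) :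
    ∫ x : SU n, (((1 - ‖act x 0‖ ^ 2) ^ ν : ℝ) : ℂ) * F (act x 0) ∂muG n =
      (cNu n ν : ℂ)⁻¹ * ∫ z, F z ∂muNu n ν := by
  rw [← integral_weight]
  exact integral_orbit (W := fun z => (((1 - ‖z‖ ^ 2) ^ ν : ℝ) : ℂ) * F z)
    (integrable_weight hF).aestronglyMeasurable

theorem inner_piNu_oneB_mul (x : SU n) (f g : bergman n ν) :
    (inner ℂ f (piNu n ν x (oneB n ν)) : ℂ) * inner ℂ (piNu n ν x (oneB n ν)) g =
      (((1 - ‖act x 0‖ ^ 2) ^ ν : ℝ) : ℂ) * (conj (rep f (act x 0)) * rep g (act x 0)) := by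
  have hp := one_sub_normSq_pos (act_mem x (zero_mem (n := n)))
  have h1 : (inner ℂ f (piNu n ν x (oneB n ν)) : ℂ) =
      conj (inner ℂ (piNu n ν x (oneB n ν)) f) := (inner_conj_symm _ _).symm
  rw [h1, inner_piNu_oneB, inner_piNu_oneB, map_mul, Complex.conj_ofReal]
  have h2 : (1 - ‖act x (0 : E n)‖ ^ 2) ^ ν =
      (1 - ‖act x (0 : E n)‖ ^ 2) ^ (ν / 2) * (1 - ‖act x (0 : E n)‖ ^ 2) ^ (ν / 2) := by
    rw [← Real.rpow_add hp, add_halves]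
  rw [h2, Complex.ofReal_mul]
  ring

theorem integrable_conj_rep_mul (f g : bergman n ν) :
    Integrable (fun z => conj (rep f z) * rep g z) (muNu n ν) := by
  exact (memLp_rep f).star.integrable_mul (memLp_rep g)

/-- On the orbit of the constants the product of coefficients depends only on `x · 0`, and its
weight `(1 - ‖z‖²)^ν dλ` is `c_ν⁻¹ μ_ν`. -/
theorem integrable_inner_piNu_oneB (f g : bergman n ν) :
    Integrable (fun x => (inner ℂ f (piNu n ν x (oneB n ν)) : ℂ) *
      inner ℂ (piNu n ν x (oneB n ν)) g) (muG n) ∧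
    ∫ x, (inner ℂ f (piNu n ν x (oneB n ν)) : ℂ) * inner ℂ (piNu n ν x (oneB n ν)) g ∂muG n =
      (cNu n ν : ℂ)⁻¹ * inner ℂ f g := by
  have h1 : (fun x => (inner ℂ f (piNu n ν x (oneB n ν)) : ℂ) *
      inner ℂ (piNu n ν x (oneB n ν)) g) = fun x : SU n => (((1 - ‖act x 0‖ ^ 2) ^ ν : ℝ) : ℂ) *
        (fun z => conj (rep f z) * rep g z) (act x 0) :=
    funext fun x => inner_piNu_oneB_mul x f g
  rw [inner_eq_integral, h1]
  exact ⟨integrable_orbit_weight (F := fun z => conj (rep f z) * rep g z)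
      (integrable_conj_rep_mul f g),
    integral_orbit_weight (F := fun z => conj (rep f z) * rep g z) (integrable_conj_rep_mul f g)⟩

theorem bergman_inner_self (g : bergman n ν) : inner ℂ g g = ((‖g‖ ^ 2 : ℝ) : ℂ) := by
  rw [inner_self_eq_norm_sq_to_K, Complex.ofReal_pow]
  rfl

theorem bergman_inner_conj_symm (f g : bergman n ν) : conj (inner ℂ g f : ℂ) = inner ℂ f g :=
  inner_conj_symm (𝕜 := ℂ) (E := bergman n ν) f g

theorem enorm_sq_eq (a : ℂ) : ‖a‖ₑ ^ 2 = ENNReal.ofReal (‖a‖ ^ 2) := by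
  rw [ENNReal.ofReal_pow (norm_nonneg _), ofReal_norm]

theorem lintegral_inner_piNu_oneB (v : bergman n ν) :
    ∫⁻ x, ‖(inner ℂ v (piNu n ν x (oneB n ν)) : ℂ)‖ₑ ^ 2 ∂muG n =
      ENNReal.ofReal ((cNu n ν)⁻¹ * ‖v‖ ^ 2) := by
  obtain ⟨h1, h2⟩ := integrable_inner_piNu_oneB v v
  have h3 : ∀ x, (inner ℂ v (piNu n ν x (oneB n ν)) : ℂ) * inner ℂ (piNu n ν x (oneB n ν)) v =
      ((‖(inner ℂ v (piNu n ν x (oneB n ν)) : ℂ)‖ ^ 2 : ℝ) : ℂ) := fun x => by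
    rw [← bergman_inner_conj_symm _ v, mul_comm, ← Complex.normSq_eq_conj_mul_self,
      Complex.normSq_eq_norm_sq]
  simp only [h3] at h1 h2
  rw [integral_complex_ofReal, bergman_inner_self, ← Complex.ofReal_inv, ← Complex.ofReal_mul] at h2
  have h2' := Complex.ofReal_injective h2
  simp only [enorm_sq_eq]
  rw [← h2', ofReal_integral_eq_lintegral_ofReal]
  · exact h1.re
  · exact Filter.Eventually.of_forall fun x => by positivity

/-- A kernel vector is a multiple of `π(sec w) 1`, and `π(x) π(sec w)` is `π(x * sec w)` up to a
phase; right invariance of `μ_G` removes `sec w`. -/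
theorem lintegral_inner_piNu_kerVec (v : bergman n ν) (w : E n) :
    ∫⁻ x, ‖(inner ℂ v (piNu n ν x (kerVec ν w)) : ℂ)‖ₑ ^ 2 ∂muG n =
      ENNReal.ofReal ((cNu n ν)⁻¹ * ‖v‖ ^ 2 * ‖kerVec ν w‖ ^ 2) := by
  set a : ℂ := (((1 - ‖w‖ ^ 2) ^ (-(ν / 2)) : ℝ) : ℂ) with ha
  have h1 : ∀ x : SU n, ‖(inner ℂ v (piNu n ν x (kerVec ν w)) : ℂ)‖ₑ ^ 2 =
      ‖a‖ₑ ^ 2 * ‖(inner ℂ v (piNu n ν (x * sec w) (oneB n ν)) : ℂ)‖ₑ ^ 2 := fun x => by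
    obtain ⟨c, hc, h⟩ := piNu_mul (ν := ν) x (sec w)
    have h' := congrArg (fun T : Op n ν => T (oneB n ν)) h
    simp only [ContinuousLinearMap.comp_apply, _root_.smul_apply] at h'
    rw [kerVec, map_smul, h', bergman_inner_smul_right, bergman_inner_smul_right, enorm_mul,
      enorm_mul, mul_pow, mul_pow]
    have : ‖c‖ₑ = 1 := by rw [← ofReal_norm, hc, ENNReal.ofReal_one]
    rw [this, one_pow, one_mul]
  simp only [h1]
  have hm : Measurable fun x : SU n => ‖(inner ℂ v (piNu n ν x (oneB n ν)) : ℂ)‖ₑ ^ 2 :=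
    (continuous_inner_piNu v _).measurable.enorm.pow_const 2
  have hm' : Measurable fun x : SU n =>
      ‖(inner ℂ v (piNu n ν (x * sec w) (oneB n ν)) : ℂ)‖ₑ ^ 2 := hm.comp (measurable_mul_const _)
  rw [lintegral_const_mul _ hm',
    lintegral_mul_right_eq_self (fun x : SU n => ‖(inner ℂ v (piNu n ν x (oneB n ν)) : ℂ)‖ₑ ^ 2),
    lintegral_inner_piNu_oneB, enorm_sq_eq, ← ENNReal.ofReal_mul (by positivity), kerVec, norm_smul,
    norm_piNu, norm_oneB, ← ha]
  congr 1
  ring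

theorem memLp_inner_piNu_kerVec (v : bergman n ν) (w : E n) :
    MemLp (fun x => (inner ℂ v (piNu n ν x (kerVec ν w)) : ℂ)) 2 (muG n) := by
  refine ⟨(continuous_inner_piNu v _).aestronglyMeasurable, ?_⟩
  rw [eLpNorm_lt_top_iff_lintegral_rpow_enorm_lt_top two_ne_zero ENNReal.ofNat_ne_top]
  simp only [ENNReal.toReal_ofNat, ENNReal.rpow_ofNat]
  rw [lintegral_inner_piNu_kerVec]
  exact ENNReal.ofReal_lt_top

theorem inner_kerVec_kerVec {z w : E n} (hz : z ∈ ball (0 : E n) 1) (hw : w ∈ ball (0 : E n) 1) :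
    inner ℂ (kerVec ν z) (kerVec ν w) = kerNu n ν z w := by
  rw [inner_kerVec hz, rep_kerVec hw hz]

theorem differentiableOn_line {F : E n → ℂ} (hF : DifferentiableOn ℂ F (ball 0 1)) (p a : E n) :
    DifferentiableOn ℂ (fun ζ : ℂ => F (p + ζ • a)) (polDomain p a) :=
  hF.comp (by fun_prop) fun _ hζ => hζ.1

theorem differentiableOn_conj_line {F : E n → ℂ} (hF : DifferentiableOn ℂ F (ball 0 1))
    (p a : E n) : DifferentiableOn ℂ (fun ζ : ℂ => conj (F (p + conj ζ • a))) (polDomain p a) := by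
  intro ζ hζ
  have h1 : DifferentiableAt ℂ (fun ξ : ℂ => F (p + ξ • a)) (conj ζ) := by
    have h2 := hF.differentiableAt (isOpen_ball.mem_nhds hζ.2)
    exact DifferentiableAt.comp (conj ζ) (g := F) (f := fun ξ : ℂ => p + ξ • a) h2 (by fun_prop)
  have h3 := h1.conj_conj
  rw [Complex.conj_conj] at h3
  exact h3.differentiableWithinAt

theorem differentiableOn_kerNu_line (p a : E n) :
    DifferentiableOn ℂ (fun ζ : ℂ => kerNu n ν (p + ζ • a) (p + conj ζ • a)) (polDomain p a) := by
  unfold kerNu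
  refine DifferentiableOn.cpow ?_ (differentiableOn_const _) fun ζ hζ =>
    one_sub_inner_mem_slitPlane hζ.1 (norm_lt_one_of_mem hζ.2).le
  have h : ∀ ζ : ℂ, (inner ℂ (p + conj ζ • a) (p + ζ • a) : ℂ) =
      inner ℂ p p + ζ * inner ℂ p a + ζ * inner ℂ a p + ζ * ζ * inner ℂ a a := fun ζ => by
    simp only [inner_add_left, inner_add_right, inner_smul_left, inner_smul_right,
      Complex.conj_conj]
    ring
  simp only [h]
  fun_prop

theorem continuousOn_norm_kerVec_line (p a : E n) :
    ContinuousOn (fun ζ : ℂ => ‖kerVec ν (p + ζ • a)‖ ^ 2) (polDomain p a) ∧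
    ContinuousOn (fun ζ : ℂ => ‖kerVec ν (p + conj ζ • a)‖ ^ 2) (polDomain p a) := by
  have h0 : ContinuousOn (fun w : E n => ‖kerVec ν w‖ ^ 2) (ball 0 1) := by
    have h1 : ContinuousOn (fun w : E n => ((1 - ‖w‖ ^ 2) ^ (-(ν / 2))) ^ 2) (ball 0 1) :=
      (ContinuousOn.rpow_const (by fun_prop) fun w hw => Or.inl (one_sub_normSq_pos hw).ne').pow 2
    exact h1.congr fun w hw => by rw [norm_kerVec hw]
  have hcc := Complex.continuous_conj
  exact ⟨h0.comp (by fun_prop) fun _ h => h.1, h0.comp (by fun_prop) fun _ h => h.2⟩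

theorem enorm_mul_le_sq (a b : ℂ) : ‖a * b‖ₑ ≤ ‖a‖ₑ ^ 2 + ‖b‖ₑ ^ 2 := by
  rw [enorm_sq_eq, enorm_sq_eq, ← ENNReal.ofReal_add (by positivity) (by positivity), ← ofReal_norm,
    norm_mul]
  refine ENNReal.ofReal_le_ofReal ?_
  nlinarith [sq_nonneg (‖a‖ - ‖b‖), sq_nonneg (‖a‖ + ‖b‖)]

/-- Both sides are holomorphic in `z` and antiholomorphic in `w`, and the preceding norm computation
is their equality for `z = w`; polarization gives the rest. -/
theorem integral_inner_piNu_kerVec (v : bergman n ν) {z w : E n} (hz : z ∈ ball (0 : E n) 1)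
    (hw : w ∈ ball (0 : E n) 1) :
    ∫ x, conj (inner ℂ v (piNu n ν x (kerVec ν z)) : ℂ) * inner ℂ v (piNu n ν x (kerVec ν w)) ∂muG n =
      (cNu n ν : ℂ)⁻¹ * ‖v‖ ^ 2 * inner ℂ (kerVec ν z) (kerVec ν w) := by
  rw [inner_kerVec_kerVec hz hw, ← sub_eq_zero]
  have hc := cNu_pos hν.out
  refine eq_zero_of_diagonal (F := fun z w =>
    ∫ x, conj (inner ℂ v (piNu n ν x (kerVec ν z)) : ℂ) *
      inner ℂ v (piNu n ν x (kerVec ν w)) ∂muG n - (cNu n ν : ℂ)⁻¹ * ‖v‖ ^ 2 * kerNu n ν z w)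
    (fun p a => ?_) (fun z hz => ?_) hz hw
  · refine DifferentiableOn.sub ?_ ((differentiableOn_kerNu_line p a).const_mul _)
    have hrep : ∀ (x : SU n) (w : E n), w ∈ ball (0 : E n) 1 →
        (inner ℂ v (piNu n ν x (kerVec ν w)) : ℂ) = conj (rep (piNu n ν x⁻¹ v) w) :=
      fun x w hw => by
        rw [← inner_kerVec hw, bergman_inner_conj_symm, inner_piNu_right]
    obtain ⟨hc1, hc2⟩ := continuousOn_norm_kerVec_line (ν := ν) p a
    refine differentiableOn_integral_param (isOpen_polDomain p a) (B := fun ζ =>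
      (cNu n ν)⁻¹ * ‖v‖ ^ 2 * (‖kerVec ν (p + ζ • a)‖ ^ 2 + ‖kerVec ν (p + conj ζ • a)‖ ^ 2))
      (fun x => ?_) (fun ζ _ => ?_) (continuousOn_const.mul (hc1.add hc2)) (fun ζ _ => ?_)
    · refine DifferentiableOn.mul ?_ ?_
      · refine (differentiableOn_line (rep_differentiableOn (piNu n ν x⁻¹ v)) p a).congr
          fun ζ hζ => ?_
        rw [hrep _ _ hζ.1, Complex.conj_conj]
      · refine (differentiableOn_conj_line (rep_differentiableOn (piNu n ν x⁻¹ v)) p a).congr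
          fun ζ hζ => hrep _ _ hζ.2
    · exact ((Complex.continuous_conj.comp (continuous_inner_piNu v _)).mul
        (continuous_inner_piNu v _)).measurable
    · refine (lintegral_mono fun x => enorm_mul_le_sq _ _).trans ?_
      have hm : ∀ w : E n, Measurable fun x : SU n =>
          ‖(inner ℂ v (piNu n ν x (kerVec ν w)) : ℂ)‖ₑ ^ 2 := fun w =>
        (continuous_inner_piNu v _).measurable.enorm.pow_const 2
      have he : ∀ a : ℂ, ‖conj a‖ₑ = ‖a‖ₑ := fun a => by
        rw [← ofReal_norm, RCLike.norm_conj, ofReal_norm]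
      simp only [he]
      rw [lintegral_add_left (hm _), lintegral_inner_piNu_kerVec, lintegral_inner_piNu_kerVec,
        ← ENNReal.ofReal_add (by positivity) (by positivity), mul_add]
  · have h1 := lintegral_inner_piNu_kerVec v z
    have h2 : ∀ x : SU n, conj (inner ℂ v (piNu n ν x (kerVec ν z)) : ℂ) *
        inner ℂ v (piNu n ν x (kerVec ν z)) =
        ((‖(inner ℂ v (piNu n ν x (kerVec ν z)) : ℂ)‖ ^ 2 : ℝ) : ℂ) := fun x => by
      rw [← Complex.normSq_eq_conj_mul_self, Complex.normSq_eq_norm_sq]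
    simp only [enorm_sq_eq] at h1
    simp only [h2]
    have hcont : Continuous fun x : SU n => ‖(inner ℂ v (piNu n ν x (kerVec ν z)) : ℂ)‖ ^ 2 :=
      (continuous_inner_piNu v _).norm.pow 2
    rw [integral_complex_ofReal, integral_eq_lintegral_of_nonneg_ae
      (Filter.Eventually.of_forall fun x => sq_nonneg _) hcont.aestronglyMeasurable, h1,
      ENNReal.toReal_ofReal (by positivity), ← inner_kerVec_kerVec hz hz, bergman_inner_self]
    push_cast
    ring

theorem memLp_inner_piNu_span (v : bergman n ν) {u : bergman n ν}
    (hu : u ∈ Submodule.span ℂ (kerVec ν '' ball (0 : E n) 1)) :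
    MemLp (fun x => (inner ℂ v (piNu n ν x u) : ℂ)) 2 (muG n) := by
  induction hu using Submodule.span_induction with
  | mem u hu =>
    obtain ⟨w, hw, rfl⟩ := hu
    exact memLp_inner_piNu_kerVec v w
  | zero => simp only [map_zero, inner_zero_right]; exact MemLp.zero
  | add u u' _ _ h h' => simp only [map_add, inner_add_right]; exact h.add h'
  | smul c u _ h => simp only [map_smul, bergman_inner_smul_right]; exact h.const_mul c

theorem integral_inner_piNu_span (v : bergman n ν) {u u' : bergman n ν}
    (hu : u ∈ Submodule.span ℂ (kerVec ν '' ball (0 : E n) 1))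
    (hu' : u' ∈ Submodule.span ℂ (kerVec ν '' ball (0 : E n) 1)) :
    ∫ x, conj (inner ℂ v (piNu n ν x u) : ℂ) * inner ℂ v (piNu n ν x u') ∂muG n =
      (cNu n ν : ℂ)⁻¹ * ‖v‖ ^ 2 * inner ℂ u u' := by
  have hint : ∀ {u u' : bergman n ν}, u ∈ Submodule.span ℂ (kerVec ν '' ball (0 : E n) 1) →
      u' ∈ Submodule.span ℂ (kerVec ν '' ball (0 : E n) 1) → Integrable
        (fun x => conj (inner ℂ v (piNu n ν x u) : ℂ) * inner ℂ v (piNu n ν x u')) (muG n) :=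
    fun h h' => (memLp_inner_piNu_span v h).star.integrable_mul (memLp_inner_piNu_span v h')
  induction hu' using Submodule.span_induction with
  | mem u' hu' =>
    obtain ⟨w, hw, rfl⟩ := hu'
    have hw' : kerVec ν w ∈ Submodule.span ℂ (kerVec ν '' ball (0 : E n) 1) :=
      Submodule.subset_span ⟨w, hw, rfl⟩
    induction hu using Submodule.span_induction with
    | mem u hu =>
      obtain ⟨z, hz, rfl⟩ := hu
      exact integral_inner_piNu_kerVec v hz hw
    | zero => simp
    | add u u' hu hu' h h' =>
      simp only [map_add, inner_add_right, add_mul, inner_add_left, mul_add]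
      rw [integral_add (hint hu hw') (hint hu' hw'), h, h']
    | smul c u hu h =>
      simp only [map_smul, bergman_inner_smul_right, bergman_inner_smul_left, map_mul, mul_assoc]
        at h ⊢
      rw [integral_const_mul, h]
      ring
  | zero => simp
  | add u₁ u₂ h₁ h₂ h h' =>
    simp only [map_add, inner_add_right, mul_add]
    rw [integral_add (hint hu h₁) (hint hu h₂), h, h']
  | smul c u' _ h =>
    simp only [map_smul, bergman_inner_smul_right]
    have h2 : ∀ x : SU n, conj (inner ℂ v (piNu n ν x u) : ℂ) * (c * inner ℂ v (piNu n ν x u')) =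
        c * (conj (inner ℂ v (piNu n ν x u) : ℂ) * inner ℂ v (piNu n ν x u')) := fun x => by ring
    simp only [h2]
    rw [integral_const_mul, h]
    ring

/-- Square integrability of the matrix coefficients. -/
theorem lintegral_inner_piNu_le (v u : bergman n ν) :
    ∫⁻ x, ‖(inner ℂ v (piNu n ν x u) : ℂ)‖ₑ ^ 2 ∂muG n ≤
      ENNReal.ofReal ((cNu n ν)⁻¹ * ‖v‖ ^ 2 * ‖u‖ ^ 2) := by
  have hc := cNu_pos hν.out
  have hspan : ∀ u ∈ Submodule.span ℂ (kerVec ν '' ball (0 : E n) 1),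
      ∫⁻ x, ‖(inner ℂ v (piNu n ν x u) : ℂ)‖ₑ ^ 2 ∂muG n =
        ENNReal.ofReal ((cNu n ν)⁻¹ * ‖v‖ ^ 2 * ‖u‖ ^ 2) := fun u hu => by
    have h1 := integral_inner_piNu_span v hu hu
    have h2 : ∀ x : SU n, conj (inner ℂ v (piNu n ν x u) : ℂ) * inner ℂ v (piNu n ν x u) =
        ((‖(inner ℂ v (piNu n ν x u) : ℂ)‖ ^ 2 : ℝ) : ℂ) := fun x => by
      rw [← Complex.normSq_eq_conj_mul_self, Complex.normSq_eq_norm_sq]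
    simp only [h2] at h1
    rw [integral_complex_ofReal, bergman_inner_self, ← Complex.ofReal_inv, ← Complex.ofReal_pow,
      ← Complex.ofReal_mul, ← Complex.ofReal_mul] at h1
    simp only [enorm_sq_eq]
    rw [← Complex.ofReal_injective h1, ofReal_integral_eq_lintegral_ofReal]
    · exact (memLp_inner_piNu_span v hu).integrable_norm_pow two_ne_zero
    · exact Filter.Eventually.of_forall fun x => by positivity
  -- Passing from the span to a general vector by Fatou's lemma gives only an inequality, which is
  -- all that is needed.
  obtain ⟨s, hs, hlim⟩ := mem_closure_iff_seq_limit.mp (dense_span_kerVec (n := n) (ν := ν) u)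
  have hm : ∀ u : bergman n ν, Measurable fun x : SU n =>
      ‖(inner ℂ v (piNu n ν x u) : ℂ)‖ₑ ^ 2 := fun u =>
    (continuous_inner_piNu v u).measurable.enorm.pow_const 2
  have hpt : ∀ x : SU n, Filter.Tendsto (fun j => ‖(inner ℂ v (piNu n ν x (s j)) : ℂ)‖ₑ ^ 2)
      Filter.atTop (nhds (‖(inner ℂ v (piNu n ν x u) : ℂ)‖ₑ ^ 2)) := fun x => by
    have h1 : Filter.Tendsto (fun j => (inner ℂ v (piNu n ν x (s j)) : ℂ)) Filter.atTop
        (nhds (inner ℂ v (piNu n ν x u))) :=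
      tendsto_const_nhds.inner (((piNu n ν x).continuous.tendsto u).comp hlim)
    exact (ENNReal.continuous_pow 2).continuousAt.tendsto.comp h1.enorm
  have hR : Filter.Tendsto (fun j => ENNReal.ofReal ((cNu n ν)⁻¹ * ‖v‖ ^ 2 * ‖s j‖ ^ 2))
      Filter.atTop (nhds (ENNReal.ofReal ((cNu n ν)⁻¹ * ‖v‖ ^ 2 * ‖u‖ ^ 2))) :=
    ENNReal.tendsto_ofReal ((hlim.norm.pow 2).const_mul _)
  calc ∫⁻ x, ‖(inner ℂ v (piNu n ν x u) : ℂ)‖ₑ ^ 2 ∂muG n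
      = ∫⁻ x, Filter.liminf (fun j => ‖(inner ℂ v (piNu n ν x (s j)) : ℂ)‖ₑ ^ 2) Filter.atTop
          ∂muG n := lintegral_congr fun x => (hpt x).liminf_eq.symm
    _ ≤ Filter.liminf (fun j => ∫⁻ x, ‖(inner ℂ v (piNu n ν x (s j)) : ℂ)‖ₑ ^ 2 ∂muG n)
          Filter.atTop := lintegral_liminf_le fun j => hm (s j)
    _ = _ := by
      simp only [fun j => hspan (s j) (hs j)]
      exact hR.liminf_eq

end OrbitIntegrals

/-! ### Injectivity of the Berezin transform and convolution of two operators. -/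

section OperatorIntegrals

variable {n : ℕ} {ν : ℝ} [hn : Fact (1 ≤ n)] [hν : Fact ((n : ℝ) < ν)]

/-! ### Injectivity of the Berezin transform -/

theorem lintegral_rep_sq (g : bergman n ν) :
    ∫⁻ z, ‖rep g z‖ₑ ^ 2 ∂muNu n ν = ENNReal.ofReal (‖g‖ ^ 2) := by
  have h1 := inner_eq_integral g g
  have h2 : ∀ z, conj (rep g z) * rep g z = ((‖rep g z‖ ^ 2 : ℝ) : ℂ) := fun z => by
    rw [← Complex.normSq_eq_conj_mul_self, Complex.normSq_eq_norm_sq]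
  simp only [h2] at h1
  rw [integral_complex_ofReal, bergman_inner_self] at h1
  simp only [enorm_sq_eq]
  rw [Complex.ofReal_injective h1, ofReal_integral_eq_lintegral_ofReal]
  · exact (memLp_rep g).integrable_norm_pow two_ne_zero
  · exact Filter.Eventually.of_forall fun x => by positivity

/-- The function `⟨V K_w, K_z⟩` is sesquiholomorphic and vanishes on the diagonal, hence everywhere
by polarization; so `V` annihilates a dense subspace. -/
theorem eq_zero_of_inner_kerVec_self {V : Op n ν}
    (h : ∀ w ∈ ball (0 : E n) 1, inner ℂ (kerVec ν w) (V (kerVec ν w)) = 0) : V = 0 := by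
  have hν0 := hν.out
  have key : ∀ z ∈ ball (0 : E n) 1, ∀ w ∈ ball (0 : E n) 1,
      (inner ℂ (kerVec ν z) (V (kerVec ν w)) : ℂ) = 0 := by
    intro z hz w hw
    refine eq_zero_of_diagonal (F := fun z w => (inner ℂ (kerVec ν z) (V (kerVec ν w)) : ℂ))
      (fun p a => ?_) h hz hw
    set W := ContinuousLinearMap.adjoint V with hW
    have hadj : ∀ f g : bergman n ν, (inner ℂ f (V g) : ℂ) = inner ℂ (W f) g := fun f g =>
      (ContinuousLinearMap.adjoint_inner_left V g f).symm
    have hrep : ∀ z ∈ ball (0 : E n) 1, ∀ y ∈ ball (0 : E n) 1,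
        conj (rep (W (kerVec ν z)) y) = rep (V (kerVec ν y)) z := fun z hz y hy => by
      rw [← inner_kerVec hy, bergman_inner_conj_symm, ← hadj, inner_kerVec hz]
    obtain ⟨hc1, hc2⟩ := continuousOn_norm_kerVec_line (ν := ν) p a
    -- Both kernels move with `ζ`. Writing the pairing as an integral over `y` of `(V K_y)(z) K(y,
    -- w)` makes the integrand holomorphic in `ζ` for each fixed `y`, with `L¹` norm controlled by
    -- the norms of the two kernels.
    have hd := differentiableOn_integral_param (μ := muNu n ν) (isOpen_polDomain p a)
      (f := fun y ζ => (ball (0 : E n) 1).indicator (fun y =>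
        rep (V (kerVec ν y)) (p + ζ • a) * kerNu n ν y (p + conj ζ • a)) y)
      (B := fun ζ => ‖V‖ ^ 2 * ‖kerVec ν (p + ζ • a)‖ ^ 2 + ‖kerVec ν (p + conj ζ • a)‖ ^ 2)
      (fun y => ?_) (fun ζ hζ => ?_) ((continuousOn_const.mul hc1).add hc2) (fun ζ hζ => ?_)
    · refine hd.congr fun ζ hζ => ?_
      rw [hadj, inner_eq_integral]
      refine integral_congr_ae ?_
      filter_upwards [ae_mem_ball_mu] with y hy
      rw [Set.indicator_of_mem hy, hrep _ hζ.1 _ hy, rep_kerVec hζ.2 hy]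
    · by_cases hy : y ∈ ball (0 : E n) 1
      · simp only [Set.indicator_of_mem hy]
        refine (differentiableOn_line (rep_differentiableOn (V (kerVec ν y))) p a).mul ?_
        refine (differentiableOn_conj_line
          (differentiableOn_kerNu (ν := ν) (norm_lt_one_of_mem hy).le) p a).congr fun ζ hζ => ?_
        rw [conj_kerNu hζ.2 hy]
      · simp only [Set.indicator_of_notMem hy]
        exact differentiableOn_const _
    · refine measurable_indicator_ball (ContinuousOn.mul ?_
        (differentiableOn_kerNu (norm_lt_one_of_mem hζ.2).le).continuousOn)
      refine (Complex.continuous_conj.comp_continuousOn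
        (rep_differentiableOn (W (kerVec ν (p + ζ • a)))).continuousOn).congr fun y hy => ?_
      exact (hrep _ hζ.1 y hy).symm
    · have hm : AEMeasurable (fun y => ‖rep (W (kerVec ν (p + ζ • a))) y‖ₑ ^ 2) (muNu n ν) :=
        (aestronglyMeasurable_of_continuousOn
          (rep_differentiableOn _).continuousOn).aemeasurable.enorm.pow_const 2
      calc ∫⁻ y, ‖(ball (0 : E n) 1).indicator (fun y =>
            rep (V (kerVec ν y)) (p + ζ • a) * kerNu n ν y (p + conj ζ • a)) y‖ₑ ∂muNu n ν
          ≤ ∫⁻ y, ‖rep (W (kerVec ν (p + ζ • a))) y‖ₑ ^ 2 +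
              ‖rep (kerVec ν (p + conj ζ • a)) y‖ₑ ^ 2 ∂muNu n ν := by
            refine lintegral_mono_ae ?_
            filter_upwards [ae_mem_ball_mu] with y hy
            rw [Set.indicator_of_mem hy, ← hrep _ hζ.1 _ hy, ← rep_kerVec hζ.2 hy]
            refine (enorm_mul_le_sq _ _).trans_eq ?_
            rw [← ofReal_norm (conj _), RCLike.norm_conj, ofReal_norm]
        _ = ENNReal.ofReal (‖W (kerVec ν (p + ζ • a))‖ ^ 2 + ‖kerVec ν (p + conj ζ • a)‖ ^ 2) := by
            rw [lintegral_add_left' hm, lintegral_rep_sq, lintegral_rep_sq,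
              ← ENNReal.ofReal_add (by positivity) (by positivity)]
        _ ≤ _ := by
            refine ENNReal.ofReal_le_ofReal (add_le_add_left ?_ _)
            have h1 := W.le_opNorm (kerVec ν (p + ζ • a))
            rw [hW, LinearIsometryEquiv.norm_map, ← hW] at h1
            rw [← mul_pow]
            exact pow_le_pow_left₀ (norm_nonneg _) h1 2
  have hk : ∀ w ∈ ball (0 : E n) 1, V (kerVec ν w) = 0 := fun w hw =>
    eq_zero_of_inner_kerVec fun z hz => key z hz w hw
  have hker : (Submodule.span ℂ (kerVec ν '' ball (0 : E n) 1)) ≤ LinearMap.ker V.toLinearMap := by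
    rw [Submodule.span_le]
    rintro _ ⟨w, hw, rfl⟩
    exact hk w hw
  ext g : 1
  have hcl : IsClosed {g : bergman n ν | V g = 0} := isClosed_eq V.continuous continuous_const
  exact hcl.closure_subset_iff.mpr (fun g hg => hker hg) (dense_span_kerVec g)

theorem eq_zero_of_inner_orbit {V : Op n ν}
    (h : ∀ x : SU n, inner ℂ (piNu n ν x (oneB n ν)) (V (piNu n ν x (oneB n ν))) = 0) : V = 0 := by
  refine eq_zero_of_inner_kerVec_self fun w _ => ?_
  rw [kerVec, map_smul, bergman_inner_smul_left, bergman_inner_smul_right, h, mul_zero, mul_zero]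

/-! ### Integrability of matrix coefficients -/

/-- Cauchy-Schwarz applied to two square integrable coefficients. -/
theorem lintegral_coeff_mul_le (a b p q : bergman n ν) :
    ∫⁻ x, ‖(inner ℂ (piNu n ν x q) b : ℂ) * inner ℂ a (piNu n ν x p)‖ₑ ∂muG n ≤
      ENNReal.ofReal ((cNu n ν)⁻¹ * (‖a‖ * ‖b‖) * (‖p‖ * ‖q‖)) := by
  have hc := cNu_pos hν.out
  have h1 : ∀ x : SU n, ‖(inner ℂ (piNu n ν x q) b : ℂ) * inner ℂ a (piNu n ν x p)‖ₑ =
      ‖(inner ℂ b (piNu n ν x q) : ℂ)‖ₑ * ‖(inner ℂ a (piNu n ν x p) : ℂ)‖ₑ := fun x => by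
    rw [enorm_mul, ← bergman_inner_conj_symm _ b, ← ofReal_norm (conj _), RCLike.norm_conj,
      ofReal_norm]
  have h2 := ENNReal.lintegral_mul_le_Lp_mul_Lq (muG n) Real.HolderConjugate.two_two
    (f := fun x => ‖(inner ℂ b (piNu n ν x q) : ℂ)‖ₑ)
    (g := fun x => ‖(inner ℂ a (piNu n ν x p) : ℂ)‖ₑ)
    (continuous_inner_piNu b q).measurable.enorm.aemeasurable
    (continuous_inner_piNu a p).measurable.enorm.aemeasurable
  simp only [h1]
  refine h2.trans ?_
  simp only [ENNReal.rpow_ofNat]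
  calc _ ≤ ENNReal.ofReal ((cNu n ν)⁻¹ * ‖b‖ ^ 2 * ‖q‖ ^ 2) ^ (1 / 2 : ℝ) *
        ENNReal.ofReal ((cNu n ν)⁻¹ * ‖a‖ ^ 2 * ‖p‖ ^ 2) ^ (1 / 2 : ℝ) := by
        gcongr
        · exact lintegral_inner_piNu_le b q
        · exact lintegral_inner_piNu_le a p
    _ = _ := by
        rw [ENNReal.ofReal_rpow_of_nonneg (by positivity) (by norm_num),
          ENNReal.ofReal_rpow_of_nonneg (by positivity) (by norm_num),
          ← ENNReal.ofReal_mul (by positivity), ← Real.sqrt_eq_rpow, ← Real.sqrt_eq_rpow,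
          ← Real.sqrt_mul (by positivity)]
        congr 1
        rw [Real.sqrt_eq_iff_eq_sq (by positivity) (by positivity)]
        ring

theorem hasSum_inner_translate {B : Op n ν} {u v : ℕ → bergman n ν} (hB : IsNuclearRep B u v)
    (x : SU n) (a b : bergman n ν) :
    HasSum (fun k => (inner ℂ (piNu n ν x (v k)) b : ℂ) * inner ℂ a (piNu n ν x (u k)))
      (inner ℂ a (translate x B b)) := by
  have h1 := ((hB.translate x).hasSum b).mapL (innerSL ℂ a)
  refine h1.congr_fun fun k => ?_
  change _ = inner ℂ a _
  rw [bergman_inner_smul_right]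

theorem lintegral_inner_translate_le {B : Op n ν} {u v : ℕ → bergman n ν}
    (hB : IsNuclearRep B u v) (a b : bergman n ν) :
    ∫⁻ x, ‖(inner ℂ a (translate x B b) : ℂ)‖ₑ ∂muG n ≤
      ENNReal.ofReal ((cNu n ν)⁻¹ * (∑' k, ‖u k‖ * ‖v k‖) * (‖a‖ * ‖b‖)) := by
  have hc := cNu_pos hν.out
  have hm : ∀ k, Measurable fun x : SU n =>
      ‖(inner ℂ (piNu n ν x (v k)) b : ℂ) * inner ℂ a (piNu n ν x (u k))‖ₑ := fun k =>
    (((continuous_piNu (v k)).inner continuous_const).mul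
      (continuous_inner_piNu a (u k))).measurable.enorm
  calc ∫⁻ x, ‖(inner ℂ a (translate x B b) : ℂ)‖ₑ ∂muG n
      ≤ ∫⁻ x, ∑' k, ‖(inner ℂ (piNu n ν x (v k)) b : ℂ) * inner ℂ a (piNu n ν x (u k))‖ₑ ∂muG n := by
        refine lintegral_mono fun x => ?_
        rw [← (hasSum_inner_translate hB x a b).tsum_eq]
        exact enorm_tsum_le_tsum_enorm
    _ = ∑' k, ∫⁻ x, ‖(inner ℂ (piNu n ν x (v k)) b : ℂ) * inner ℂ a (piNu n ν x (u k))‖ₑ ∂muG n :=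
        lintegral_tsum fun k => (hm k).aemeasurable
    _ ≤ ∑' k, ENNReal.ofReal ((cNu n ν)⁻¹ * (‖a‖ * ‖b‖) * (‖u k‖ * ‖v k‖)) :=
        ENNReal.tsum_le_tsum fun k => lintegral_coeff_mul_le a b (u k) (v k)
    _ = _ := by
        rw [← ENNReal.ofReal_tsum_of_nonneg (fun k => by positivity) (hB.1.mul_left _),
          tsum_mul_left]
        congr 1
        ring

theorem exists_lintegral_inner_translate_le {B : Op n ν} (hB : IsTraceClass B) :
    ∃ C : ℝ, 0 ≤ C ∧ ∀ a b : bergman n ν,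
      ∫⁻ x, ‖(inner ℂ a (translate x B b) : ℂ)‖ₑ ∂muG n ≤ ENNReal.ofReal (C * (‖a‖ * ‖b‖)) := by
  obtain ⟨u, v, h⟩ := hB
  have hc := cNu_pos hν.out
  exact ⟨_, mul_nonneg (inv_nonneg.mpr hc.le) (tsum_nonneg fun k => by positivity),
    lintegral_inner_translate_le h⟩

theorem integrable_inner_translate {B : Op n ν} (hB : IsTraceClass B) (a b : bergman n ν) :
    Integrable (fun x => (inner ℂ a (translate x B b) : ℂ)) (muG n) := by
  obtain ⟨C, -, hC⟩ := exists_lintegral_inner_translate_le hB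
  exact ⟨(continuous_inner_translate B a b).aestronglyMeasurable,
    (hC a b).trans_lt ENNReal.ofReal_lt_top⟩

theorem integral_norm_inner_translate_le {B : Op n ν} {C : ℝ} (hC0 : 0 ≤ C) {a b : bergman n ν}
    (hC : ∫⁻ x, ‖(inner ℂ a (translate x B b) : ℂ)‖ₑ ∂muG n ≤ ENNReal.ofReal (C * (‖a‖ * ‖b‖))) :
    ∫ x, ‖(inner ℂ a (translate x B b) : ℂ)‖ ∂muG n ≤ C * (‖a‖ * ‖b‖) := by
  rw [integral_norm_eq_lintegral_enorm (continuous_inner_translate B a b).aestronglyMeasurable]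
  exact ENNReal.toReal_le_of_le_ofReal (by positivity) hC

/-- The weak integral `∫ ψ(x) π(x) B π(x)* dx` for a bounded function `ψ`. -/
theorem exists_weak_integral {B : Op n ν} (hB : IsTraceClass B) {ψ : SU n → ℂ}
    (hψ : Continuous ψ) {M : ℝ} (hM : ∀ x, ‖ψ x‖ ≤ M) : ∃ V : Op n ν, ∀ f g : bergman n ν,
      inner ℂ f (V g) = ∫ x, ψ x * inner ℂ f (translate x B g) ∂muG n := by
  obtain ⟨C, hC0, hC⟩ := exists_lintegral_inner_translate_le hB
  have hM0 : 0 ≤ M := (norm_nonneg _).trans (hM 1)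
  have hint : ∀ f g : bergman n ν,
      Integrable (fun x => ψ x * inner ℂ f (translate x B g)) (muG n) := fun f g =>
    (integrable_inner_translate hB f g).bdd_mul (c := M) hψ.aestronglyMeasurable
      (Filter.Eventually.of_forall hM)
  refine exists_op_of_form (C := M * C) (b := fun f g =>
    ∫ x, ψ x * inner ℂ f (translate x B g) ∂muG n) (fun f f' g => ?_) (fun c f g => ?_)
    (fun f g g' => ?_) (fun c f g => ?_) fun f g => ?_
  · rw [← integral_add (hint f g) (hint f' g)]
    simp only [inner_add_left, mul_add]
  · rw [← integral_const_mul]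
    refine integral_congr_ae (Filter.Eventually.of_forall fun x => ?_)
    simp only
    rw [bergman_inner_smul_left]
    ring
  · rw [← integral_add (hint f g) (hint f g')]
    simp only [map_add, inner_add_right, mul_add]
  · rw [← integral_const_mul]
    refine integral_congr_ae (Filter.Eventually.of_forall fun x => ?_)
    simp only
    rw [map_smul, bergman_inner_smul_right]
    ring
  · refine (norm_integral_le_integral_norm _).trans ?_
    calc ∫ x, ‖ψ x * inner ℂ f (translate x B g)‖ ∂muG n
        ≤ ∫ x, M * ‖(inner ℂ f (translate x B g) : ℂ)‖ ∂muG n := by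
          refine integral_mono (hint f g).norm
            ((integrable_inner_translate hB f g).norm.const_mul M) fun x => ?_
          simp only [norm_mul]
          exact mul_le_mul_of_nonneg_right (hM x) (norm_nonneg _)
      _ ≤ M * C * (‖f‖ * ‖g‖) := by
          rw [integral_const_mul, mul_assoc]
          exact mul_le_mul_of_nonneg_left (integral_norm_inner_translate_le hC0 (hC f g)) hM0

/-! ### The convolution of operators -/

theorem hasSum_opConv {A : Op n ν} {u v : ℕ → bergman n ν} (hA : IsNuclearRep A u v) (B : Op n ν)
    (x : SU n) : HasSum (fun k => (inner ℂ (v k) (translate x B (u k)) : ℂ)) (opConv A B x) :=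
  hasSum_trace_comp hA (translate x B)

theorem continuous_opConv {A : Op n ν} (hA : IsTraceClass A) (B : Op n ν) :
    Continuous (opConv A B) := by
  obtain ⟨u, v, h⟩ := hA
  have h1 : opConv A B = fun x => ∑' k, (inner ℂ (v k) (translate x B (u k)) : ℂ) :=
    funext fun x => (hasSum_opConv h B x).tsum_eq.symm
  rw [h1]
  refine continuous_tsum (fun k => continuous_inner_translate B _ _) (h.1.mul_left ‖B‖) fun k x => ?_
  refine (norm_inner_le_norm _ _).trans ?_
  have := norm_translate_apply_le x B (u k)
  nlinarith [norm_nonneg (u k), norm_nonneg (v k)]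

/-- A nuclear representation of `A` writes `A * B` as a series of coefficients of translates of `B`,
whose `L¹` norms are summable. -/
theorem integrable_opConv {A B : Op n ν} (hA : IsTraceClass A) (hB : IsTraceClass B) :
    Integrable (opConv A B) (muG n) := by
  refine ⟨(continuous_opConv hA B).aestronglyMeasurable, ?_⟩
  obtain ⟨u, v, h⟩ := hA
  obtain ⟨C, hC0, hC⟩ := exists_lintegral_inner_translate_le hB
  rw [hasFiniteIntegral_iff_enorm]
  calc ∫⁻ x, ‖opConv A B x‖ₑ ∂muG n
      ≤ ∫⁻ x, ∑' k, ‖(inner ℂ (v k) (translate x B (u k)) : ℂ)‖ₑ ∂muG n := by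
        refine lintegral_mono fun x => ?_
        rw [← (hasSum_opConv h B x).tsum_eq]
        exact enorm_tsum_le_tsum_enorm
    _ = ∑' k, ∫⁻ x, ‖(inner ℂ (v k) (translate x B (u k)) : ℂ)‖ₑ ∂muG n :=
        lintegral_tsum fun k => (continuous_inner_translate B _ _).measurable.enorm.aemeasurable
    _ ≤ ∑' k, ENNReal.ofReal (C * (‖v k‖ * ‖u k‖)) := ENNReal.tsum_le_tsum fun k => hC _ _
    _ < ∞ := by
        simp only [mul_comm ‖v _‖]
        rw [← ENNReal.ofReal_tsum_of_nonneg (fun k => by positivity) (h.1.mul_left _)]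
        exact ENNReal.ofReal_lt_top

/-- Expanding `A` in rank one terms, sum and integral may be exchanged; hence integrating `A * B`
against `ψ` is the trace of `A` times the weak integral of the translates of `B`. -/
theorem integral_opConv_mul {A B : Op n ν} (hA : IsTraceClass A) (hB : IsTraceClass B)
    {ψ : SU n → ℂ} (hψ : Continuous ψ) {M : ℝ} (hM : ∀ x, ‖ψ x‖ ≤ M) {X : Op n ν}
    (hX : ∀ f g : bergman n ν, inner ℂ f (X g) = ∫ x, ψ x * inner ℂ f (translate x B g) ∂muG n) :
    ∫ x, ψ x * opConv A B x ∂muG n = trace (A ∘L X) := by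
  obtain ⟨u, v, h⟩ := hA
  obtain ⟨C, hC0, hC⟩ := exists_lintegral_inner_translate_le hB
  have hM0 : 0 ≤ M := (norm_nonneg _).trans (hM 1)
  have hint : ∀ k, Integrable (fun x => ψ x * inner ℂ (v k) (translate x B (u k))) (muG n) :=
    fun k => (integrable_inner_translate hB _ _).bdd_mul (c := M) hψ.aestronglyMeasurable
      (Filter.Eventually.of_forall hM)
  have hbound : ∀ k, ∫ x, ‖ψ x * inner ℂ (v k) (translate x B (u k))‖ ∂muG n ≤
      M * C * (‖u k‖ * ‖v k‖) := fun k => by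
    calc ∫ x, ‖ψ x * inner ℂ (v k) (translate x B (u k))‖ ∂muG n
        ≤ ∫ x, M * ‖(inner ℂ (v k) (translate x B (u k)) : ℂ)‖ ∂muG n := by
          refine integral_mono (hint k).norm
            ((integrable_inner_translate hB _ _).norm.const_mul M) fun x => ?_
          simp only [norm_mul]
          exact mul_le_mul_of_nonneg_right (hM x) (norm_nonneg _)
      _ ≤ M * C * (‖u k‖ * ‖v k‖) := by
          rw [integral_const_mul, mul_assoc, mul_comm ‖u k‖]
          exact mul_le_mul_of_nonneg_left (integral_norm_inner_translate_le hC0 (hC _ _)) hM0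
  have hs : Summable fun k => ∫ x, ‖ψ x * inner ℂ (v k) (translate x B (u k))‖ ∂muG n :=
    Summable.of_nonneg_of_le (fun k => integral_nonneg fun _ => norm_nonneg _) hbound
      (h.1.mul_left _)
  have hpt : ∀ x, HasSum (fun k => ψ x * inner ℂ (v k) (translate x B (u k)))
      (ψ x * opConv A B x) := fun x => (hasSum_opConv h B x).mul_left _
  have h1 := hasSum_integral_of_summable_integral_norm hint hs
  have h2 : (fun x => ∑' k, ψ x * inner ℂ (v k) (translate x B (u k))) =
      fun x => ψ x * opConv A B x := funext fun x => (hpt x).tsum_eq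
  have h3 := hasSum_trace_comp h X
  simp only [hX] at h3
  have h4 : ∫ x, ψ x * opConv A B x ∂muG n = ∫ x, ∑' k, ψ x * inner ℂ (v k)
      (translate x B (u k)) ∂muG n := by rw [h2]
  rw [h4]
  exact h1.unique h3

end OperatorIntegrals

/-! ### Nuclear operators as a Banach space and the convolution `f * A`. -/

section FunctionOperatorConvolution

/-! ### The Banach space of nuclear operators -/

section Nuclear

variable (H : Type*) [NormedAddCommGroup H] [InnerProductSpace ℂ H]

local instance instInnerHilbert' : Inner ℂ H := InnerProductSpace.toInner

/-- Pairs of vectors of norm at most one. -/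
abbrev UnitPair : Type _ := {s : H × H // ‖s.1‖ ≤ 1 ∧ ‖s.2‖ ≤ 1}

/-- Coefficient sequences of nuclear operators. -/
abbrev NucCoeff : Type _ := lp (fun _ : UnitPair H => ℂ) 1

variable {H}

theorem NucCoeff.summable_norm (a : NucCoeff H) : Summable fun s => ‖a s‖ := by
  simpa using (lp.memℓp a).summable (by simp)

theorem NucCoeff.norm_eq (a : NucCoeff H) : ‖a‖ = ∑' s, ‖a s‖ := by
  simpa using lp.norm_eq_tsum_rpow (by simp) a

theorem norm_rankOne_unitPair (s : UnitPair H) :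
    ‖InnerProductSpace.rankOne ℂ s.1.1 s.1.2‖ ≤ 1 := by
  rw [InnerProductSpace.norm_rankOne]
  exact mul_le_one₀ s.2.1 (norm_nonneg _) s.2.2

theorem norm_smul_rankOne_le (a : NucCoeff H) (s : UnitPair H) :
    ‖a s • InnerProductSpace.rankOne ℂ s.1.1 s.1.2‖ ≤ ‖a s‖ := by
  rw [norm_smul]
  exact mul_le_of_le_one_right (norm_nonneg _) (norm_rankOne_unitPair s)

variable [CompleteSpace H]

theorem summable_smul_rankOne (a : NucCoeff H) :
    Summable fun s : UnitPair H => a s • InnerProductSpace.rankOne ℂ s.1.1 s.1.2 :=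
  Summable.of_norm_bounded a.summable_norm (norm_smul_rankOne_le a)

variable (H) in
/-- The operator with given coefficients. -/
def nucSum : NucCoeff H →L[ℂ] (H →L[ℂ] H) :=
  LinearMap.mkContinuous
    { toFun := fun a => ∑' s, a s • InnerProductSpace.rankOne ℂ s.1.1 s.1.2
      map_add' := fun a b => by
        rw [← (summable_smul_rankOne a).tsum_add (summable_smul_rankOne b)]
        refine tsum_congr fun s => ?_
        rw [lp.coeFn_add, Pi.add_apply, add_smul]
      map_smul' := fun c a => by
        rw [RingHom.id_apply, ← (summable_smul_rankOne a).tsum_const_smul c]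
        refine tsum_congr fun s => ?_
        rw [lp.coeFn_smul, Pi.smul_apply, smul_assoc] } 1 fun a => by
    rw [one_mul, a.norm_eq]
    exact tsum_of_norm_bounded a.summable_norm.hasSum (norm_smul_rankOne_le a)

theorem hasSum_nucSum (a : NucCoeff H) :
    HasSum (fun s : UnitPair H => a s • InnerProductSpace.rankOne ℂ s.1.1 s.1.2) (nucSum H a) :=
  (summable_smul_rankOne a).hasSum

instance isClosed_ker_nucSum :
    IsClosed (LinearMap.ker (nucSum H).toLinearMap : Set (NucCoeff H)) :=
  (nucSum H).isClosed_ker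

variable (H) in
/-- The Banach space of nuclear operators. -/
abbrev Nuc : Type _ := NucCoeff H ⧸ LinearMap.ker (nucSum H).toLinearMap

variable (H) in
/-- The operator underlying an element of `Nuc H`. -/
def nucOp : Nuc H →L[ℂ] (H →L[ℂ] H) :=
  (LinearMap.ker (nucSum H).toLinearMap).liftQL (nucSum H) le_rfl

theorem nucOp_mk (a : NucCoeff H) : nucOp H (Submodule.Quotient.mk a) = nucSum H a := rfl

theorem nucOp_injective : Function.Injective (nucOp H) := by
  intro x y
  induction x using Submodule.Quotient.induction_on with | _ a
  induction y using Submodule.Quotient.induction_on with | _ b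
  intro h
  rw [nucOp_mk, nucOp_mk] at h
  rw [Submodule.Quotient.eq]
  change nucSum H (a - b) = 0
  rw [map_sub, h, sub_self]

/-- An `ℓ¹` family has countable support, so it can be indexed by `ℕ`, with zero terms outside the
range of the indexing. -/
theorem isTraceClass_nucOp (N : Nuc H) : IsTraceClass (nucOp H N) := by
  induction N using Submodule.Quotient.induction_on with | _ a
  rw [nucOp_mk]
  have hcount : (Function.support fun s => ‖a s‖).Countable := a.summable_norm.countable_support
  obtain ⟨f, hf⟩ := (Set.countable_iff_exists_injOn.mp hcount)
  set T := Function.support fun s : UnitPair H => ‖a s‖ with hT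
  have hinj : Function.Injective fun s : T => f s := fun s t h => Subtype.ext (hf s.2 t.2 h)
  set u : ℕ → H := Function.extend (fun s : T => f s) (fun s : T => a s.1 • s.1.1.1) 0 with hu
  set v : ℕ → H := Function.extend (fun s : T => f s) (fun s : T => s.1.1.2) 0 with hv
  have hu0 : ∀ k ∉ Set.range fun s : T => f s, u k = 0 := fun k hk => by
    rw [hu, Function.extend_apply' _ _ _ hk, Pi.zero_apply]
  refine ⟨u, v, ?_, fun g => ?_⟩
  · rw [← hinj.summable_iff (fun k hk => by rw [hu0 k hk, norm_zero, zero_mul])]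
    refine Summable.of_nonneg_of_le (fun s => mul_nonneg (norm_nonneg _) (norm_nonneg _)) (fun s => ?_)
      (a.summable_norm.comp_injective (Subtype.val_injective (p := fun s => s ∈ T)))
    simp only [Function.comp_apply, hu, hv, hinj.extend_apply, norm_smul]
    have h1 := s.1.2.1
    have h2 := s.1.2.2
    rw [mul_assoc]
    exact mul_le_of_le_one_right (norm_nonneg _) (mul_le_one₀ h1 (norm_nonneg _) h2)
  · have h1 := (hasSum_nucSum a).mapL (ContinuousLinearMap.apply ℂ H g)
    have hz : ∀ k ∉ Set.range fun s : T => f s, (inner ℂ (v k) g : ℂ) • u k = 0 := fun k hk => by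
      rw [hu0 k hk, smul_zero]
    have h2 : HasSum (fun k => (inner ℂ (v k) g : ℂ) • u k) (nucSum H a g) := by
      rw [← hinj.hasSum_iff hz]
      have h3 : HasSum ((fun s : UnitPair H => a s • (inner ℂ s.1.2 g : ℂ) • s.1.1) ∘
          ((↑) : T → UnitPair H)) (nucSum H a g) := by
        rw [hasSum_subtype_iff_of_support_subset]
        · exact h1
        · intro s hs
          rw [hT, Function.mem_support, norm_ne_zero_iff]
          rintro h0
          exact hs (by simp only [h0, zero_smul])
      refine h3.congr_fun fun s => ?_
      simp only [Function.comp_apply, hu, hv, hinj.extend_apply]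
      rw [smul_comm]
    exact h2

open Classical in
/-- The rank one operator `u ⊗ v` as an element of `Nuc H`. -/
def nucRk (u v : H) : Nuc H :=
  if h : u ≠ 0 ∧ v ≠ 0 then
    (‖u‖ * ‖v‖ : ℂ) • Submodule.Quotient.mk (lp.single 1 (⟨((‖u‖ : ℂ)⁻¹ • u, (‖v‖ : ℂ)⁻¹ • v), by
      have h1 := norm_ne_zero_iff.mpr h.1
      have h2 := norm_ne_zero_iff.mpr h.2
      simp [norm_smul, h1, h2]⟩ : UnitPair H) (1 : ℂ))
  else 0

theorem nucOp_nucRk (u v : H) : nucOp H (nucRk u v) = InnerProductSpace.rankOne ℂ u v := by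
  classical
  rw [nucRk]
  split_ifs with h
  · have h1 : (‖u‖ : ℂ) ≠ 0 := by exact_mod_cast norm_ne_zero_iff.mpr h.1
    have h2 : (‖v‖ : ℂ) ≠ 0 := by exact_mod_cast norm_ne_zero_iff.mpr h.2
    rw [map_smul, nucOp_mk, ← (hasSum_nucSum _).tsum_eq, tsum_eq_single _ fun s hs => by
      rw [lp.single_apply_ne _ _ _ hs, zero_smul], lp.single_apply_self, one_smul]
    ext g
    simp only [_root_.smul_apply, InnerProductSpace.rankOne_apply, inner_smul_left, smul_smul,
      map_inv₀, Complex.conj_ofReal]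
    congr 1
    field_simp
  · rw [map_zero]
    rw [not_and_or, not_not, not_not] at h
    rcases h with rfl | rfl <;> simp

theorem norm_nucRk_le (u v : H) : ‖nucRk u v‖ ≤ ‖u‖ * ‖v‖ := by
  classical
  rw [nucRk]
  split_ifs with h
  · rw [norm_smul]
    have h1 : ‖(‖u‖ * ‖v‖ : ℂ)‖ = ‖u‖ * ‖v‖ := by simp
    rw [h1]
    refine mul_le_of_le_one_right (by positivity) ((Submodule.Quotient.norm_mk_le _ _).trans ?_)
    rw [lp.norm_single (by simp), norm_one]
  · rw [norm_zero]
    positivity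

/-- Elements of `Nuc H` are determined by their operators, so bilinearity is checked there; the
identity gives continuity of `nucRk`. -/
theorem nucRk_sub_nucRk (u v u' v' : H) :
    nucRk u v - nucRk u' v' = nucRk (u - u') v + nucRk u' (v - v') := by
  apply nucOp_injective
  simp only [map_sub, map_add, nucOp_nucRk, _root_.sub_apply]
  abel

theorem continuous_nucRk : Continuous fun p : H × H => nucRk p.1 p.2 := by
  refine continuous_iff_continuousAt.mpr fun p => ?_
  rw [ContinuousAt, tendsto_iff_norm_sub_tendsto_zero]
  have h1 : Continuous fun q : H × H => ‖q.1 - p.1‖ * ‖q.2‖ + ‖p.1‖ * ‖q.2 - p.2‖ := by fun_prop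
  have h2 := h1.tendsto p
  simp only [sub_self, norm_zero, zero_mul, mul_zero, add_zero] at h2
  refine squeeze_zero (fun _ => norm_nonneg _) (fun q => ?_) h2
  rw [nucRk_sub_nucRk]
  exact (norm_add_le _ _).trans (add_le_add (norm_nucRk_le _ _) (norm_nucRk_le _ _))

end Nuclear

variable {n : ℕ} {ν : ℝ} [hn : Fact (1 ≤ n)] [hν : Fact ((n : ℝ) < ν)]

/-! ### The convolution of a function and an operator -/

/-- The translates lift to a bounded map that is continuous in the nuclear norm: each rank one term
is continuous because orbits of `π` are, and the series converges uniformly in `x`. -/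
theorem exists_nuc_translate {A : Op n ν} (hA : IsTraceClass A) :
    ∃ N : SU n → Nuc (bergman n ν), Continuous N ∧ (∀ x, nucOp _ (N x) = translate x A) ∧
      ∃ C : ℝ, ∀ x, ‖N x‖ ≤ C := by
  obtain ⟨u, v, h⟩ := hA
  have hb : ∀ k (x : SU n), ‖nucRk (piNu n ν x (u k)) (piNu n ν x (v k))‖ ≤ ‖u k‖ * ‖v k‖ :=
    fun k x => (norm_nucRk_le _ _).trans_eq (by rw [norm_piNu, norm_piNu])
  refine ⟨fun x => ∑' k, nucRk (piNu n ν x (u k)) (piNu n ν x (v k)), ?_, fun x => ?_,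
    ∑' k, ‖u k‖ * ‖v k‖, fun x => tsum_of_norm_bounded h.1.hasSum fun k => hb k x⟩
  · refine continuous_tsum (fun k => ?_) h.1 hb
    exact continuous_nucRk.comp ((continuous_piNu (u k)).prodMk (continuous_piNu (v k)))
  · have hs : Summable fun k => nucRk (piNu n ν x (u k)) (piNu n ν x (v k)) :=
      Summable.of_norm_bounded h.1 fun k => hb k x
    ext g : 1
    have h1 := (hs.hasSum.mapL (nucOp _)).mapL (ContinuousLinearMap.apply ℂ (bergman n ν) g)
    refine h1.unique ?_
    refine ((h.translate x).hasSum g).congr_fun fun k => ?_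
    change nucOp _ (nucRk _ _) g = _
    rw [nucOp_nucRk, InnerProductSpace.rankOne_apply]

/-- A weak integral alone would only give a bounded operator. As a Bochner integral in `Nuc`, it is
trace class. -/
theorem exists_funOpConv {F : SU n → ℂ} (hF : Integrable F (muG n)) {A : Op n ν}
    (hA : IsTraceClass A) : ∃ V : Op n ν, IsTraceClass V ∧ ∀ g h : bergman n ν,
      inner ℂ h (V g) = ∫ x, F x * inner ℂ h (translate x A g) ∂muG n := by
  obtain ⟨N, hN, hNA, C, hC⟩ := exists_nuc_translate hA
  have hint : Integrable (fun x => F x • N x) (muG n) :=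
    hF.smul_bdd C hN.aestronglyMeasurable (Filter.Eventually.of_forall hC)
  refine ⟨nucOp _ (∫ x, F x • N x ∂muG n), isTraceClass_nucOp _, fun g h => ?_⟩
  have h1 := ((innerSL ℂ h).comp ((ContinuousLinearMap.apply ℂ (bergman n ν) g).comp
    (nucOp (bergman n ν)))).integral_comp_comm hint
  refine h1.symm.trans (integral_congr_ae (Filter.Eventually.of_forall fun x => ?_))
  simp only [map_smul, smul_eq_mul]
  change F x * inner ℂ h (nucOp _ (N x) g) = _
  rw [hNA]

theorem funOpConv_spec {F : SU n → ℂ} (hF : Integrable F (muG n)) {A : Op n ν}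
    (hA : IsTraceClass A) (g h : bergman n ν) :
    inner ℂ h (funOpConv F A g) = ∫ x, F x * inner ℂ h (translate x A g) ∂muG n := by
  obtain ⟨V, -, hV⟩ := exists_funOpConv hF hA
  exact Classical.epsilon_spec (p := fun V : Op n ν => ∀ g h : bergman n ν,
    inner ℂ h (V g) = ∫ x, F x * inner ℂ h (translate x A g) ∂muG n) ⟨V, hV⟩ g h

theorem isTraceClass_funOpConv {F : SU n → ℂ} (hF : Integrable F (muG n)) {A : Op n ν}
    (hA : IsTraceClass A) : IsTraceClass (funOpConv F A) := by
  obtain ⟨V, hVt, hV⟩ := exists_funOpConv hF hA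
  have : funOpConv F A = V := by
    ext g : 1
    refine ext_inner_left ℂ fun h => ?_
    rw [funOpConv_spec hF hA, hV]
  rwa [this]

theorem isRadialOp_funOpConv {F : SU n → ℂ} (hF : Integrable F (muG n))
    (hK : ∀ k : U n, (fun x => F (kEmb k * x)) =ᵐ[muG n] F) {A : Op n ν}
    (hA : IsTraceClass A) : IsRadialOp (funOpConv F A) := by
  intro k
  ext g : 1
  refine ext_inner_left ℂ fun h => ?_
  rw [inner_translate, funOpConv_spec hF hA, funOpConv_spec hF hA,
    ← integral_mul_left_eq_self (fun x => F x * inner ℂ h (translate x A g)) (kEmb k)]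
  refine integral_congr_ae ?_
  filter_upwards [hK k] with x hx
  rw [hx, translate_mul, inner_translate (kEmb k)]

end FunctionOperatorConvolution

/-! ### Radial functions on the group and the product of the algebra. -/

section ConvolutionAlgebra

variable {n : ℕ} {ν : ℝ} [hn : Fact (1 ≤ n)] [hν : Fact ((n : ℝ) < ν)]

/-! ### Radial integrable functions -/

theorem measurable_onG (f : L1K n) : Measurable (onG f) :=
  (((Lp.stronglyMeasurable (f : Lp ℂ 1 (invMeasure n))).measurable).comp measurable_orbit :)

theorem integrable_onG (f : L1K n) : Integrable (onG f) (muG n) :=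
  integrable_orbit (W := ((f : Lp ℂ 1 (invMeasure n)) : E n → ℂ)) (L1.integrable_coeFn _)

theorem integral_norm_onG (f : L1K n) : ∫ x, ‖onG f x‖ ∂muG n = ‖f‖ := by
  have h1 : ∫ x, ‖onG f x‖ ∂muG n = ∫ z, ‖(f : Lp ℂ 1 (invMeasure n)) z‖ ∂invMeasure n :=
    integral_orbit (W := fun z => ‖(f : Lp ℂ 1 (invMeasure n)) z‖)
      (L1.integrable_coeFn _).norm.aestronglyMeasurable
  rw [h1, ← L1.norm_eq_integral_norm]
  rfl

theorem onG_mul_kEmb (f : L1K n) (x : SU n) (k : U n) : onG f (x * kEmb k) = onG f x := by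
  rw [onG, pull, pull, act_mul_kEmb_zero]

theorem ae_orbit {P : E n → Prop} (h : ∀ᵐ z ∂invMeasure n, P z) :
    ∀ᵐ x ∂muG n, P (act (x : SU n) 0) :=
  measurePreserving_orbit.quasiMeasurePreserving.ae h

theorem onG_kEmb_mul (f : L1K n) (k : U n) : (fun x => onG f (kEmb k * x)) =ᵐ[muG n] onG f := by
  obtain ⟨F, hF, hf⟩ := f.2
  have h1 : ∀ᵐ x ∂muG n, onG f x = F (act x 0) :=
    ae_orbit (P := fun z => (f : Lp ℂ 1 (invMeasure n)) z = F z) hf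
  have h2 := (measurePreserving_mul_left (muG n) (kEmb k)).quasiMeasurePreserving.ae h1
  filter_upwards [h1, h2] with x hx hx'
  rw [hx, hx', act_mul _ _ zero_mem, hF]

theorem onG_add (f g : L1K n) : onG (f + g) =ᵐ[muG n] fun x => onG f x + onG g x :=
  ae_orbit (P := fun z => ((f + g : L1K n) : Lp ℂ 1 (invMeasure n)) z =
    (f : Lp ℂ 1 (invMeasure n)) z + (g : Lp ℂ 1 (invMeasure n)) z) (Lp.coeFn_add _ _)

theorem onG_smul (c : ℂ) (f : L1K n) : onG (c • f) =ᵐ[muG n] fun x => c * onG f x :=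
  ae_orbit (P := fun z => ((c • f : L1K n) : Lp ℂ 1 (invMeasure n)) z =
    c * (f : Lp ℂ 1 (invMeasure n)) z) (Lp.coeFn_smul _ _)

theorem onG_zero : onG (0 : L1K n) =ᵐ[muG n] 0 :=
  ae_orbit (P := fun z => ((0 : L1K n) : Lp ℂ 1 (invMeasure n)) z = 0) (Lp.coeFn_zero _ _ _)

theorem onG_sub (f g : L1K n) : onG (f - g) =ᵐ[muG n] fun x => onG f x - onG g x :=
  ae_orbit (P := fun z => ((f - g : L1K n) : Lp ℂ 1 (invMeasure n)) z =
    (f : Lp ℂ 1 (invMeasure n)) z - (g : Lp ℂ 1 (invMeasure n)) z) (Lp.coeFn_sub _ _)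

theorem onG_injective {f g : L1K n} (h : onG f =ᵐ[muG n] onG g) : f = g := by
  rw [← sub_eq_zero, ← norm_eq_zero, ← integral_norm_onG]
  have h1 : onG (f - g) =ᵐ[muG n] fun _ => 0 := by
    filter_upwards [h, onG_sub f g] with x h3 h4
    rw [h4, h3, sub_self]
  have h2 : (fun x => ‖onG (f - g) x‖) =ᵐ[muG n] fun _ => 0 := by
    filter_upwards [h1] with x hx
    rw [hx, norm_zero]
  rw [integral_congr_ae h2, integral_zero]

/-- An integrable bi-`K`-invariant function on `G` comes from a radial function on the ball. -/
theorem exists_onG_eq {F : SU n → ℂ} (hm : Measurable F) (hi : Integrable F (muG n))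
    (hl : ∀ (k : U n) x, F (kEmb k * x) = F x) (hr : ∀ x (k : U n), F (x * kEmb k) = F x) :
    ∃ f : L1K n, onG f =ᵐ[muG n] F := by
  classical
  -- `F` is read along the section; right `K`-invariance gives `F (sec (x · 0)) = F x`.
  set s : E n → SU n := (ball (0 : E n) 1).piecewise sec fun _ => 1 with hs
  have hsm : Measurable s := continuousOn_sec.measurable_piecewise continuousOn_const
    measurableSet_ball
  set W : E n → ℂ := (ball (0 : E n) 1).indicator fun z => F (s z) with hW
  have hWm : Measurable W := (hm.comp hsm).indicator measurableSet_ball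
  have hWF : ∀ x : SU n, W (act x 0) = F x := fun x => by
    have hx := act_mem x (zero_mem (n := n))
    obtain ⟨k, hk⟩ := exists_eq_sec_mul x
    rw [hW, Set.indicator_of_mem hx, hs, Set.piecewise_eq_of_mem _ _ _ hx]
    conv_rhs => rw [hk, hr]
  have hWi : Integrable W (invMeasure n) := by
    rw [← measurePreserving_orbit.integrable_comp hWm.aestronglyMeasurable]
    exact hi.congr (Filter.Eventually.of_forall fun x => (hWF x).symm)
  have hWK : ∀ (k : U n) (z : E n), W (act (kEmb k) z) = W z := fun k z => by
    by_cases hz : z ∈ ball (0 : E n) 1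
    · rw [← act_sec hz, ← act_mul _ _ zero_mem, hWF, hWF, hl]
    · have hz' : act (kEmb k) z ∉ ball (0 : E n) 1 := by
        rw [mem_ball_zero_iff] at hz ⊢
        rwa [norm_act_kEmb]
      rw [hW, Set.indicator_of_notMem hz, Set.indicator_of_notMem hz']
  refine ⟨⟨hWi.toL1 W, W, hWK, hWi.coeFn_toL1⟩, ?_⟩
  have h1 := ae_orbit hWi.coeFn_toL1
  filter_upwards [h1] with x hx
  rw [← hWF]
  exact hx

/-! ### Convolution of functions on the group -/

theorem measurable_conv {F H : SU n → ℂ} (hF : Measurable F) (hH : Measurable H) :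
    Measurable (conv F H) := by
  have hm : Measurable fun p : SU n × SU n => F p.2 * H (p.2⁻¹ * p.1) :=
    (hF.comp measurable_snd).mul (hH.comp (measurable_snd.inv.mul measurable_fst))
  exact (hm.stronglyMeasurable.integral_prod_right' (ν := muG n)).measurable

/-- The shear `(y, x) ↦ (y, y⁻¹ x)` preserves the product measure. -/
theorem integrable_conv_kernel {F H : SU n → ℂ} (hF : Integrable F (muG n))
    (hH : Integrable H (muG n)) :
    Integrable (fun p : SU n × SU n => F p.1 * H (p.1⁻¹ * p.2)) ((muG n).prod (muG n)) :=
  ((measurePreserving_prod_inv_mul (muG n) (muG n)).integrable_comp_of_integrable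
    (hF.mul_prod hH) :)

theorem integrable_conv {F H : SU n → ℂ} (hF : Integrable F (muG n)) (hH : Integrable H (muG n)) :
    Integrable (conv F H) (muG n) :=
  (integrable_conv_kernel hF hH).integral_prod_right

theorem integral_conv_mul {F H : SU n → ℂ} (hF : Integrable F (muG n))
    (hH : Integrable H (muG n)) {ψ : SU n → ℂ} (hψ : Measurable ψ) {M : ℝ} (hM : ∀ x, ‖ψ x‖ ≤ M) :
    ∫ x, conv F H x * ψ x ∂muG n = ∫ y, F y * ∫ x, H x * ψ (y * x) ∂muG n ∂muG n := by
  have h1 : Integrable (Function.uncurry fun (x y : SU n) => F y * H (y⁻¹ * x) * ψ x)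
      ((muG n).prod (muG n)) := by
    have h2 : Integrable (fun p : SU n × SU n => F p.1 * H (p.1⁻¹ * p.2) * ψ p.2)
        ((muG n).prod (muG n)) :=
      (integrable_conv_kernel hF hH).mul_bdd (c := M)
        (hψ.comp measurable_snd).aestronglyMeasurable
        (Filter.Eventually.of_forall fun p => hM p.2)
    exact h2.swap
  calc ∫ x, conv F H x * ψ x ∂muG n
      = ∫ x, ∫ y, F y * H (y⁻¹ * x) * ψ x ∂muG n ∂muG n := by
        refine integral_congr_ae (Filter.Eventually.of_forall fun x => ?_)
        simp only [conv]
        rw [integral_mul_const]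
    _ = ∫ y, ∫ x, F y * H (y⁻¹ * x) * ψ x ∂muG n ∂muG n := integral_integral_swap h1
    _ = _ := by
        refine integral_congr_ae (Filter.Eventually.of_forall fun y => ?_)
        simp only [mul_assoc]
        rw [integral_const_mul]
        congr 1
        rw [← integral_mul_left_eq_self (fun x => H (y⁻¹ * x) * ψ x) y]
        simp only [inv_mul_cancel_left]

theorem integral_norm_conv_le {F H : SU n → ℂ} (hF : Integrable F (muG n))
    (hH : Integrable H (muG n)) :
    ∫ x, ‖conv F H x‖ ∂muG n ≤ (∫ x, ‖F x‖ ∂muG n) * ∫ x, ‖H x‖ ∂muG n := by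
  have h1 := integrable_conv_kernel hF hH
  have h2 : Integrable (Function.uncurry fun (x y : SU n) => ‖F y * H (y⁻¹ * x)‖)
      ((muG n).prod (muG n)) := h1.norm.swap
  calc ∫ x, ‖conv F H x‖ ∂muG n ≤ ∫ x, ∫ y, ‖F y * H (y⁻¹ * x)‖ ∂muG n ∂muG n := by
        refine integral_mono (integrable_conv hF hH).norm h1.norm.integral_prod_right fun x => ?_
        exact norm_integral_le_integral_norm _
    _ = ∫ y, ∫ x, ‖F y * H (y⁻¹ * x)‖ ∂muG n ∂muG n := integral_integral_swap h2
    _ = _ := by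
        rw [← integral_mul_const]
        refine integral_congr_ae (Filter.Eventually.of_forall fun y => ?_)
        simp only [norm_mul]
        rw [integral_const_mul, integral_mul_left_eq_self (fun x => ‖H x‖) y⁻¹]

theorem conv_kEmb_mul {F H : SU n → ℂ} {k : U n}
    (hF : (fun x => F (kEmb k * x)) =ᵐ[muG n] F) (x : SU n) :
    conv F H (kEmb k * x) = conv F H x := by
  rw [conv, ← integral_mul_left_eq_self (fun y => F y * H (y⁻¹ * (kEmb k * x))) (kEmb k), conv]
  refine integral_congr_ae ?_
  filter_upwards [hF] with y hy
  rw [hy, _root_.mul_inv_rev, mul_assoc, inv_mul_cancel_left]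

theorem conv_mul_kEmb {F H : SU n → ℂ} {k : U n} (hH : ∀ x, H (x * kEmb k) = H x) (x : SU n) :
    conv F H (x * kEmb k) = conv F H x := by
  simp only [conv, ← mul_assoc, hH]

theorem conv_congr_ae {F F' H H' : SU n → ℂ} (hF : F =ᵐ[muG n] F') (hH : H =ᵐ[muG n] H')
    (x : SU n) : conv F H x = conv F' H' x := by
  have h1 : ∀ᵐ y ∂muG n, H (y⁻¹ * x) = H' (y⁻¹ * x) := by
    have h3 : ∀ᵐ y ∂muG n, H (y * x) = H' (y * x) :=
      (measurePreserving_mul_right (muG n) x).quasiMeasurePreserving.ae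
        (p := fun y => H y = H' y) hH
    exact (Measure.measurePreserving_inv (muG n)).quasiMeasurePreserving.ae
      (p := fun y => H (y * x) = H' (y * x)) h3
  refine integral_congr_ae ?_
  filter_upwards [hF, h1] with y h2 h3
  rw [h2, h3]

/-! ### Invariance of the operator convolution -/

theorem opConv_mul_kEmb {B : Op n ν} (hB : IsRadialOp B) (A : Op n ν) (x : SU n) (k : U n) :
    opConv A B (x * kEmb k) = opConv A B x := by
  rw [opConv, translate_mul, hB k, opConv]

/-- Applying `π(k)` to a nuclear representation of a radial `A` gives another one of the same `A`,
and the trace does not depend on the representation. -/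
theorem opConv_kEmb_mul {A : Op n ν} (hA : IsTraceClass A) (hA' : IsRadialOp A) (B : Op n ν)
    (k : U n) (x : SU n) : opConv A B (kEmb k * x) = opConv A B x := by
  obtain ⟨u, v, h⟩ := hA
  have h1 := h.translate (kEmb k)
  rw [hA' k] at h1
  refine (hasSum_opConv h1 B (kEmb k * x)).unique ((hasSum_opConv h B x).congr_fun fun j => ?_)
  rw [translate_mul, inner_translate (kEmb k)]
  have : ∀ g : bergman n ν, piNu n ν (kEmb k)⁻¹ (piNu n ν (kEmb k) g) = g := fun g => by
    have := piNu_apply_piNu_inv (ν := ν) (kEmb k)⁻¹ g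
    rwa [inv_inv] at this
  rw [this, this]

/-! ### The product of the convolution algebra -/

/-- The prescribed components lie in the algebra: the function is integrable and bi-`K`-invariant,
the operator is trace class and radial. Hence the choice in the product is not a default value. -/
theorem algMul_spec (a b : Alg n ν) :
    (onG (algMul a b).1 =ᵐ[muG n] fun x => conv (onG a.1) (onG b.1) x +
      opConv (a.2 : Op n ν) b.2 x) ∧
    ((algMul a b).2 : Op n ν) =
      funOpConv (onG a.1) (b.2 : Op n ν) + funOpConv (onG b.1) (a.2 : Op n ν) := by
  have hA := a.2.2
  have hB := b.2.2
  obtain ⟨f, hf⟩ := exists_onG_eq (F := fun x => conv (onG a.1) (onG b.1) x +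
      opConv (a.2 : Op n ν) b.2 x)
    ((measurable_conv (measurable_onG _) (measurable_onG _)).add
      (continuous_opConv hA.1 _).measurable)
    ((integrable_conv (integrable_onG _) (integrable_onG _)).add (integrable_opConv hA.1 hB.1))
    (fun k x => by rw [conv_kEmb_mul (onG_kEmb_mul _ k), opConv_kEmb_mul hA.1 hA.2])
    (fun x k => by rw [conv_mul_kEmb fun x => onG_mul_kEmb _ x k, opConv_mul_kEmb hB.2])
  have h1 : ∀ (f : L1K n) (A : T1K n ν), funOpConv (onG f) (A : Op n ν) ∈ T1K n ν := fun f A =>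
    ⟨isTraceClass_funOpConv (integrable_onG f) A.2.1,
      isRadialOp_funOpConv (integrable_onG f) (onG_kEmb_mul f) A.2.1⟩
  exact Classical.epsilon_spec (p := fun c : Alg n ν =>
    (onG c.1 =ᵐ[muG n] fun x => conv (onG a.1) (onG b.1) x + opConv (a.2 : Op n ν) b.2 x) ∧
    (c.2 : Op n ν) = funOpConv (onG a.1) (b.2 : Op n ν) + funOpConv (onG b.1) (a.2 : Op n ν))
    ⟨(f, ⟨_, Submodule.add_mem _ (h1 a.1 b.2) (h1 b.1 a.2)⟩), hf, rfl⟩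

end ConvolutionAlgebra

/-! ### Spherical transforms, the Berezin identity and the functionals `Φ_{φ,j}`. -/

section SphericalTransform

variable {n : ℕ} {ν : ℝ} [hn : Fact (1 ≤ n)] [hν : Fact ((n : ℝ) < ν)]

/-! ### The Haar measure of `U(n)` -/

instance : IsProbabilityMeasure (muK n) := ⟨Measure.haarMeasure_self⟩

instance : Measure.IsHaarMeasure (muK n) := by
  unfold muK
  infer_instance

/-- A right translate is again a left invariant probability measure, and on a compact group there is
only one. -/
instance : Measure.IsMulRightInvariant (muK n) := by
  refine ⟨fun k => ?_⟩
  have : IsProbabilityMeasure (Measure.map (fun x => x * k) (muK n)) :=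
    Measure.isProbabilityMeasure_map (measurable_mul_const k).aemeasurable
  have h := Measure.isMulInvariant_eq_smul_of_compactSpace
    (Measure.map (fun x => x * k) (muK n)) (muK n)
  have h1 := congrArg (fun μ : Measure (U n) => μ Set.univ) h
  simp only [measure_univ, Measure.smul_apply, ENNReal.smul_def, smul_eq_mul, mul_one] at h1
  have h2 : Measure.haarScalarFactor (Measure.map (fun x => x * k) (muK n)) (muK n) = 1 := by
    exact_mod_cast h1.symm
  rw [h2, one_smul] at h
  exact h

/-! ### Bounded spherical functions -/

theorem spherical_continuous (φ : SBdd n) : Continuous φ.1 := φ.2.1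

theorem spherical_exists_bound (φ : SBdd n) : ∃ C : ℝ, ∀ x, ‖φ.1 x‖ ≤ C := φ.2.2.2.2

theorem spherical_integral_eq (φ : SBdd n) (x y : SU n) :
    ∫ k : U n, φ.1 (x * kEmb k * y) ∂muK n = φ.1 x * φ.1 y := φ.2.2.2.1 x y

theorem spherical_exists_ne_zero (φ : SBdd n) : ∃ x, φ.1 x ≠ 0 := Function.ne_iff.mp φ.2.2.1

/-- In the functional equation the element of `K` is absorbed by invariance of `μ_K`; then a nonzero
value of `φ` is cancelled. -/
theorem spherical_kEmb_mul (φ : SBdd n) (k : U n) (y : SU n) : φ.1 (kEmb k * y) = φ.1 y := by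
  obtain ⟨x, hx⟩ := spherical_exists_ne_zero φ
  refine mul_left_cancel₀ hx ?_
  rw [← spherical_integral_eq φ, ← spherical_integral_eq φ,
    ← integral_mul_right_eq_self (fun l : U n => φ.1 (x * kEmb l * y)) k]
  simp only [kEmb_mul, mul_assoc]

theorem spherical_mul_kEmb (φ : SBdd n) (x : SU n) (k : U n) : φ.1 (x * kEmb k) = φ.1 x := by
  obtain ⟨y, hy⟩ := spherical_exists_ne_zero φ
  refine mul_right_cancel₀ hy ?_
  rw [← spherical_integral_eq φ, ← spherical_integral_eq φ,
    ← integral_mul_left_eq_self (fun l : U n => φ.1 (x * kEmb l * y)) k]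
  simp only [kEmb_mul, mul_assoc]

theorem spherical_one (φ : SBdd n) : φ.1 1 = 1 := by
  obtain ⟨x, hx⟩ := spherical_exists_ne_zero φ
  refine mul_left_cancel₀ hx ?_
  rw [← spherical_integral_eq φ]
  simp only [mul_one, spherical_mul_kEmb φ]
  simp

theorem spherical_inv (φ : SBdd n) (x : SU n) : φ.1 x⁻¹ = φ.1 x := by
  obtain ⟨k, k', h⟩ := exists_inv_eq x
  rw [h, spherical_mul_kEmb φ, spherical_kEmb_mul φ]

theorem sphTransform_eq (F : SU n → ℂ) (φ : SBdd n) :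
    sphTransform F φ = ∫ x, F x * φ.1 x ∂muG n := by
  simp only [sphTransform, spherical_inv φ]

theorem integrable_mul_spherical {F : SU n → ℂ} (hF : Integrable F (muG n)) (φ : SBdd n) :
    Integrable (fun x => F x * φ.1 x) (muG n) := by
  obtain ⟨C, hC⟩ := spherical_exists_bound φ
  exact hF.mul_bdd (c := C) (spherical_continuous φ).aestronglyMeasurable (Filter.Eventually.of_forall hC)

theorem sphTransform_congr {F H : SU n → ℂ} (h : F =ᵐ[muG n] H) (φ : SBdd n) :
    sphTransform F φ = sphTransform H φ := by
  refine integral_congr_ae ?_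
  filter_upwards [h] with x hx
  rw [hx]

theorem sphTransform_add {F H : SU n → ℂ} (hF : Integrable F (muG n)) (hH : Integrable H (muG n))
    (φ : SBdd n) :
    sphTransform (fun x => F x + H x) φ = sphTransform F φ + sphTransform H φ := by
  simp only [sphTransform_eq, add_mul]
  exact integral_add (integrable_mul_spherical hF φ) (integrable_mul_spherical hH φ)

theorem sphTransform_const_mul (c : ℂ) (F : SU n → ℂ) (φ : SBdd n) :
    sphTransform (fun x => c * F x) φ = c * sphTransform F φ := by
  simp only [sphTransform, mul_assoc]
  exact integral_const_mul _ _

theorem norm_sphTransform_le {F : SU n → ℂ} (hF : Integrable F (muG n)) {φ : SBdd n} {C : ℝ}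
    (hC : ∀ x, ‖φ.1 x‖ ≤ C) : ‖sphTransform F φ‖ ≤ C * ∫ x, ‖F x‖ ∂muG n := by
  rw [sphTransform_eq, ← integral_const_mul]
  refine (norm_integral_le_integral_norm _).trans ?_
  refine integral_mono (integrable_mul_spherical hF φ).norm (hF.norm.const_mul C) fun x => ?_
  simp only [norm_mul]
  rw [mul_comm]
  exact mul_le_mul_of_nonneg_right (hC x) (norm_nonneg _)

/-- Averaging over `K` in an integral against a left `K`-invariant function. -/
theorem integral_mul_average {H : SU n → ℂ} (hH : Integrable H (muG n))
    (hK : ∀ k : U n, (fun x => H (kEmb k * x)) =ᵐ[muG n] H) {ψ : SU n → ℂ} (hψ : Continuous ψ)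
    {M : ℝ} (hM : ∀ x, ‖ψ x‖ ≤ M) :
    ∫ x, H x * ψ x ∂muG n = ∫ x, H x * ∫ k : U n, ψ (kEmb k * x) ∂muK n ∂muG n := by
  have h1 : ∀ k : U n, ∫ x, H x * ψ (kEmb k * x) ∂muG n = ∫ x, H x * ψ x ∂muG n := fun k => by
    rw [← integral_mul_left_eq_self (fun x => H x * ψ x) (kEmb k)]
    refine integral_congr_ae ?_
    filter_upwards [hK k] with x hx
    rw [hx]
  have hcont : Continuous fun p : U n × SU n => ψ (kEmb p.1 * p.2) :=
    hψ.comp ((continuous_kEmb.comp continuous_fst).mul continuous_snd)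
  have hint : Integrable (Function.uncurry fun (k : U n) (x : SU n) => H x * ψ (kEmb k * x))
      ((muK n).prod (muG n)) := by
    have h2 : Integrable (fun p : U n × SU n => H p.2) ((muK n).prod (muG n)) := hH.comp_snd _
    exact h2.mul_bdd (c := M) hcont.aestronglyMeasurable
      (Filter.Eventually.of_forall fun p => hM _)
  have h2 := integral_integral_swap hint
  simp only [h1, integral_const, probReal_univ, one_smul] at h2
  rw [h2]
  refine integral_congr_ae (Filter.Eventually.of_forall fun x => ?_)
  simp only
  rw [integral_const_mul]

/-- Left `K`-invariance of `H` allows an average over `K` between `y` and `x`, and the functional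
equation then splits `φ(y k x)`. -/
theorem integral_mul_spherical_translate {H : SU n → ℂ} (hH : Integrable H (muG n))
    (hK : ∀ k : U n, (fun x => H (kEmb k * x)) =ᵐ[muG n] H) (φ : SBdd n) (y : SU n) :
    ∫ x, H x * φ.1 (y * x) ∂muG n = φ.1 y * sphTransform H φ := by
  obtain ⟨C, hC⟩ := spherical_exists_bound φ
  rw [integral_mul_average hH hK (ψ := fun x => φ.1 (y * x))
    ((spherical_continuous φ).comp (continuous_const.mul continuous_id)) (fun x => hC _), sphTransform_eq,
    ← integral_const_mul]
  refine integral_congr_ae (Filter.Eventually.of_forall fun x => ?_)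
  simp only [← mul_assoc y]
  rw [spherical_integral_eq φ]
  ring

theorem sphTransform_conv {F H : SU n → ℂ} (hF : Integrable F (muG n)) (hH : Integrable H (muG n))
    (hK : ∀ k : U n, (fun x => H (kEmb k * x)) =ᵐ[muG n] H) (φ : SBdd n) :
    sphTransform (conv F H) φ = sphTransform F φ * sphTransform H φ := by
  obtain ⟨C, hC⟩ := spherical_exists_bound φ
  rw [sphTransform_eq, integral_conv_mul hF hH (spherical_continuous φ).measurable hC, sphTransform_eq F,
    ← integral_mul_const]
  refine integral_congr_ae (Filter.Eventually.of_forall fun y => ?_)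
  simp only
  rw [integral_mul_spherical_translate hH hK, mul_assoc]

/-! ### The Berezin transform -/

theorem inner_piNu_piNu (y x : SU n) (B : Op n ν) (f g : bergman n ν) :
    inner ℂ (piNu n ν y (piNu n ν x f)) (B (piNu n ν y (piNu n ν x g))) =
      inner ℂ (piNu n ν (y * x) f) (B (piNu n ν (y * x) g)) := by
  obtain ⟨c, hc, h⟩ := piNu_mul (ν := ν) y x
  have h1 : ∀ f : bergman n ν, piNu n ν y (piNu n ν x f) = c • piNu n ν (y * x) f := fun f => by
    have := congrArg (fun T : Op n ν => T f) h
    simpa only [ContinuousLinearMap.comp_apply, _root_.smul_apply] using this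
  rw [h1, h1, map_smul, bergman_inner_smul_left, bergman_inner_smul_right, ← mul_assoc,
    ← Complex.normSq_eq_conj_mul_self, Complex.normSq_eq_norm_sq, hc]
  simp

theorem inner_orbit_translate (y x : SU n) (B : Op n ν) :
    inner ℂ (piNu n ν y (oneB n ν)) (translate x B (piNu n ν y (oneB n ν))) =
      opConv B (P0 n ν) (x⁻¹ * y) := by
  rw [inner_translate, inner_piNu_piNu, opConv_P0]

theorem isTraceClass_P0 : IsTraceClass (P0 n ν) := P0_mem_T1K.1

theorem isRadialOp_P0 : IsRadialOp (P0 n ν) := P0_mem_T1K.2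

theorem opConv_P0_kEmb_mul {B : Op n ν} (hB : IsTraceClass B) (hB' : IsRadialOp B) (k : U n) :
    (fun x => opConv B (P0 n ν) (kEmb k * x)) =ᵐ[muG n] opConv B (P0 n ν) :=
  Filter.Eventually.of_forall fun x => opConv_kEmb_mul hB hB' _ k x

theorem opConv_P0_inv {B : Op n ν} (hB : IsTraceClass B) (hB' : IsRadialOp B) (x : SU n) :
    opConv B (P0 n ν) x⁻¹ = opConv B (P0 n ν) x := by
  obtain ⟨k, k', h⟩ := exists_inv_eq x
  rw [h, opConv_mul_kEmb isRadialOp_P0, opConv_kEmb_mul hB hB']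

theorem opConv_funOpConv_P0 {F : SU n → ℂ} (hF : Integrable F (muG n)) {B : Op n ν}
    (hB : IsTraceClass B) : opConv (funOpConv F B) (P0 n ν) = conv F (opConv B (P0 n ν)) := by
  funext x
  rw [opConv_P0, funOpConv_spec hF hB, conv]
  simp only [inner_orbit_translate]

theorem opConv_P0_P0 : opConv (P0 n ν) (P0 n ν) = pull (hNu n ν) := by
  funext x
  have hp := one_sub_normSq_pos (act_mem x (zero_mem (n := n)))
  have h1 : inner ℂ (oneB n ν) (piNu n ν x (oneB n ν)) =
      conj (inner ℂ (piNu n ν x (oneB n ν)) (oneB n ν)) := (bergman_inner_conj_symm _ _).symm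
  rw [opConv_P0, P0_apply, bergman_inner_smul_right, h1,
    inner_piNu_oneB, rep_oneB (act_mem x zero_mem), mul_one, Complex.conj_ofReal,
    ← Complex.ofReal_mul, ← Real.rpow_add hp, add_halves]
  rfl

theorem integrable_hNu : Integrable (pull (hNu n ν)) (muG n) := by
  rw [← opConv_P0_P0]
  exact integrable_opConv isTraceClass_P0 isTraceClass_P0

/-! ### The operators `∫ φ(x) π(x) B π(x)* dx` -/

theorem exists_sphOp {B : Op n ν} (hB : IsTraceClass B) (φ : SBdd n) : ∃ X : Op n ν,
    ∀ f g : bergman n ν, inner ℂ f (X g) = ∫ x, φ.1 x * inner ℂ f (translate x B g) ∂muG n := by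
  obtain ⟨C, hC⟩ := spherical_exists_bound φ
  exact exists_weak_integral hB (spherical_continuous φ) hC

theorem sphTransform_opConv {A B : Op n ν} (hA : IsTraceClass A) (hB : IsTraceClass B)
    {φ : SBdd n} {X : Op n ν} (hX : ∀ f g : bergman n ν, inner ℂ f (X g) =
      ∫ x, φ.1 x * inner ℂ f (translate x B g) ∂muG n) :
    sphTransform (opConv A B) φ = trace (A ∘L X) := by
  obtain ⟨C, hC⟩ := spherical_exists_bound φ
  rw [sphTransform_eq, ← integral_opConv_mul hA hB (spherical_continuous φ) hC hX]
  simp only [mul_comm]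

/-- The Berezin transform of the weak integral is `∫ φ(x) (B * P₀)(x⁻¹ y) dx`. After the
substitution `x ↦ y x` and inversion symmetry of `B * P₀`, the functional equation applies and
leaves a multiple of `φ`. -/
theorem inner_orbit_sphOp {B : Op n ν} (hB : IsTraceClass B) (hB' : IsRadialOp B) {φ : SBdd n}
    {X : Op n ν} (hX : ∀ f g : bergman n ν, inner ℂ f (X g) =
      ∫ x, φ.1 x * inner ℂ f (translate x B g) ∂muG n) (y : SU n) :
    inner ℂ (piNu n ν y (oneB n ν)) (X (piNu n ν y (oneB n ν))) =
      φ.1 y * sphTransform (opConv B (P0 n ν)) φ := by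
  rw [hX]
  simp only [inner_orbit_translate]
  rw [← integral_mul_left_eq_self (fun x => φ.1 x * opConv B (P0 n ν) (x⁻¹ * y)) y,
    ← integral_mul_spherical_translate (integrable_opConv hB isTraceClass_P0)
      (opConv_P0_kEmb_mul hB hB')]
  refine integral_congr_ae (Filter.Eventually.of_forall fun x => ?_)
  simp only
  rw [_root_.mul_inv_rev, inv_mul_cancel_right, opConv_P0_inv hB hB', mul_comm]

theorem trace_smul (c : ℂ) (A : Op n ν) : trace (c • A) = c * trace A := by
  rw [trace_eq_tsum, trace_eq_tsum, ← tsum_mul_left]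
  refine tsum_congr fun e => ?_
  rw [_root_.smul_apply, inner_smul_right]

/-- Both sides have the same Berezin transform, which is injective. The relation is stated without
division, so that it does not presuppose `ĥ_ν(φ) ≠ 0`. -/
theorem smul_sphOp_eq {B : Op n ν} (hB : IsTraceClass B) (hB' : IsRadialOp B) {φ : SBdd n}
    {X Y : Op n ν} (hX : ∀ f g : bergman n ν, inner ℂ f (X g) =
      ∫ x, φ.1 x * inner ℂ f (translate x B g) ∂muG n)
    (hY : ∀ f g : bergman n ν, inner ℂ f (Y g) =
      ∫ x, φ.1 x * inner ℂ f (translate x (P0 n ν) g) ∂muG n) :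
    hHat n ν φ • X = sphTransform (opConv B (P0 n ν)) φ • Y := by
  rw [← sub_eq_zero]
  refine eq_zero_of_inner_orbit fun y => ?_
  rw [_root_.sub_apply, _root_.smul_apply, _root_.smul_apply,
    inner_sub_right, bergman_inner_smul_right, bergman_inner_smul_right,
    inner_orbit_sphOp hB hB' hX, inner_orbit_sphOp isTraceClass_P0 isRadialOp_P0 hY,
    opConv_P0_P0, hHat]
  ring

/-- `(A * B)^ ĥ = (A * P₀)^ (B * P₀)^`. -/
theorem sphTransform_opConv_mul_hHat {A B : Op n ν} (hA : IsTraceClass A) (hB : IsTraceClass B)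
    (hB' : IsRadialOp B) (φ : SBdd n) :
    sphTransform (opConv A B) φ * hHat n ν φ =
      sphTransform (opConv A (P0 n ν)) φ * sphTransform (opConv B (P0 n ν)) φ := by
  obtain ⟨X, hX⟩ := exists_sphOp hB φ
  obtain ⟨Y, hY⟩ := exists_sphOp (isTraceClass_P0 (n := n) (ν := ν)) φ
  rw [sphTransform_opConv hA hB hX, sphTransform_opConv hA isTraceClass_P0 hY, mul_comm,
    ← trace_smul, ← ContinuousLinearMap.comp_smul, smul_sphOp_eq hB hB' hX hY,
    ContinuousLinearMap.comp_smul, trace_smul, mul_comm]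

/-! ### Toeplitz operators with spherical symbols -/

theorem onBall_act (φ : SBdd n) (x : SU n) : onBall φ.1 (act x 0) = φ.1 x := by
  have h := Classical.epsilon_spec (p := fun y : SU n => act y 0 = act x 0) ⟨x, rfl⟩
  obtain ⟨k, hk⟩ := exists_kEmb_of_act_eq h
  rw [onBall]
  conv_rhs => rw [hk, spherical_mul_kEmb φ]

theorem onBall_eq_sec (φ : SBdd n) {z : E n} (hz : z ∈ ball (0 : E n) 1) :
    onBall φ.1 z = φ.1 (sec z) := by
  conv_lhs => rw [← act_sec hz, onBall_act]

theorem continuousOn_onBall (φ : SBdd n) : ContinuousOn (onBall φ.1) (ball 0 1) :=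
  ((spherical_continuous φ).comp_continuousOn continuousOn_sec).congr fun _ hz => onBall_eq_sec φ hz

theorem onBall_eq_of_norm_eq (φ : SBdd n) {z w : E n} (hz : z ∈ ball (0 : E n) 1)
    (h : ‖z‖ = ‖w‖) : onBall φ.1 w = onBall φ.1 z := by
  obtain ⟨k, rfl⟩ := exists_kEmb_act_eq h
  rw [← act_sec hz, ← act_mul _ _ zero_mem, onBall_act, onBall_act, spherical_kEmb_mul φ]

/-- The translate of `P₀` is the projection onto a normalized kernel, so the integral over `G`
descends to the ball and becomes the quadratic form of the Toeplitz operator divided by `c_ν`. -/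
theorem inner_sphOp_P0 {φ : SBdd n} {Y : Op n ν} (hY : ∀ f g : bergman n ν, inner ℂ f (Y g) =
      ∫ x, φ.1 x * inner ℂ f (translate x (P0 n ν) g) ∂muG n) (f g : bergman n ν) :
    inner ℂ f (Y g) =
      (cNu n ν : ℂ)⁻¹ * ∫ z, onBall φ.1 z * (conj (rep f z) * rep g z) ∂muNu n ν := by
  obtain ⟨C, hC⟩ := spherical_exists_bound φ
  have hint : Integrable (fun z => onBall φ.1 z * (conj (rep f z) * rep g z)) (muNu n ν) := by
    refine (integrable_conj_rep_mul f g).bdd_mul (c := C)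
      (aestronglyMeasurable_of_continuousOn (continuousOn_onBall φ)) ?_
    filter_upwards [ae_mem_ball_mu] with z hz
    rw [onBall_eq_sec φ hz]
    exact hC _
  rw [hY, ← integral_orbit_weight (F := fun z => onBall φ.1 z * (conj (rep f z) * rep g z)) hint]
  refine integral_congr_ae (Filter.Eventually.of_forall fun x => ?_)
  simp only
  rw [translate_P0_apply, bergman_inner_smul_right, mul_comm (inner ℂ _ g), inner_piNu_oneB_mul,
    onBall_act]
  ring

theorem toeplitz_eq {φ : SBdd n} {Y : Op n ν} (hY : ∀ f g : bergman n ν, inner ℂ f (Y g) =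
      ∫ x, φ.1 x * inner ℂ f (translate x (P0 n ν) g) ∂muG n) :
    toeplitz n ν (onBall φ.1) = (cNu n ν : ℂ) • Y := by
  have hc0 : (cNu n ν : ℂ) ≠ 0 := by exact_mod_cast (cNu_pos hν.out).ne'
  refine opOf_eq fun g => ?_
  filter_upwards [coe_ae_eq_rep (((cNu n ν : ℂ) • Y) g), ae_mem_ball_mu] with z hz hzb
  rw [hz, _root_.smul_apply, rep_smul _ _ hzb, ← inner_kerVec hzb, inner_sphOp_P0 hY,
    mul_inv_cancel_left₀ hc0]
  refine integral_congr_ae ?_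
  filter_upwards [coe_ae_eq_rep g, ae_mem_ball_mu] with w hw hwb
  rw [hw, rep_kerVec hzb hwb, conj_kerNu hwb hzb]
  ring

theorem TOp_eq {s : SBdd n → ℂ} {φ : SBdd n} {Y : Op n ν}
    (hY : ∀ f g : bergman n ν, inner ℂ f (Y g) =
      ∫ x, φ.1 x * inner ℂ f (translate x (P0 n ν) g) ∂muG n) :
    TOp n ν s φ = (s φ)⁻¹ • Y := by
  have hc0 : (cNu n ν : ℂ) ≠ 0 := by exact_mod_cast (cNu_pos hν.out).ne'
  rw [TOp, toeplitz_eq hY, smul_smul, _root_.mul_inv_rev, inv_mul_cancel_right₀ hc0]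

theorem trace_comp_TOp (s : SBdd n → ℂ) (φ : SBdd n) {A : Op n ν} (hA : IsTraceClass A) :
    trace (A ∘L TOp n ν s φ) = sphTransform (opConv A (P0 n ν)) φ / s φ := by
  obtain ⟨Y, hY⟩ := exists_sphOp (isTraceClass_P0 (n := n) (ν := ν)) φ
  rw [TOp_eq hY, ContinuousLinearMap.comp_smul, trace_smul, sphTransform_opConv hA
    isTraceClass_P0 hY, div_eq_inv_mul]

theorem Phi_eq_trace (s : SBdd n → ℂ) (φ : SBdd n) (j : Fin 2) (f : L1K n) (A : T1K n ν) :
    Phi s φ j (f, A) = sphTransform (onG f) φ +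
      (-1) ^ (j : ℕ) * trace ((A : Op n ν) ∘L TOp n ν s φ) := by
  rw [trace_comp_TOp s φ A.2.1, Phi]

/-! ### The functionals are multiplicative -/

theorem opConv_P0_add (A B : Op n ν) :
    opConv (A + B) (P0 n ν) = fun x => opConv A (P0 n ν) x + opConv B (P0 n ν) x := by
  funext x
  rw [opConv_P0, opConv_P0, opConv_P0, _root_.add_apply, inner_add_right]

theorem opConv_P0_smul (c : ℂ) (A : Op n ν) :
    opConv (c • A) (P0 n ν) = fun x => c * opConv A (P0 n ν) x := by
  funext x
  rw [opConv_P0, opConv_P0, _root_.smul_apply, bergman_inner_smul_right]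

theorem exists_onG_hNu : ∃ f : L1K n, onG f =ᵐ[muG n] pull (hNu n ν) := by
  refine exists_onG_eq ?_ integrable_hNu (fun k x => ?_) fun x k => ?_
  · rw [← opConv_P0_P0]
    exact (continuous_opConv isTraceClass_P0 _).measurable
  · rw [← opConv_P0_P0, opConv_kEmb_mul isTraceClass_P0 isRadialOp_P0]
  · rw [← opConv_P0_P0, opConv_mul_kEmb isRadialOp_P0]

theorem Phi_add (s : SBdd n → ℂ) (φ : SBdd n) (j : Fin 2) (a b : Alg n ν) :
    Phi s φ j (a + b) = Phi s φ j a + Phi s φ j b := by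
  have h1 : sphTransform (onG (a + b).1) φ =
      sphTransform (onG a.1) φ + sphTransform (onG b.1) φ :=
    (sphTransform_congr (onG_add a.1 b.1) φ).trans
      (sphTransform_add (integrable_onG a.1) (integrable_onG b.1) φ)
  have h2 : sphTransform (opConv ((a + b).2 : Op n ν) (P0 n ν)) φ =
      sphTransform (opConv (a.2 : Op n ν) (P0 n ν)) φ +
        sphTransform (opConv (b.2 : Op n ν) (P0 n ν)) φ :=
    (congrArg (fun F => sphTransform F φ) (opConv_P0_add (a.2 : Op n ν) b.2)).trans
      (sphTransform_add (integrable_opConv a.2.2.1 isTraceClass_P0)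
        (integrable_opConv b.2.2.1 isTraceClass_P0) φ)
  simp only [Phi]
  rw [h1, h2]
  ring

theorem Phi_smul (s : SBdd n → ℂ) (φ : SBdd n) (j : Fin 2) (c : ℂ) (a : Alg n ν) :
    Phi s φ j (c • a) = c * Phi s φ j a := by
  have h1 : sphTransform (onG (c • a).1) φ = c * sphTransform (onG a.1) φ :=
    (sphTransform_congr (onG_smul c a.1) φ).trans (sphTransform_const_mul c (onG a.1) φ)
  have h2 : sphTransform (opConv ((c • a).2 : Op n ν) (P0 n ν)) φ =
      c * sphTransform (opConv (a.2 : Op n ν) (P0 n ν)) φ :=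
    (congrArg (fun F => sphTransform F φ) (opConv_P0_smul c (a.2 : Op n ν))).trans
      (sphTransform_const_mul c _ φ)
  simp only [Phi]
  rw [h1, h2]
  ring

theorem sphTransform_conv_opConv_P0 (f : L1K n) (A : T1K n ν) (φ : SBdd n) :
    sphTransform (conv (onG f) (opConv (A : Op n ν) (P0 n ν))) φ =
      sphTransform (onG f) φ * sphTransform (opConv (A : Op n ν) (P0 n ν)) φ :=
  sphTransform_conv (integrable_onG f) (integrable_opConv A.2.1 isTraceClass_P0)
    (opConv_P0_kEmb_mul A.2.1 A.2.2) φ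

theorem sphTransform_algMul_fst (a b : Alg n ν) (φ : SBdd n) :
    sphTransform (onG (algMul a b).1) φ = sphTransform (onG a.1) φ * sphTransform (onG b.1) φ +
      sphTransform (opConv (a.2 : Op n ν) b.2) φ :=
  (sphTransform_congr (algMul_spec a b).1 φ).trans <|
    (sphTransform_add (integrable_conv (integrable_onG a.1) (integrable_onG b.1))
      (integrable_opConv a.2.2.1 b.2.2.1) φ).trans <|
    congrArg (· + sphTransform (opConv (a.2 : Op n ν) b.2) φ)
      (sphTransform_conv (integrable_onG a.1) (integrable_onG b.1) (onG_kEmb_mul b.1) φ)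

theorem sphTransform_algMul_snd (a b : Alg n ν) (φ : SBdd n) :
    sphTransform (opConv ((algMul a b).2 : Op n ν) (P0 n ν)) φ =
      sphTransform (onG a.1) φ * sphTransform (opConv (b.2 : Op n ν) (P0 n ν)) φ +
      sphTransform (onG b.1) φ * sphTransform (opConv (a.2 : Op n ν) (P0 n ν)) φ := by
  have h1 : opConv ((algMul a b).2 : Op n ν) (P0 n ν) = fun x =>
      conv (onG a.1) (opConv (b.2 : Op n ν) (P0 n ν)) x +
        conv (onG b.1) (opConv (a.2 : Op n ν) (P0 n ν)) x := by
    rw [← opConv_funOpConv_P0 (integrable_onG a.1) b.2.2.1,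
      ← opConv_funOpConv_P0 (integrable_onG b.1) a.2.2.1, (algMul_spec a b).2]
    exact opConv_P0_add _ _
  rw [h1, ← sphTransform_conv_opConv_P0, ← sphTransform_conv_opConv_P0]
  exact sphTransform_add
    (integrable_conv (integrable_onG a.1) (integrable_opConv b.2.2.1 isTraceClass_P0))
    (integrable_conv (integrable_onG b.1) (integrable_opConv a.2.2.1 isTraceClass_P0)) φ

/-- The mixed terms come from the convolution theorem. The term from `A * B` equals the product of
the two operator terms, because its transform is `(A * P₀)^ (B * P₀)^ / s²` and the sign squares to
one. -/
theorem Phi_mul {s : SBdd n → ℂ} (hs : ∀ φ, s φ ^ 2 = hHat n ν φ)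
    (φ : SBdd n) (h0 : s φ ≠ 0) (j : Fin 2) (a b : Alg n ν) :
    Phi s φ j (algMul a b) = Phi s φ j a * Phi s φ j b := by
  have hε : ((-1 : ℂ) ^ (j : ℕ)) * (-1) ^ (j : ℕ) = 1 := by
    rw [← mul_pow]
    simp
  have h3 := sphTransform_opConv_mul_hHat a.2.2.1 b.2.2.1 b.2.2.2 φ
  rw [← hs] at h3
  have h4 := eq_div_of_mul_eq (pow_ne_zero 2 h0) h3
  have h5 := sphTransform_algMul_fst a b φ
  have h6 := sphTransform_algMul_snd a b φ
  simp only [Phi]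
  rw [h5, h6, h4]
  generalize sphTransform (onG a.1) φ = p
  generalize sphTransform (onG b.1) φ = q
  generalize sphTransform (opConv (a.2 : Op n ν) (P0 n ν)) φ = t
  generalize sphTransform (opConv (b.2 : Op n ν) (P0 n ν)) φ = u
  generalize s φ = σ at h0
  generalize (-1 : ℂ) ^ (j : ℕ) = ε at hε
  field_simp
  linear_combination -(t * u) * hε

theorem isMultiplicativeFunctional_Phi {s : SBdd n → ℂ} (hs : ∀ φ, s φ ^ 2 = hHat n ν φ)
    (φ : SBdd n) (h0 : s φ ≠ 0) (j : Fin 2) :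
    IsMultiplicativeFunctional (Phi s φ j : Alg n ν → ℂ) := by
  refine ⟨Phi_add s φ j, Phi_smul s φ j, Phi_mul hs φ h0 j, ?_⟩
  -- The pair `(h_ν, 0)` has value `ĥ_ν(φ) = s(φ)²`.
  · obtain ⟨f, hf⟩ := exists_onG_hNu (n := n) (ν := ν)
    refine ⟨(f, 0), ?_⟩
    have h1 : opConv ((0 : T1K n ν) : Op n ν) (P0 n ν) = fun x => 0 * opConv 0 (P0 n ν) x :=
      (congrArg (fun B : Op n ν => opConv B (P0 n ν)) (zero_smul ℂ (0 : Op n ν)).symm).trans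
        (opConv_P0_smul 0 0)
    rw [Phi, sphTransform_congr hf, h1, sphTransform_const_mul, zero_mul, zero_div, mul_zero,
      add_zero]
    change hHat n ν φ ≠ 0
    rw [← hs]
    exact pow_ne_zero 2 h0

/-- The function part is bounded by `sup |φ|`; in the trace form the operator part is bounded by the
operator norm of `T^{φ,ν}`. -/
theorem exists_bound_Phi (s : SBdd n → ℂ) (φ : SBdd n) (j : Fin 2) :
    ∃ C : ℝ, ∀ a : Alg n ν, ‖Phi s φ j a‖ ≤ C * algNorm a := by
  obtain ⟨C, hC⟩ := spherical_exists_bound φ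
  have htn : ∀ A : Op n ν, 0 ≤ traceNorm A := fun A => Real.sInf_nonneg (by
    rintro t ⟨u, v, -, rfl⟩
    exact tsum_nonneg fun k => by positivity)
  refine ⟨max C ‖TOp n ν s φ‖, fun a => ?_⟩
  rw [show a = (a.1, a.2) from rfl, Phi_eq_trace, algNorm, mul_add]
  refine (norm_add_le _ _).trans (add_le_add ?_ ?_)
  · refine (norm_sphTransform_le (integrable_onG _) hC).trans ?_
    rw [integral_norm_onG]
    exact mul_le_mul_of_nonneg_right (le_max_left _ _) (norm_nonneg _)
  · rw [norm_mul, norm_pow, norm_neg, norm_one, one_pow, one_mul]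
    exact (norm_trace_comp_le a.2.2.1 _).trans
      (mul_le_mul_of_nonneg_right (le_max_right _ _) (htn _))

end SphericalTransform

/-! ### Eigenvalues on homogeneous polynomials and the nonvanishing of `ĥ_ν`. -/

section HomogeneousPolynomials

variable {n : ℕ} {ν : ℝ} [hn : Fact (1 ≤ n)] [hν : Fact ((n : ℝ) < ν)]

/-! ### Toeplitz operators on homogeneous polynomials -/

theorem exists_hasSum_one_sub_cpow (ν : ℝ) : ∃ a : ℕ → ℂ,
    (∀ t : ℂ, ‖t‖ < 1 → HasSum (fun j => a j * t ^ j) ((1 - t) ^ (-(ν : ℂ)))) ∧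
    ∀ r : ℝ, 0 ≤ r → r < 1 → Summable fun j => ‖a j‖ * r ^ j := by
  have h1 : ∀ t : ℂ, ‖t‖ < 1 → HasSum (fun j : ℕ => Ring.choose ((ν : ℂ) + j - 1) j * t ^ j)
      ((1 - t) ^ (-(ν : ℂ))) := fun t ht => by
    have h := (Complex.one_div_one_sub_cpow_hasFPowerSeriesOnBall_zero (ν : ℂ)).hasSum (y := t)
      (by
        rw [Metric.mem_eball, edist_zero_right, ← ofReal_norm]
        exact ENNReal.ofReal_lt_one.mpr ht)
    simp only [zero_add, FormalMultilinearSeries.ofScalars_apply_eq, smul_eq_mul] at h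
    rwa [one_div, ← Complex.cpow_neg] at h
  refine ⟨_, h1, fun r hr hr1 => ?_⟩
  have h := (h1 (r : ℂ) (by rwa [Complex.norm_real, Real.norm_of_nonneg hr])).summable.norm
  simpa only [norm_mul, norm_pow, Complex.norm_real, Real.norm_of_nonneg hr] using h

/-- The single value `c = exp i` serves every pair `j ≠ m`: equality would make `m - j` an integer
multiple of `2π`, against irrationality of `π`. -/
theorem exists_norm_one_pow_ne_one {j m : ℕ} (h : j ≠ m) :
    ∃ c : ℂ, ‖c‖ = 1 ∧ conj c ^ j * c ^ m ≠ 1 := by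
  by_contra! hc
  have h1 := hc (Complex.exp (Complex.I)) (by
    have := Complex.norm_exp_ofReal_mul_I 1
    simpa using this)
  rw [← Complex.exp_conj, Complex.conj_I, ← Complex.exp_nat_mul, ← Complex.exp_nat_mul,
    ← Complex.exp_add, Complex.exp_eq_one_iff] at h1
  obtain ⟨k, hk⟩ := h1
  have h2 := congrArg Complex.im hk
  simp at h2
  rcases eq_or_ne k 0 with rfl | hk0
  · apply h
    simp at h2
    exact_mod_cast (show (j : ℝ) = m by linarith)
  · have h3 : Real.pi = (((m : ℤ) - j : ℤ) : ℝ) / ((2 * k : ℤ) : ℝ) := by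
      push_cast
      field_simp
      linarith
    exact (irrational_pi.ne_rat ((((m : ℤ) - j : ℤ) : ℚ) / ((2 * k : ℤ) : ℚ))) (by
      rw [h3]; push_cast; rfl)

/-- Rotation by `c` preserves the measure and multiplies the integrand by `conj c ^ j * c ^ m ≠ 1`.
-/
theorem integral_radial_mul_eq_zero {j m : ℕ} (hjm : j ≠ m) {ψ : ℝ → ℂ} {g : E n → ℂ}
    (hg : ∀ (c : ℂ) y, g (c • y) = c ^ m * g y) (z : E n) :
    ∫ y, ψ (‖y‖ ^ 2) * g y * (inner ℂ y z) ^ j ∂muNu n ν = 0 := by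
  obtain ⟨c, hc, hc1⟩ := exists_norm_one_pow_ne_one hjm
  have hemb : MeasurableEmbedding (fun y : E n => c • y) :=
    (Homeomorph.smulOfNeZero c (by rintro rfl; simp at hc)).measurableEmbedding
  have h := (measurePreserving_rotation (n := n) (ν := ν) hc).integral_comp hemb
    (fun y => ψ (‖y‖ ^ 2) * g y * (inner ℂ y z) ^ j)
  have h1 : ∀ y : E n, ψ (‖c • y‖ ^ 2) * g (c • y) * (inner ℂ (c • y) z) ^ j =
      (conj c ^ j * c ^ m) * (ψ (‖y‖ ^ 2) * g y * (inner ℂ y z) ^ j) := fun y => by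
    rw [norm_smul, hc, one_mul, hg, inner_smul_left, mul_pow]
    ring
  simp only [h1] at h
  rw [integral_const_mul] at h
  have h2 : (conj c ^ j * c ^ m - 1) * ∫ y, ψ (‖y‖ ^ 2) * g y * (inner ℂ y z) ^ j ∂muNu n ν = 0 := by
    linear_combination h
  exact (mul_eq_zero.mp h2).resolve_left (sub_ne_zero.mpr hc1)

theorem norm_inner_le_of_mem {y z : E n} (hy : y ∈ ball (0 : E n) 1) : ‖(inner ℂ y z : ℂ)‖ ≤ ‖z‖ :=
  (norm_inner_le_norm y z).trans
    (mul_le_of_le_one_left (norm_nonneg _) (norm_lt_one_of_mem hy).le)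

/-- Expanding the kernel in powers of `⟨z, y⟩`, only the term of degree `m` survives the rotations.
The constant `D` depends on `g` and `z` but not on `ψ`. -/
theorem integral_radial_mul_kerNu {m : ℕ} {g : E n → ℂ}
    (hg : ∀ (c : ℂ) y, g (c • y) = c ^ m * g y) {z : E n} (hz : z ∈ ball (0 : E n) 1) :
    ∃ D : ℂ, ∀ ψ : ℝ → ℂ, Integrable (fun y => ψ (‖y‖ ^ 2) * g y) (muNu n ν) →
      ∫ y, ψ (‖y‖ ^ 2) * g y * kerNu n ν z y ∂muNu n ν = D * radialMoment n ν m ψ := by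
  obtain ⟨a, ha, ha'⟩ := exists_hasSum_one_sub_cpow ν
  have hz1 := norm_lt_one_of_mem hz
  have hH : ∀ r : ℝ, 0 < r → ∀ ζ : E n, (fun y => g y * (inner ℂ y z) ^ m) (r • ζ) =
      ((r ^ (2 * m) : ℝ) : ℂ) * (fun y => g y * (inner ℂ y z) ^ m) ζ := fun r _ ζ => by
    have h : r • ζ = (r : ℂ) • ζ := rfl
    simp only [h, hg, inner_smul_left, Complex.conj_ofReal, mul_pow, pow_mul, pow_two]
    push_cast
    ring
  obtain ⟨D, hD⟩ : ∃ D : ℂ, ∀ ψ : ℝ → ℂ, ∫ y, ψ (‖y‖ ^ 2) * (g y * (inner ℂ y z) ^ m) ∂muNu n ν =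
      D * radialMoment n ν m ψ :=
    ⟨_, exists_integral_radial_mul_homogeneous hn.out hν.out m hH⟩
  refine ⟨a m * D, fun ψ hψ => ?_⟩
  rw [mul_assoc (a m), ← hD]
  have hbound : ∀ j, ∀ᵐ y ∂muNu n ν, ‖(inner ℂ y z : ℂ) ^ j‖ ≤ ‖z‖ ^ j := fun j => by
    filter_upwards [ae_mem_ball_mu] with y hy
    rw [norm_pow]
    exact pow_le_pow_left₀ (norm_nonneg _) (norm_inner_le_of_mem hy) j
  have hint : ∀ j, Integrable (fun y => ψ (‖y‖ ^ 2) * g y * (inner ℂ y z) ^ j) (muNu n ν) :=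
    fun j => hψ.mul_bdd (c := ‖z‖ ^ j)
      ((continuous_id.inner continuous_const).pow j).aestronglyMeasurable (hbound j)
  have hint' : ∀ j, Integrable (fun y => a j * (ψ (‖y‖ ^ 2) * g y * (inner ℂ y z) ^ j))
      (muNu n ν) := fun j => (hint j).const_mul _
  have hsum : Summable fun j =>
      ∫ y, ‖a j * (ψ (‖y‖ ^ 2) * g y * (inner ℂ y z) ^ j)‖ ∂muNu n ν := by
    refine Summable.of_nonneg_of_le (fun j => integral_nonneg fun _ => norm_nonneg _)
      (fun j => ?_) ((ha' ‖z‖ (norm_nonneg _) hz1).mul_right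
        (∫ y, ‖ψ (‖y‖ ^ 2) * g y‖ ∂muNu n ν))
    rw [← integral_const_mul]
    refine integral_mono_ae (hint' j).norm (hψ.norm.const_mul _) ?_
    filter_upwards [hbound j] with y hy
    rw [norm_mul, norm_mul _ (_ ^ _), mul_assoc, mul_comm ‖ψ _ * g y‖]
    exact mul_le_mul_of_nonneg_left (mul_le_mul_of_nonneg_right hy (norm_nonneg _))
      (norm_nonneg _)
  have h1 := hasSum_integral_of_summable_integral_norm hint' hsum
  have h2 : ∀ j ≠ m, ∫ y, a j * (ψ (‖y‖ ^ 2) * g y * (inner ℂ y z) ^ j) ∂muNu n ν = 0 :=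
    fun j hj => by rw [integral_const_mul, integral_radial_mul_eq_zero hj hg, mul_zero]
  have h3 := h1.unique (hasSum_single m h2)
  have h4 : ∫ y, ψ (‖y‖ ^ 2) * g y * kerNu n ν z y ∂muNu n ν =
      ∫ y, ∑' j, a j * (ψ (‖y‖ ^ 2) * g y * (inner ℂ y z) ^ j) ∂muNu n ν := by
    refine integral_congr_ae ?_
    filter_upwards [ae_mem_ball_mu] with y hy
    have h5 := (ha _ ((norm_inner_le_of_mem (z := z) hy).trans_lt hz1)).mul_left
      (ψ (‖y‖ ^ 2) * g y)
    rw [kerNu, ← h5.tsum_eq]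
    exact tsum_congr fun j => by ring
  rw [h4, h3, integral_const_mul]
  congr 1
  refine integral_congr_ae (Filter.Eventually.of_forall fun y => ?_)
  simp only
  ring

theorem radialMoment_one_ne_zero (m : ℕ) : radialMoment n ν m (fun _ => 1) ≠ 0 := by
  rw [radialMoment_one hn.out hν.out]
  have h1 := Real.Gamma_pos_of_pos (show 0 < ν - n by linarith [hν.out])
  have h0 : (0 : ℝ) ≤ n := Nat.cast_nonneg n
  have h2 := Real.Gamma_pos_of_pos (show 0 < (m : ℝ) + ν by
    have := hν.out
    have h3 : (0 : ℝ) ≤ m := Nat.cast_nonneg m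
    linarith)
  have h3 : (0 : ℝ) < (n + m - 1).factorial := by exact_mod_cast Nat.factorial_pos _
  exact_mod_cast (by positivity : (0 : ℝ) < (n + m - 1).factorial * Real.Gamma (ν - n) /
    Real.Gamma (m + ν)).ne'

/-- For `ψ = 1` the integral is the reproducing formula, which determines the constant `D`; what
remains is the quotient of moments. -/
theorem integral_radial_mul_rep_mul_kerNu {m : ℕ} {p : E n → ℂ} {g : bergman n ν}
    (hp : ∀ (c : ℂ) y, p (c • y) = c ^ m * p y) (hg : Set.EqOn (rep g) p (ball 0 1))
    {ψ : ℝ → ℂ} (hψ : AEStronglyMeasurable (fun y : E n => ψ (‖y‖ ^ 2)) (muNu n ν)) {M : ℝ}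
    (hM : ∀ᵐ y ∂muNu n ν, ‖ψ (‖y‖ ^ 2)‖ ≤ M) {z : E n} (hz : z ∈ ball (0 : E n) 1) :
    ∫ y, ψ (‖y‖ ^ 2) * rep g y * kerNu n ν z y ∂muNu n ν =
      radialMoment n ν m ψ / radialMoment n ν m (fun _ => 1) * rep g z := by
  obtain ⟨D, hD⟩ := integral_radial_mul_kerNu (ν := ν) hp hz
  have hpi : Integrable p (muNu n ν) := (integrable_rep g).congr (by
    filter_upwards [ae_mem_ball_mu] with y hy using hg hy)
  have h1 := hD ψ (hpi.bdd_mul (c := M) hψ hM)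
  have h2 := hD (fun _ => 1) (by simpa using hpi)
  have h3 : ∀ ψ : ℝ → ℂ, ∫ y, ψ (‖y‖ ^ 2) * rep g y * kerNu n ν z y ∂muNu n ν =
      ∫ y, ψ (‖y‖ ^ 2) * p y * kerNu n ν z y ∂muNu n ν := fun ψ => by
    refine integral_congr_ae ?_
    filter_upwards [ae_mem_ball_mu] with y hy
    rw [hg hy]
  have h4 : rep g z = D * radialMoment n ν m (fun _ => 1) := by
    rw [← h2, ← h3 fun _ => 1, ← inner_kerVec hz, inner_eq_integral]
    refine integral_congr_ae ?_
    filter_upwards [ae_mem_ball_mu] with y hy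
    rw [rep_kerVec hz hy, conj_kerNu hy hz]
    ring
  rw [h3, h1, h4]
  field_simp [radialMoment_one_ne_zero (n := n) (ν := ν) m]

theorem eval_smul_of_isHomogeneous {p : MvPolynomial (Fin n) ℂ} {m : ℕ} (hp : p.IsHomogeneous m)
    (c : ℂ) (y : E n) : MvPolynomial.eval (fun i => (c • y) i) p =
      c ^ m * MvPolynomial.eval (fun i => y i) p := by
  rw [MvPolynomial.eval_eq, MvPolynomial.eval_eq, Finset.mul_sum]
  refine Finset.sum_congr rfl fun d hd => ?_
  have h : ∑ i, d i = m := by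
    have h1 := hp (MvPolynomial.mem_support_iff.mp hd)
    rw [← h1, Finsupp.weight_apply, Finsupp.sum_fintype _ _ (by simp)]
    simp
  simp only [PiLp.smul_apply, smul_eq_mul, mul_pow]
  rw [Finset.prod_mul_distrib]
  have h2 : ∏ i ∈ d.support, c ^ d i = c ^ m := by
    rw [Finset.prod_pow_eq_pow_sum, ← h]
    congr 1
    exact Finset.sum_subset (Finset.subset_univ _) fun i _ hi => by simpa using hi
  rw [h2]
  ring

theorem differentiable_eval (p : MvPolynomial (Fin n) ℂ) :
    Differentiable ℂ fun z : E n => MvPolynomial.eval (fun i => z i) p := by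
  simp only [MvPolynomial.eval_eq]
  fun_prop

variable (ν) in
/-- The operator `∫ φ(x) π(x) P₀ π(x)* dx`, up to a factor the Toeplitz operator with symbol `φ`. -/
def sphOp (φ : SBdd n) : Op n ν := (exists_sphOp (isTraceClass_P0 (n := n) (ν := ν)) φ).choose

theorem inner_sphOp (φ : SBdd n) (f g : bergman n ν) : inner ℂ f (sphOp ν φ g) =
    ∫ x, φ.1 x * inner ℂ f (translate x (P0 n ν) g) ∂muG n :=
  (exists_sphOp isTraceClass_P0 φ).choose_spec f g

theorem translate_smul (x : SU n) (c : ℂ) (A : Op n ν) : translate x (c • A) = c • translate x A := by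
  rw [translate, translate, ContinuousLinearMap.smul_comp, ContinuousLinearMap.comp_smul]

theorem isRadialOp_sphOp (φ : SBdd n) : IsRadialOp (sphOp ν φ) := fun k => by
  refine ContinuousLinearMap.ext fun g => ext_inner_left ℂ fun f => ?_
  rw [inner_translate, inner_sphOp, inner_sphOp,
    ← integral_mul_left_eq_self (fun x => φ.1 x * inner ℂ f (translate x (P0 n ν) g)) (kEmb k)]
  refine integral_congr_ae (Filter.Eventually.of_forall fun x => ?_)
  simp only
  rw [spherical_kEmb_mul, inner_translate, inner_translate, inner_piNu_piNu, _root_.mul_inv_rev]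

theorem isRadialOp_TOp (s : SBdd n → ℂ) (φ : SBdd n) : IsRadialOp (TOp n ν s φ) := fun k => by
  rw [TOp_eq (inner_sphOp φ), translate_smul, isRadialOp_sphOp φ k]

theorem TOp_apply_of_isHomogeneousPoly (s : SBdd n → ℂ) (φ : SBdd n) {m : ℕ} {e : E n}
    (he : ‖e‖ = 1) {g : bergman n ν} (hg : IsHomogeneousPoly m g) :
    TOp n ν s φ g = (((n.factorial * Real.Gamma (m + ν) /
        (Real.Gamma ν * (n + m - 1).factorial) : ℝ) : ℂ) / s φ *
      radialMoment n ν m fun r => onBall φ.1 ((Real.sqrt r : ℂ) • e)) • g := by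
  obtain ⟨p, hp, hgp⟩ := hg
  have hrep := rep_eqOn (differentiable_eval p).differentiableOn hgp
  obtain ⟨C, hC⟩ := spherical_exists_bound φ
  have hψ : ∀ y ∈ ball (0 : E n) 1,
      onBall φ.1 ((Real.sqrt (‖y‖ ^ 2) : ℂ) • e) = onBall φ.1 y := fun y hy => by
    refine onBall_eq_of_norm_eq φ hy ?_
    rw [norm_smul, he, mul_one, Complex.norm_real, Real.sqrt_sq (norm_nonneg _), norm_norm]
  have hψ' : (fun y : E n => onBall φ.1 ((Real.sqrt (‖y‖ ^ 2) : ℂ) • e)) =ᵐ[muNu n ν]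
      onBall φ.1 := by
    filter_upwards [ae_mem_ball_mu] with y hy using hψ y hy
  refine bergman_ext fun z hz => ?_
  have h1 := integral_radial_mul_rep_mul_kerNu
    (p := fun y => MvPolynomial.eval (fun i => y i) p) (eval_smul_of_isHomogeneous hp) hrep
    (ψ := fun r => onBall φ.1 ((Real.sqrt r : ℂ) • e)) (M := C)
    ((aestronglyMeasurable_of_continuousOn (continuousOn_onBall φ)).congr hψ'.symm)
    (by
      filter_upwards [ae_mem_ball_mu] with y hy
      rw [hψ y hy, onBall_eq_sec φ hy]
      exact hC _) hz
  have h2 : ∫ y, onBall φ.1 ((Real.sqrt (‖y‖ ^ 2) : ℂ) • e) * rep g y * kerNu n ν z y ∂muNu n ν =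
      ∫ y, onBall φ.1 y * (conj (rep (kerVec ν z) y) * rep g y) ∂muNu n ν := by
    refine integral_congr_ae ?_
    filter_upwards [ae_mem_ball_mu] with y hy
    rw [hψ y hy, rep_kerVec hz hy, conj_kerNu hy hz]
    ring
  -- The eigenvalue is `s⁻¹ c_ν⁻¹` times the quotient of moments; `Γ(ν - n)` cancels between `c_ν`
  -- and the beta value.
  rw [TOp_eq (inner_sphOp φ), _root_.smul_apply, rep_smul _ _ hz, rep_smul _ _ hz,
    ← inner_kerVec hz (sphOp ν φ g), inner_sphOp_P0 (inner_sphOp φ), ← h2, h1,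
    radialMoment_one hn.out hν.out, cNu]
  have h0 : (0 : ℝ) ≤ n := Nat.cast_nonneg n
  have hm : (0 : ℝ) ≤ m := Nat.cast_nonneg m
  have hν' := hν.out
  have g1 : (Real.Gamma (ν - n) : ℂ) ≠ 0 := by
    exact_mod_cast (Real.Gamma_pos_of_pos (show 0 < ν - n by linarith)).ne'
  have g2 : (Real.Gamma (m + ν) : ℂ) ≠ 0 := by
    exact_mod_cast (Real.Gamma_pos_of_pos (show 0 < m + ν by linarith)).ne'
  have g3 : (Real.Gamma ν : ℂ) ≠ 0 := by
    exact_mod_cast (Real.Gamma_pos_of_pos (show 0 < ν by linarith)).ne'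
  have g4 : ((n + m - 1).factorial : ℂ) ≠ 0 := by exact_mod_cast Nat.factorial_ne_zero _
  have g5 : (n.factorial : ℂ) ≠ 0 := by exact_mod_cast Nat.factorial_ne_zero _
  push_cast
  generalize radialMoment n ν m (fun r => onBall φ.1 ((Real.sqrt r : ℂ) • e)) = R
  field_simp

/-! ### The spherical transform of `h_ν` has no zeros -/

/-- Applying the hypothesis to the holomorphic functions `z_i F` and summing over `i` produces one
more factor `‖z‖²`; induction gives all powers. -/
theorem integral_mul_normSq_pow_eq_zero {ρ : E n → ℂ}
    (hρ : ∀ F : E n → ℂ, DifferentiableOn ℂ F (ball 0 1) → (∃ M, ∀ z ∈ ball (0 : E n) 1, ‖F z‖ ≤ M) →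
      ∫ z, ρ z * (‖F z‖ ^ 2 : ℝ) ∂muNu n ν = 0)
    (hi : Integrable ρ (muNu n ν)) (m : ℕ) :
    ∀ F : E n → ℂ, DifferentiableOn ℂ F (ball 0 1) → (∃ M, ∀ z ∈ ball (0 : E n) 1, ‖F z‖ ≤ M) →
      ∫ z, ρ z * (((‖z‖ ^ 2) ^ m * ‖F z‖ ^ 2 : ℝ) : ℂ) ∂muNu n ν = 0 := by
  induction m with
  | zero => simpa using hρ
  | succ m ih =>
    rintro F hF ⟨M, hM⟩
    have hM' : ∀ i, ∀ z ∈ ball (0 : E n) 1, ‖z i * F z‖ ≤ M := fun i z hz => by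
      rw [norm_mul]
      refine (mul_le_of_le_one_left (norm_nonneg _) ?_).trans (hM z hz)
      exact (PiLp.norm_apply_le z i).trans (norm_lt_one_of_mem hz).le
    have hd : ∀ i, DifferentiableOn ℂ (fun z : E n => z i * F z) (ball 0 1) := fun i =>
      DifferentiableOn.mul (by fun_prop) hF
    have h1 : ∀ i, ∫ z, ρ z * (((‖z‖ ^ 2) ^ m * ‖z i * F z‖ ^ 2 : ℝ) : ℂ) ∂muNu n ν = 0 :=
      fun i => ih _ (hd i) ⟨M, hM' i⟩
    have h2 : ∀ i, Integrable (fun z => ρ z * (((‖z‖ ^ 2) ^ m * ‖z i * F z‖ ^ 2 : ℝ) : ℂ))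
        (muNu n ν) := fun i => by
      refine hi.mul_bdd (c := M ^ 2) (aestronglyMeasurable_of_continuousOn ?_) ?_
      · have := (hd i).continuousOn
        fun_prop
      · filter_upwards [ae_mem_ball_mu] with z hz
        rw [Complex.norm_real, Real.norm_of_nonneg (by positivity)]
        have h3 : (‖z‖ ^ 2) ^ m ≤ 1 :=
          pow_le_one₀ (by positivity) (pow_le_one₀ (norm_nonneg _) (norm_lt_one_of_mem hz).le)
        exact (mul_le_of_le_one_left (by positivity) h3).trans
          (pow_le_pow_left₀ (norm_nonneg _) (hM' i z hz) 2)
    rw [← Finset.sum_const_zero (s := (Finset.univ : Finset (Fin n))),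
      ← Finset.sum_congr rfl fun i _ => h1 i, ← integral_finsetSum _ fun i _ => h2 i]
    refine integral_congr_ae (Filter.Eventually.of_forall fun z => ?_)
    simp only
    rw [← Finset.mul_sum, ← Complex.ofReal_sum, ← Finset.mul_sum]
    simp only [norm_mul, mul_pow]
    rw [← Finset.sum_mul, ← EuclideanSpace.norm_sq_eq, pow_succ, mul_assoc]

/-- If the transform vanished, the operator `∫ φ π P₀ π*` would have zero Berezin transform, hence
be zero. Then `φ` would be orthogonal to all polynomials, and by Weierstrass to all continuous
functions, of `‖z‖²`, although it is `1` at the origin. -/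
theorem hHat_ne_zero (φ : SBdd n) : hHat n ν φ ≠ 0 := by
  intro h0
  have hY : sphOp ν φ = 0 := eq_zero_of_inner_orbit fun y => by
    rw [inner_orbit_sphOp isTraceClass_P0 isRadialOp_P0 (inner_sphOp φ), opConv_P0_P0]
    change φ.1 y * hHat n ν φ = 0
    rw [h0, mul_zero]
  have hc0 : (cNu n ν : ℂ) ≠ 0 := by exact_mod_cast (cNu_pos hν.out).ne'
  obtain ⟨C, hC⟩ := spherical_exists_bound φ
  have hcont := continuousOn_onBall φ
  have hbd : ∀ᵐ z ∂muNu n ν, ‖onBall φ.1 z‖ ≤ C := by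
    filter_upwards [ae_mem_ball_mu] with z hz
    rw [onBall_eq_sec φ hz]
    exact hC _
  have hi : Integrable (onBall φ.1) (muNu n ν) := by
    have h1 := (integrable_const (1 : ℂ) (μ := muNu n ν)).bdd_mul (c := C)
      (aestronglyMeasurable_of_continuousOn hcont) hbd
    simpa using h1
  have h1 : ∀ F : E n → ℂ, DifferentiableOn ℂ F (ball 0 1) →
      (∃ M, ∀ z ∈ ball (0 : E n) 1, ‖F z‖ ≤ M) →
      ∫ z, onBall φ.1 z * (‖F z‖ ^ 2 : ℝ) ∂muNu n ν = 0 := by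
    rintro F hF ⟨M, hM⟩
    have hL : MemLp F 2 (muNu n ν) := MemLp.of_bound
      (aestronglyMeasurable_of_continuousOn hF.continuousOn) M (by
        filter_upwards [ae_mem_ball_mu] with z hz using hM z hz)
    have h2 := inner_sphOp_P0 (inner_sphOp φ) (ofHol F hF hL) (ofHol F hF hL)
    rw [hY, _root_.zero_apply, inner_zero_right] at h2
    rw [← (mul_eq_zero.mp h2.symm).resolve_left (inv_ne_zero hc0)]
    refine integral_congr_ae ?_
    filter_upwards [ae_mem_ball_mu] with z hz
    rw [rep_ofHol hF hL hz, ← Complex.normSq_eq_conj_mul_self, Complex.normSq_eq_norm_sq]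
  have h2 : ∀ m : ℕ, ∫ z, onBall φ.1 z * (((‖z‖ ^ 2) ^ m : ℝ) : ℂ) ∂muNu n ν = 0 := fun m => by
    simpa using integral_mul_normSq_pow_eq_zero h1 hi m (fun _ => 1) (differentiableOn_const _)
      ⟨1, by simp⟩
  have hnsq : ∀ z ∈ ball (0 : E n) 1, ‖z‖ ^ 2 ∈ Set.Icc (0 : ℝ) 1 := fun z hz =>
    ⟨by positivity, pow_le_one₀ (norm_nonneg _) (norm_lt_one_of_mem hz).le⟩
  have hint : ∀ q : ℝ → ℝ, Continuous q →
      Integrable (fun z => onBall φ.1 z * (q (‖z‖ ^ 2) : ℂ)) (muNu n ν) := fun q hq => by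
    obtain ⟨B, hB⟩ := isCompact_Icc.exists_bound_of_continuousOn (s := Set.Icc (0 : ℝ) 1)
      hq.continuousOn
    refine hi.mul_bdd (c := B) (aestronglyMeasurable_of_continuousOn (by fun_prop)) ?_
    filter_upwards [ae_mem_ball_mu] with z hz
    rw [Complex.norm_real]
    exact hB _ (hnsq z hz)
  have h3 : ∀ p : Polynomial ℝ, ∫ z, onBall φ.1 z * ((p.eval (‖z‖ ^ 2) : ℝ) : ℂ) ∂muNu n ν = 0 :=
    fun p => by
      induction p using Polynomial.induction_on' with
      | add p q hp hq =>
        simp only [Polynomial.eval_add, Complex.ofReal_add, mul_add]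
        rw [integral_add (hint _ p.continuous) (hint _ q.continuous), hp, hq, add_zero]
      | monomial k a =>
        simp only [Polynomial.eval_monomial, Complex.ofReal_mul]
        have h4 : ∀ z : E n, onBall φ.1 z * ((a : ℂ) * (((‖z‖ ^ 2) ^ k : ℝ) : ℂ)) =
            a * (onBall φ.1 z * (((‖z‖ ^ 2) ^ k : ℝ) : ℂ)) := fun z => by ring
        simp only [h4]
        rw [integral_const_mul, h2, mul_zero]
  have h4 : ∀ q : ℝ → ℝ, Continuous q →
      ∫ z, onBall φ.1 z * (q (‖z‖ ^ 2) : ℂ) ∂muNu n ν = 0 := fun q hq => by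
    by_contra hne
    have hC0 : 0 ≤ C := (norm_nonneg _).trans (hC 1)
    obtain ⟨p, hp⟩ := exists_polynomial_near_of_continuousOn 0 1 q hq.continuousOn
      (‖∫ z, onBall φ.1 z * (q (‖z‖ ^ 2) : ℂ) ∂muNu n ν‖ / (C + 1))
      (div_pos (norm_pos_iff.mpr hne) (by linarith))
    set ε := ‖∫ z, onBall φ.1 z * (q (‖z‖ ^ 2) : ℂ) ∂muNu n ν‖ / (C + 1) with hε
    have h5 : ∫ z, onBall φ.1 z * (q (‖z‖ ^ 2) : ℂ) ∂muNu n ν =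
        ∫ z, onBall φ.1 z * ((q (‖z‖ ^ 2) : ℂ) - (p.eval (‖z‖ ^ 2) : ℝ)) ∂muNu n ν := by
      simp only [mul_sub]
      rw [integral_sub (hint q hq) (hint _ p.continuous), h3, sub_zero]
    have h6 : ‖∫ z, onBall φ.1 z * ((q (‖z‖ ^ 2) : ℂ) - (p.eval (‖z‖ ^ 2) : ℝ)) ∂muNu n ν‖ ≤ C * ε := by
      have h7 := norm_integral_le_of_norm_le_const (μ := muNu n ν) (C := C * ε)
        (f := fun z => onBall φ.1 z * ((q (‖z‖ ^ 2) : ℂ) - (p.eval (‖z‖ ^ 2) : ℝ))) (by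
          filter_upwards [ae_mem_ball_mu, hbd] with z hz hz'
          rw [norm_mul, ← Complex.ofReal_sub, Complex.norm_real, norm_sub_rev]
          exact mul_le_mul hz' (hp _ (hnsq z hz)).le (norm_nonneg _) hC0)
      simpa using h7
    have h8 : ε * (C + 1) = ‖∫ z, onBall φ.1 z * (q (‖z‖ ^ 2) : ℂ) ∂muNu n ν‖ := by
      rw [hε]
      field_simp
    have h9 : 0 < ε := div_pos (norm_pos_iff.mpr hne) (by linarith)
    rw [← h5, ← h8] at h6
    linarith
  have hφ0 : onBall φ.1 (0 : E n) = 1 := by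
    have := onBall_act φ 1
    rwa [act_one, spherical_one] at this
  have hnhd : ∀ᶠ z in nhds (0 : E n), 1 / 2 < (onBall φ.1 z).re := by
    have h5 : ContinuousAt (fun z => (onBall φ.1 z).re) (0 : E n) :=
      Complex.continuous_re.continuousAt.comp (hcont.continuousAt (ball_mem_nhds 0 one_pos))
    refine h5.eventually (lt_mem_nhds ?_)
    simp only [hφ0]
    norm_num
  obtain ⟨δ, hδ, hδ'⟩ := Metric.eventually_nhds_iff.mp hnhd
  -- A radial bump supported where `Re φ > 1/2` has a nonnegative product with `Re φ`, positive at
  -- the origin.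
  have h5 := h4 (fun t => max (δ ^ 2 - t) 0) (by fun_prop)
  have hint5 := hint (fun t => max (δ ^ 2 - t) 0) (by fun_prop)
  have h6 : ∀ z : E n, 0 ≤ (onBall φ.1 z).re * max (δ ^ 2 - ‖z‖ ^ 2) 0 := fun z => by
    rcases lt_or_ge ‖z‖ δ with hz | hz
    · have := hδ' (y := z) (by simpa using hz)
      exact mul_nonneg (by linarith) (le_max_right _ _)
    · rw [max_eq_right (by nlinarith [norm_nonneg z]), mul_zero]
  have h7 : ∫ z, (onBall φ.1 z).re * max (δ ^ 2 - ‖z‖ ^ 2) 0 ∂muNu n ν = 0 := by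
    have h8 := integral_re hint5
    rw [h5] at h8
    simpa [Complex.re_mul_ofReal] using h8
  have hint7 : Integrable (fun z => (onBall φ.1 z).re * max (δ ^ 2 - ‖z‖ ^ 2) 0) (muNu n ν) := by
    have h8 := hint5.re
    simpa [Complex.re_mul_ofReal] using h8
  have h8 := (integral_eq_zero_iff_of_nonneg h6 hint7).mp h7
  have h9 := eqOn_ball_of_ae_eq hν.out h8
    (by
      have : ContinuousOn (fun z => (onBall φ.1 z).re) (ball (0 : E n) 1) :=
        Complex.continuous_re.comp_continuousOn hcont
      fun_prop) continuousOn_const zero_mem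
  simp only [hφ0, Complex.one_re, norm_zero, one_mul, Pi.zero_apply] at h9
  have h10 := le_max_left (δ ^ 2 - (0 : ℝ) ^ 2) 0
  rw [h9] at h10
  nlinarith

end HomogeneousPolynomials

/-! ### Characters of the radial `L¹` algebra. -/

section RadialFunctions

variable {n : ℕ} {ν : ℝ} [hn : Fact (1 ≤ n)] [hν : Fact ((n : ℝ) < ν)]

/-! ### The convolution algebra of radial integrable functions -/

/-- The limit is represented by a pointwise limit of `K`-invariant representatives; `limUnder` is
defined everywhere, so the invariance is exact and not only almost everywhere. -/
theorem isClosed_L1K : IsClosed (L1K n : Set (Lp ℂ 1 (invMeasure n))) := by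
  refine IsSeqClosed.isClosed fun fs f hfs hlim => ?_
  choose F hF hfF using hfs
  obtain ⟨ns, -, hae⟩ := (tendstoInMeasure_of_tendsto_Lp hlim).exists_seq_tendsto_ae
  refine ⟨fun z => Filter.limUnder Filter.atTop fun j => F (ns j) z, fun k z => by simp only [hF], ?_⟩
  filter_upwards [hae, ae_all_iff.mpr hfF] with z hz hz'
  simp only [hz'] at hz
  exact hz.limUnder_eq.symm

instance : CompleteSpace (L1K n) := isClosed_L1K.completeSpace_coe

theorem exists_onG_eq_conv (f g : L1K n) : ∃ h : L1K n, onG h =ᵐ[muG n] conv (onG f) (onG g) :=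
  exists_onG_eq (measurable_conv (measurable_onG _) (measurable_onG _))
    (integrable_conv (integrable_onG _) (integrable_onG _))
    (fun k x => conv_kEmb_mul (onG_kEmb_mul f k) x)
    fun x k => conv_mul_kEmb (fun x => onG_mul_kEmb g x k) x

/-- The convolution of two radial integrable functions. -/
def convL1K (f g : L1K n) : L1K n := (exists_onG_eq_conv f g).choose

theorem onG_convL1K (f g : L1K n) : onG (convL1K f g) =ᵐ[muG n] conv (onG f) (onG g) :=
  (exists_onG_eq_conv f g).choose_spec

theorem norm_convL1K_le (f g : L1K n) : ‖convL1K f g‖ ≤ ‖f‖ * ‖g‖ := by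
  rw [← integral_norm_onG, ← integral_norm_onG, ← integral_norm_onG]
  refine le_trans (le_of_eq (integral_congr_ae ?_))
    (integral_norm_conv_le (integrable_onG f) (integrable_onG g))
  filter_upwards [onG_convL1K f g] with x hx
  rw [hx]

theorem convL1K_sub (f g h : L1K n) : convL1K f (g - h) = convL1K f g - convL1K f h := by
  refine onG_injective ?_
  filter_upwards [onG_convL1K f (g - h), onG_convL1K f g, onG_convL1K f h,
    onG_sub (convL1K f g) (convL1K f h),
    (integrable_conv_kernel (integrable_onG f) (integrable_onG g)).prod_left_ae,
    (integrable_conv_kernel (integrable_onG f) (integrable_onG h)).prod_left_ae]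
    with x h1 h2 h3 h4 h5 h6
  rw [h1, h4, h2, h3, conv_congr_ae (Filter.EventuallyEq.refl _ _) (onG_sub g h) x, conv, conv, conv,
    ← integral_sub h5 h6]
  simp only [mul_sub]

/-- Multiplicative linear functionals are contractive. -/
theorem norm_le_of_multiplicative (ψ : L1K n →ₗ[ℂ] ℂ)
    (hψ : ∀ f g, ψ (convL1K f g) = ψ f * ψ g) (f : L1K n) : ‖ψ f‖ ≤ ‖f‖ := by
  by_contra! hlt
  have h0 : ψ f ≠ 0 := norm_pos_iff.mp ((norm_nonneg f).trans_lt hlt)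
  -- If `‖f‖ < ‖ψ f‖`, then `a` has norm less than one and `ψ a = 1`. The contraction `b ↦ a + a *
  -- b` has a fixed point, and applying `ψ` gives `ψ b = 1 + ψ b`.
  set a : L1K n := (ψ f)⁻¹ • f with ha
  have ha1 : ‖a‖ < 1 := by
    rw [ha, norm_smul, norm_inv, inv_mul_lt_iff₀ (norm_pos_iff.mpr h0), mul_one]
    exact hlt
  have hψa : ψ a = 1 := by
    rw [ha, map_smul, smul_eq_mul, inv_mul_cancel₀ h0]
  have hc : ContractingWith ‖a‖₊ fun b : L1K n => a + convL1K a b := by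
    refine ⟨by exact_mod_cast ha1, LipschitzWith.of_dist_le_mul fun b b' => ?_⟩
    rw [dist_add_left, dist_eq_norm, ← convL1K_sub, dist_eq_norm]
    exact norm_convL1K_le _ _
  have hb := hc.fixedPoint_isFixedPt
  have h1 := congrArg ψ hb.eq
  rw [map_add, hψ, hψa, one_mul] at h1
  exact one_ne_zero (add_eq_right.mp h1)

/-! ### Translation in `L¹(G)` -/

/-- Left translation of integrable functions on `G`. -/
def transG (y : SU n) (g : Lp ℂ 1 (muG n)) : Lp ℂ 1 (muG n) := DomMulAct.mk y⁻¹ • g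

theorem coeFn_transG (y : SU n) (g : Lp ℂ 1 (muG n)) :
    (transG y g : SU n → ℂ) =ᵐ[muG n] fun x => g (y⁻¹ * x) :=
  DomMulAct.smul_Lp_ae_eq _ _

theorem norm_transG (y : SU n) (g : Lp ℂ 1 (muG n)) : ‖transG y g‖ = ‖g‖ :=
  DomMulAct.norm_smul_Lp _ _

theorem continuous_transG (g : Lp ℂ 1 (muG n)) : Continuous fun y : SU n => transG y g :=
  haveI : Fact ((1 : ℝ≥0∞) ≠ ∞) := ⟨ENNReal.one_ne_top⟩
  (DomMulAct.continuous_mk.comp continuous_inv).smul continuous_const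

/-- Integration over a measurable set as a functional on `L¹(G)`. -/
def setIntegralG (s : Set (SU n)) : Lp ℂ 1 (muG n) →L[ℂ] ℂ :=
  LinearMap.mkContinuous
    { toFun := fun f => ∫ x in s, f x ∂muG n
      map_add' := fun f g => by
        rw [← integral_add (L1.integrable_coeFn f).integrableOn (L1.integrable_coeFn g).integrableOn]
        exact integral_congr_ae (ae_restrict_of_ae (Lp.coeFn_add f g))
      map_smul' := fun c f => by
        rw [RingHom.id_apply, ← integral_smul]
        exact integral_congr_ae (ae_restrict_of_ae (Lp.coeFn_smul c f)) } 1 fun f => by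
    rw [one_mul, L1.norm_eq_integral_norm]
    exact (norm_integral_le_integral_norm _).trans
      (setIntegral_le_integral (L1.integrable_coeFn f).norm
        (Filter.Eventually.of_forall fun _ => norm_nonneg _))

theorem setIntegralG_apply (s : Set (SU n)) (f : Lp ℂ 1 (muG n)) :
    setIntegralG s f = ∫ x in s, f x ∂muG n := rfl

theorem integrable_smul_transG {F : SU n → ℂ} (hF : Integrable F (muG n)) (g : Lp ℂ 1 (muG n)) :
    Integrable (fun y => F y • transG y g) (muG n) := by
  refine (hF.norm.mul_const ‖g‖).mono'
    (hF.aestronglyMeasurable.smul (continuous_transG g).aestronglyMeasurable)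
    (Filter.Eventually.of_forall fun y => ?_)
  rw [norm_smul, norm_transG]

/-- A convolution is a vector-valued integral of translates. -/
theorem eq_integral_transG {F : SU n → ℂ} (hF : Integrable F (muG n)) {g h : Lp ℂ 1 (muG n)}
    (hh : h =ᵐ[muG n] conv F g) : h = ∫ y, F y • transG y g ∂muG n := by
  refine Lp.ext ?_
  -- Set integrals are continuous functionals, so they commute with the vector-valued integral.
  refine Integrable.ae_eq_of_forall_setIntegral_eq _ _ (L1.integrable_coeFn _)
    (L1.integrable_coeFn _) fun s hs _ => ?_
  have hg := L1.integrable_coeFn g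
  have hb : ∀ x, ‖s.indicator (fun _ => (1 : ℂ)) x‖ ≤ 1 := fun x => by
    refine (norm_indicator_le_norm_self _ _).trans ?_
    simp
  have hset : ∀ f : SU n → ℂ, ∫ x in s, f x ∂muG n =
      ∫ x, f x * s.indicator (fun _ => 1) x ∂muG n := fun f => by
    rw [← integral_indicator hs]
    congr 1
    funext x
    by_cases hx : x ∈ s
    · rw [Set.indicator_of_mem hx, Set.indicator_of_mem hx, mul_one]
    · rw [Set.indicator_of_notMem hx, Set.indicator_of_notMem hx, mul_zero]
  rw [← setIntegralG_apply s (∫ y, F y • transG y g ∂muG n),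
    ← ContinuousLinearMap.integral_comp_comm _ (integrable_smul_transG hF g),
    integral_congr_ae (ae_restrict_of_ae hh), hset,
    integral_conv_mul hF hg (measurable_const.indicator hs) hb]
  refine integral_congr_ae (Filter.Eventually.of_forall fun y => ?_)
  simp only
  rw [map_smul, smul_eq_mul, setIntegralG_apply, integral_congr_ae (ae_restrict_of_ae
    (coeFn_transG y g)), hset, ← integral_mul_left_eq_self
    (fun x => g (y⁻¹ * x) * s.indicator (fun _ => 1) x) y]
  simp only [inv_mul_cancel_left]

/-- The isometric embedding of the radial integrable functions on the ball into `L¹(G)`. -/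
def embG : L1K n →ₗᵢ[ℂ] Lp ℂ 1 (muG n) :=
  (Lp.compMeasurePreservingₗᵢ ℂ (fun x : SU n => act x 0) measurePreserving_orbit).comp
    (L1K n).subtypeₗᵢ

theorem coeFn_embG (f : L1K n) : (embG f : SU n → ℂ) =ᵐ[muG n] onG f :=
  Lp.coeFn_compMeasurePreserving _ _

theorem transG_mul_kEmb (f : L1K n) (y : SU n) (k : U n) :
    transG (y * kEmb k) (embG f) = transG y (embG f) := by
  have h1 : DomMulAct.mk (kEmb k) • embG f = embG f := by
    refine Lp.ext ?_
    have h2 : ∀ᵐ x ∂muG n, embG f (kEmb k * x) = onG f (kEmb k * x) :=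
      (measurePreserving_mul_left (muG n) (kEmb k)).quasiMeasurePreserving.ae
        (p := fun x => embG f x = onG f x) (coeFn_embG f)
    filter_upwards [DomMulAct.smul_Lp_ae_eq (DomMulAct.mk (kEmb k)) (embG f), coeFn_embG f, h2,
      onG_kEmb_mul f k] with x h3 h4 h5 h6
    rw [h3, h4, ← h6, ← h5]
    rfl
  rw [transG, transG, _root_.mul_inv_rev, DomMulAct.mk_mul, mul_smul]
  congr 1
  rw [DomMulAct.mk_inv, inv_smul_eq_iff, h1]

/-- A multiplicative functional is given by a bounded continuous function. -/
theorem exists_integral_representation (ψ : L1K n →ₗ[ℂ] ℂ)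
    (hψ : ∀ f g, ψ (convL1K f g) = ψ f * ψ g) (hne : ψ ≠ 0) :
    ∃ θ : SU n → ℂ, Continuous θ ∧ (∃ C, ∀ x, ‖θ x‖ ≤ C) ∧
      (∀ x (k : U n), θ (x * kEmb k) = θ x) ∧ ∀ f, ψ f = ∫ x, onG f x * θ x ∂muG n := by
  obtain ⟨f₀, hf₀⟩ : ∃ f, ψ f ≠ 0 := by
    by_contra! h
    exact hne (LinearMap.ext h)
  let ψc : L1K n →L[ℂ] ℂ := ψ.mkContinuous 1 fun f => by
    rw [one_mul]
    exact norm_le_of_multiplicative ψ hψ f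
  let e := (embG (n := n)).equivRange
  -- Translates of `f₀` are in general no longer left `K`-invariant, so the functional is first
  -- extended to all of `L¹(G)` by Hahn-Banach.
  obtain ⟨L, hL, -⟩ := exists_extension_norm_eq (LinearMap.range (embG (n := n)).toLinearMap)
    (ψc ∘L (e.symm.toContinuousLinearEquiv : _ →L[ℂ] L1K n))
  have hL' : ∀ f, L (embG f) = ψ f := fun f => by
    have h := hL (e f)
    rw [ContinuousLinearMap.comp_apply] at h
    have h2 : e.symm (e f) = f := e.symm_apply_apply f
    exact h.trans (congrArg ψc h2)
  -- Since `f * f₀ = ∫ f(y) (translate of f₀ by y) dy`, applying `L` gives `ψ(f) ψ(f₀)`, and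
  -- dividing by `ψ(f₀)` exhibits the density.
  refine ⟨fun y => L (transG y (embG f₀)) / ψ f₀,
    (L.continuous.comp (continuous_transG _)).div_const _,
    ⟨‖L‖ * ‖embG f₀‖ / ‖ψ f₀‖, fun x => ?_⟩, fun x k => by simp only [transG_mul_kEmb], fun f => ?_⟩
  · rw [norm_div]
    gcongr
    rw [← norm_transG x]
    exact L.le_opNorm _
  · have h1 : embG (convL1K f f₀) = ∫ y, onG f y • transG y (embG f₀) ∂muG n := by
      refine eq_integral_transG (integrable_onG f) ?_
      filter_upwards [coeFn_embG (convL1K f f₀), onG_convL1K f f₀] with x h2 h3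
      rw [h2, h3]
      exact conv_congr_ae (Filter.EventuallyEq.refl _ _) (coeFn_embG f₀).symm x
    have h2 := congrArg L h1
    rw [hL', hψ, ← ContinuousLinearMap.integral_comp_comm _
      (integrable_smul_transG (integrable_onG f) _)] at h2
    rw [eq_div_of_mul_eq hf₀ h2, ← integral_div]
    refine integral_congr_ae (Filter.Eventually.of_forall fun y => ?_)
    simp only
    rw [map_smul, smul_eq_mul, mul_div_assoc]

end RadialFunctions

/-! ### From characters to spherical functions, and the classification. -/

section Classification

variable {n : ℕ} {ν : ℝ} [hn : Fact (1 ≤ n)] [hν : Fact ((n : ℝ) < ν)]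

/-! ### Spherical functions from multiplicative functionals -/

theorem continuous_integral_mul {X : Type*} [MeasurableSpace X] {μ : Measure X} {g : X → ℂ}
    (hg : Integrable g μ) {w : SU n → X → ℂ} (hm : ∀ y, AEStronglyMeasurable (w y) μ)
    (hc : ∀ x, Continuous fun y => w y x) {M : ℝ} (hM : ∀ y x, ‖w y x‖ ≤ M) :
    Continuous fun y => ∫ x, g x * w y x ∂μ := by
  refine continuous_of_dominated (bound := fun x => ‖g x‖ * M)
    (fun y => hg.aestronglyMeasurable.mul (hm y))
    (fun y => Filter.Eventually.of_forall fun x => ?_) (hg.norm.mul_const M)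
    (Filter.Eventually.of_forall fun x => continuous_const.mul (hc x))
  rw [norm_mul]
  exact mul_le_mul_of_nonneg_left (hM y x) (norm_nonneg _)

theorem continuous_integral_K {w : SU n → U n → ℂ} (hm : ∀ y, Continuous (w y))
    (hc : ∀ k, Continuous fun y => w y k) {M : ℝ} (hM : ∀ y k, ‖w y k‖ ≤ M) :
    Continuous fun y => ∫ k, w y k ∂muK n := by
  have h := continuous_integral_mul (integrable_const (1 : ℂ) (μ := muK n))
    (fun y => (hm y).aestronglyMeasurable) hc hM
  simpa only [one_mul] using h

theorem norm_integral_K_le {w : U n → ℂ} {M : ℝ} (hM : ∀ k, ‖w k‖ ≤ M) :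
    ‖∫ k, w k ∂muK n‖ ≤ M := by
  have h := norm_integral_le_of_norm_le_const (μ := muK n) (Filter.Eventually.of_forall hM)
  simpa using h

theorem pull_hNu_pos (x : SU n) (ν : ℝ) : 0 < (1 - ‖act x (0 : E n)‖ ^ 2) ^ ν :=
  Real.rpow_pos_of_pos (one_sub_normSq_pos (act_mem x zero_mem)) _

theorem continuous_pull_hNu : Continuous (pull (hNu n ν)) := by
  rw [← opConv_P0_P0]
  exact continuous_opConv isTraceClass_P0 _

/-- Testing against `conj w` times a strictly positive integrable radial weight gives a vanishing
integral of a nonnegative continuous function. The weight is `h_(n+1)`, any exponent above `n` being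
admissible. -/
theorem eq_zero_of_integral_onG_mul {w : SU n → ℂ} (hw : Continuous w) {M : ℝ}
    (hM : ∀ x, ‖w x‖ ≤ M) (hl : ∀ (k : U n) x, w (kEmb k * x) = w x)
    (hr : ∀ x (k : U n), w (x * kEmb k) = w x)
    (h : ∀ f : L1K n, ∫ x, onG f x * w x ∂muG n = 0) (x : SU n) : w x = 0 := by
  have : Fact ((n : ℝ) < n + 1) := ⟨by linarith⟩
  set H := pull (hNu n (n + 1)) with hH
  have hHc : Continuous H := continuous_pull_hNu
  have hHl : ∀ (k : U n) x, H (kEmb k * x) = H x := fun k x => by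
    rw [hH, ← opConv_P0_P0, opConv_kEmb_mul isTraceClass_P0 isRadialOp_P0]
  have hHr : ∀ x (k : U n), H (x * kEmb k) = H x := fun x k => by
    rw [hH, ← opConv_P0_P0, opConv_mul_kEmb isRadialOp_P0]
  have hwc : Continuous fun x => conj (w x) := Complex.continuous_conj.comp hw
  have hi : Integrable (fun x => conj (w x) * H x) (muG n) :=
    integrable_hNu.bdd_mul (c := M) hwc.aestronglyMeasurable
      (Filter.Eventually.of_forall fun x => by rw [Complex.norm_conj]; exact hM x)
  obtain ⟨f, hf⟩ := exists_onG_eq (F := fun x => conj (w x) * H x) (hwc.mul hHc).measurable hi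
    (fun k x => by rw [hl, hHl]) fun x k => by rw [hr, hHr]
  have h1 : ∫ x, conj (w x) * H x * w x ∂muG n = 0 := by
    rw [← h f]
    refine integral_congr_ae ?_
    filter_upwards [hf] with x hx
    rw [hx]
  have hi2 : Integrable (fun x => conj (w x) * H x * w x) (muG n) :=
    hi.mul_bdd (c := M) hw.aestronglyMeasurable (Filter.Eventually.of_forall hM)
  have h2 : ∀ x, (conj (w x) * H x * w x).re =
      ‖w x‖ ^ 2 * (1 - ‖act x (0 : E n)‖ ^ 2) ^ ((n : ℝ) + 1) := fun x => by
    have h3 : conj (w x) * H x * w x =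
        ((‖w x‖ ^ 2 * (1 - ‖act x (0 : E n)‖ ^ 2) ^ ((n : ℝ) + 1) : ℝ) : ℂ) := by
      rw [mul_right_comm, ← Complex.normSq_eq_conj_mul_self, Complex.normSq_eq_norm_sq, hH, pull,
        hNu, ← Complex.ofReal_mul]
    rw [h3, Complex.ofReal_re]
  have h4 : ∫ x, (conj (w x) * H x * w x).re ∂muG n = 0 := by
    have h5 := integral_re hi2
    rw [h1] at h5
    simpa using h5
  have h5 := (integral_eq_zero_iff_of_nonneg (fun x =>
    (mul_nonneg (sq_nonneg _) (pull_hNu_pos x _).le).trans_eq (h2 x).symm) hi2.re).mp h4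
  have h6 := (Continuous.ae_eq_iff_eq (muG n)
    (Complex.continuous_re.comp ((hwc.mul hHc).mul hw)) continuous_const).mp h5
  have h7 := congrFun h6 x
  have h8 := (h2 x).symm.trans h7
  exact norm_eq_zero.mp (pow_eq_zero_iff two_ne_zero |>.mp
    ((mul_eq_zero.mp h8).resolve_right (pull_hNu_pos x _).ne'))

/-- The representing function is averaged over `K` on the left. Its functional equation is obtained
by testing both variables against radial functions, where it reduces to multiplicativity of `ψ`. -/
theorem exists_spherical (ψ : L1K n →ₗ[ℂ] ℂ) (hψ : ∀ f g, ψ (convL1K f g) = ψ f * ψ g)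
    (hne : ψ ≠ 0) : ∃ φ : SBdd n, ∀ f, ψ f = sphTransform (onG f) φ := by
  obtain ⟨θ, hθ, ⟨C, hC⟩, hθr, hrep⟩ := exists_integral_representation ψ hψ hne
  set φ : SU n → ℂ := fun y => ∫ k : U n, θ (kEmb k * y) ∂muK n with hφ
  have hφc : Continuous φ := continuous_integral_K
    (fun y => hθ.comp (continuous_kEmb.mul continuous_const))
    (fun k => hθ.comp (continuous_const.mul continuous_id)) fun y k => hC _
  have hφb : ∀ y, ‖φ y‖ ≤ C := fun y => norm_integral_K_le fun k => hC _
  have hφl : ∀ (l : U n) y, φ (kEmb l * y) = φ y := fun l y => by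
    have h := integral_mul_right_eq_self (μ := muK n) (fun k : U n => θ (kEmb k * y)) l
    simpa only [kEmb_mul, mul_assoc] using h
  have hφr : ∀ y (l : U n), φ (y * kEmb l) = φ y := fun y l => by
    simp only [hφ, ← mul_assoc, hθr]
  have hψφ : ∀ f, ψ f = ∫ x, onG f x * φ x ∂muG n := fun f => by
    rw [hrep, integral_mul_average (integrable_onG f) (onG_kEmb_mul f) hθ hC]
  -- The left side of the functional equation, bi-`K`-invariant in each variable, so that it may be
  -- tested with radial functions.
  set a : SU n → SU n → ℂ := fun y x => ∫ k : U n, φ (y * kEmb k * x) ∂muK n with ha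
  have hab : ∀ y x, ‖a y x‖ ≤ C := fun y x => norm_integral_K_le fun k => hφb _
  have hac1 : ∀ x, Continuous fun y => a y x := fun x => continuous_integral_K
    (fun y => hφc.comp ((continuous_const.mul continuous_kEmb).mul continuous_const))
    (fun k => hφc.comp ((continuous_id.mul continuous_const).mul continuous_const))
    fun y k => hφb _
  have hac2 : ∀ y, Continuous (a y) := fun y => continuous_integral_K
    (fun x => hφc.comp ((continuous_const.mul continuous_kEmb).mul continuous_const))
    (fun k => hφc.comp (continuous_const.mul continuous_id))
    fun y k => hφb _
  have ha1 : ∀ (l : U n) y x, a (kEmb l * y) x = a y x := fun l y x => by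
    simp only [ha, mul_assoc, hφl]
  have ha2 : ∀ (l : U n) y x, a y (x * kEmb l) = a y x := fun l y x => by
    simp only [ha, ← mul_assoc, hφr]
  have ha3 : ∀ (l : U n) y x, a (y * kEmb l) x = a y x := fun l y x => by
    have h := integral_mul_left_eq_self (μ := muK n) (fun k : U n => φ (y * kEmb k * x)) l
    simpa only [ha, kEmb_mul, mul_assoc] using h
  have ha4 : ∀ (l : U n) y x, a y (kEmb l * x) = a y x := fun l y x => by
    have h := integral_mul_right_eq_self (μ := muK n) (fun k : U n => φ (y * kEmb k * x)) l
    simpa only [ha, kEmb_mul, mul_assoc] using h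
  have hga : ∀ (g : L1K n) y, Integrable (fun x => onG g x * a y x) (muG n) := fun g y =>
    (integrable_onG g).mul_bdd (c := C) (hac2 y).aestronglyMeasurable
      (Filter.Eventually.of_forall fun x => hab y x)
  have hgφ : ∀ g : L1K n, Integrable (fun x => onG g x * φ x) (muG n) := fun g =>
    (integrable_onG g).mul_bdd (c := C) hφc.aestronglyMeasurable (Filter.Eventually.of_forall hφb)
  set W : L1K n → SU n → ℂ := fun g y => ∫ x, onG g x * a y x ∂muG n with hW
  have hWc : ∀ g, Continuous (W g) := fun g => continuous_integral_mul (integrable_onG g)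
    (fun y => (hac2 y).aestronglyMeasurable) hac1 hab
  have hWb : ∀ g y, ‖W g y‖ ≤ ‖g‖ * C := fun g y => by
    rw [← integral_norm_onG, ← integral_mul_const]
    refine (norm_integral_le_integral_norm _).trans
      (integral_mono (hga g y).norm ((integrable_onG g).norm.mul_const C) fun x => ?_)
    simp only [norm_mul]
    exact mul_le_mul_of_nonneg_left (hab y x) (norm_nonneg _)
  -- The functional equation integrated against `g` in the second variable; testing with `f` in the
  -- first variable turns it into `ψ(f * g) = ψ(f) ψ(g)`.
  have hWφ : ∀ (g : L1K n) y, W g y = φ y * ψ g := fun g y => by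
    rw [← sub_eq_zero]
    refine eq_zero_of_integral_onG_mul (w := fun y => W g y - φ y * ψ g) (M := ‖g‖ * C + C * ‖ψ g‖)
      ((hWc g).sub (hφc.mul continuous_const)) (fun y => ?_) (fun k y => ?_) (fun y k => ?_)
      (fun f => ?_) y
    · refine (norm_sub_le _ _).trans (add_le_add (hWb g y) ?_)
      rw [norm_mul]
      exact mul_le_mul_of_nonneg_right (hφb y) (norm_nonneg _)
    · simp only [hW, ha1, hφl]
    · simp only [hW, ha3, hφr]
    · have h1 : ψ (convL1K f g) = ∫ y, onG f y * W g y ∂muG n := by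
        have h2 : ∫ x, onG (convL1K f g) x * φ x ∂muG n =
            ∫ x, conv (onG f) (onG g) x * φ x ∂muG n := by
          refine integral_congr_ae ?_
          filter_upwards [onG_convL1K f g] with x hx
          rw [hx]
        rw [hψφ, h2, integral_conv_mul (integrable_onG f) (integrable_onG g) hφc.measurable hφb]
        refine integral_congr_ae (Filter.Eventually.of_forall fun y => ?_)
        simp only
        rw [integral_mul_average (integrable_onG g) (onG_kEmb_mul g) (ψ := fun x => φ (y * x))
          (hφc.comp (continuous_const.mul continuous_id)) (fun x => hφb _)]
        simp only [hW, ha, mul_assoc]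
      have h3 : ∫ y, onG f y * (φ y * ψ g) ∂muG n = ψ f * ψ g := by
        rw [hψφ f, ← integral_mul_const]
        simp only [mul_assoc]
      have h4 : Integrable (fun y => onG f y * (φ y * ψ g)) (muG n) := by
        simpa only [mul_assoc] using (hgφ f).mul_const (ψ g)
      have h5 : Integrable (fun y => onG f y * W g y) (muG n) :=
        (integrable_onG f).mul_bdd (c := ‖g‖ * C) (hWc g).aestronglyMeasurable
          (Filter.Eventually.of_forall (hWb g))
      simp only [mul_sub]
      rw [integral_sub h5 h4, ← h1, h3, hψ, sub_self]
  have haφ : ∀ y x, a y x = φ y * φ x := fun y x => by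
    rw [← sub_eq_zero]
    refine eq_zero_of_integral_onG_mul (w := fun x => a y x - φ y * φ x) (M := C + ‖φ y‖ * C)
      ((hac2 y).sub (continuous_const.mul hφc)) (fun x => ?_) (fun k x => ?_) (fun x k => ?_)
      (fun g => ?_) x
    · refine (norm_sub_le _ _).trans (add_le_add (hab y x) ?_)
      rw [norm_mul]
      exact mul_le_mul_of_nonneg_left (hφb x) (norm_nonneg _)
    · simp only [ha4, hφl]
    · simp only [ha2, hφr]
    · have h4 : ∀ x, onG g x * (φ y * φ x) = φ y * (onG g x * φ x) := fun x => by ring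
      simp only [mul_sub, h4]
      rw [integral_sub (hga g y) ((hgφ g).const_mul _), integral_const_mul, ← hψφ, ← hWφ, sub_self]
  have hφ0 : φ ≠ 0 := fun h0 => hne (LinearMap.ext fun f => by
    rw [hψφ, h0]
    simp)
  refine ⟨⟨φ, hφc, hφ0, haφ, C, hφb⟩, fun f => ?_⟩
  rw [sphTransform_eq, hψφ]

/-! ### The multiplicative functionals of the convolution algebra -/

theorem opConv_zero_left (B : Op n ν) (x : SU n) : opConv 0 B x = 0 := by
  rw [opConv, ContinuousLinearMap.zero_comp, ← zero_smul ℂ (0 : Op n ν), trace_smul, zero_mul]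

theorem funOpConv_zero_right {F : SU n → ℂ} (hF : Integrable F (muG n)) :
    funOpConv F (0 : Op n ν) = 0 := by
  refine ContinuousLinearMap.ext fun g => ext_inner_left ℂ fun h => ?_
  rw [funOpConv_spec hF IsTraceClass.zero, _root_.zero_apply, inner_zero_right]
  simp [translate]

theorem funOpConv_onG_zero {A : Op n ν} (hA : IsTraceClass A) :
    funOpConv (onG (0 : L1K n)) A = 0 := by
  refine ContinuousLinearMap.ext fun g => ext_inner_left ℂ fun h => ?_
  rw [funOpConv_spec (integrable_onG 0) hA, _root_.zero_apply, inner_zero_right]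
  refine integral_eq_zero_of_ae ?_
  filter_upwards [onG_zero (n := n)] with x hx
  rw [hx, Pi.zero_apply, zero_mul]

theorem algMul_functions (f g : L1K n) :
    algMul (f, (0 : T1K n ν)) (g, 0) = (convL1K f g, 0) := by
  obtain ⟨h1, h2⟩ := algMul_spec (f, (0 : T1K n ν)) (g, 0)
  refine Prod.ext (onG_injective ?_) (Subtype.ext ?_)
  · filter_upwards [h1, onG_convL1K f g] with x h3 h4
    rw [h3, h4]
    exact add_eq_left.mpr (opConv_zero_left _ x)
  · rw [h2]
    exact (congrArg₂ (· + ·) (funOpConv_zero_right (integrable_onG f))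
      (funOpConv_zero_right (integrable_onG g))).trans (add_zero 0)

theorem algMul_operators (A B : T1K n ν) : ∃ h : L1K n,
    onG h =ᵐ[muG n] opConv (A : Op n ν) B ∧ algMul ((0 : L1K n), A) (0, B) = (h, 0) := by
  obtain ⟨h1, h2⟩ := algMul_spec ((0 : L1K n), A) (0, B)
  refine ⟨(algMul ((0 : L1K n), A) (0, B)).1, ?_, Prod.ext rfl (Subtype.ext ?_)⟩
  · filter_upwards [h1] with x h3
    rw [h3]
    refine add_eq_right.mpr ?_
    rw [conv_congr_ae onG_zero (Filter.EventuallyEq.refl _ _) x]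
    simp [conv]
  · rw [h2]
    exact (congrArg₂ (· + ·) (funOpConv_onG_zero B.2.1) (funOpConv_onG_zero A.2.1)).trans
      (add_zero 0)

instance : AddCommGroup (T1K n ν) := Submodule.addCommGroup _

instance : Module ℂ (T1K n ν) := Submodule.module _

theorem exists_linear_restriction {V W : Type*} [AddCommGroup V] [Module ℂ V] [AddCommGroup W]
    [Module ℂ W] {Ψ : V × W → ℂ} (h1 : ∀ a b, Ψ (a + b) = Ψ a + Ψ b)
    (h2 : ∀ (c : ℂ) a, Ψ (c • a) = c * Ψ a) :
    ∃ ψ : V →ₗ[ℂ] ℂ, (∀ f, ψ f = Ψ (f, 0)) ∧ ∀ f A, Ψ (f, A) = ψ f + Ψ (0, A) := by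
  refine ⟨⟨⟨fun f => Ψ (f, 0), fun f g => ?_⟩, fun c f => ?_⟩, fun f => rfl, fun f A => ?_⟩
  · rw [← h1, Prod.mk_add_mk, add_zero]
  · simp only [RingHom.id_apply, smul_eq_mul]
    rw [← h2, Prod.smul_mk, smul_zero]
  · change Ψ (f, A) = Ψ (f, 0) + Ψ (0, A)
    rw [← h1, Prod.mk_add_mk, add_zero, zero_add]

/-- Products of two operators are functions, so the values on operators are governed by the
restriction to functions: `Ψ(0, A) Ψ(0, B) = (A * B)^(φ)`. With `B = P₀` this leaves only a choice
of sign. -/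
theorem exists_eq_Phi {s : SBdd n → ℂ} (hs : ∀ φ, s φ ^ 2 = hHat n ν φ) {Ψ : Alg n ν → ℂ}
    (hΨ : IsMultiplicativeFunctional Ψ) : ∃ (φ : SBdd n) (j : Fin 2), Ψ = Phi s φ j := by
  obtain ⟨ψ, hψ0, hsplit⟩ := exists_linear_restriction hΨ.map_add hΨ.map_smul
  have hψ : ∀ f g, ψ (convL1K f g) = ψ f * ψ g := fun f g => by
    rw [hψ0, hψ0, hψ0, ← algMul_functions]
    exact hΨ.map_mul _ _
  have hop : ∀ A B : T1K n ν, ∃ h : L1K n, onG h =ᵐ[muG n] opConv (A : Op n ν) B ∧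
      Ψ (0, A) * Ψ (0, B) = ψ h := fun A B => by
    obtain ⟨h, h1, h2⟩ := algMul_operators A B
    exact ⟨h, h1, by rw [hψ0, ← h2]; exact (hΨ.map_mul _ _).symm⟩
  -- If the restriction to functions were zero, every `Ψ(0, A)` would have square zero.
  have hne : ψ ≠ 0 := fun h0 => by
    obtain ⟨⟨f, A⟩, ha⟩ := hΨ.ne_zero
    obtain ⟨h, -, h2⟩ := hop A A
    rw [h0, LinearMap.zero_apply] at h2
    rw [hsplit, h0, LinearMap.zero_apply, zero_add] at ha
    exact ha (mul_self_eq_zero.mp h2)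
  obtain ⟨φ, hφ⟩ := exists_spherical ψ hψ hne
  have hs0 : s φ ≠ 0 := fun h0 => hHat_ne_zero (ν := ν) φ (by rw [← hs, h0]; simp)
  have hop' : ∀ A B : T1K n ν, Ψ (0, A) * Ψ (0, B) =
      sphTransform (opConv (A : Op n ν) B) φ := fun A B => by
    obtain ⟨h, h1, h2⟩ := hop A B
    rw [h2, hφ, sphTransform_congr h1]
  let p : T1K n ν := ⟨P0 n ν, P0_mem_T1K⟩
  have hp : Ψ (0, p) ^ 2 = s φ ^ 2 := by
    rw [pow_two, hop', hs, hHat, ← opConv_P0_P0]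
  -- The value on `P₀` is one of the two square roots of `ĥ_ν(φ)`.
  obtain ⟨j, hj⟩ : ∃ j : Fin 2, Ψ (0, p) = (-1) ^ (j : ℕ) * s φ := by
    rcases sq_eq_sq_iff_eq_or_eq_neg.mp hp with h | h
    · exact ⟨0, by simp [h]⟩
    · exact ⟨1, by simp [h]⟩
  refine ⟨φ, j, funext fun a => ?_⟩
  obtain ⟨f, A⟩ := a
  have hA := hop' A p
  rw [hj] at hA
  have hε : ((-1 : ℂ) ^ (j : ℕ)) * (-1) ^ (j : ℕ) = 1 := by
    rw [← mul_pow]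
    simp
  rw [hsplit, hφ, Phi]
  congr 1
  change Ψ (0, A) = (-1) ^ (j : ℕ) * (sphTransform (opConv (A : Op n ν) (P0 n ν)) φ / s φ)
  rw [← hA]
  field_simp
  linear_combination -(Ψ (0, A)) * hε

end Classification

end BergmanQHA

end
theorem mainTheorem4 (n : ℕ) (hn : 1 ≤ n) (ν : ℝ) (hν : (n : ℝ) < ν)
    (s : BergmanQHA.SBdd n → ℂ) (hs : ∀ φ, s φ ^ 2 = BergmanQHA.hHat n ν φ) :
    (∀ φ, s φ ≠ 0) ∧
    (∀ (φ : BergmanQHA.SBdd n) (j : Fin 2),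
      BergmanQHA.IsMultiplicativeFunctional
        (BergmanQHA.Phi s φ j : BergmanQHA.Alg n ν → ℂ) ∧
      ∃ C : ℝ, ∀ a : BergmanQHA.Alg n ν,
        ‖BergmanQHA.Phi s φ j a‖ ≤ C * BergmanQHA.algNorm a) ∧
    (∀ Ψ : BergmanQHA.Alg n ν → ℂ, BergmanQHA.IsMultiplicativeFunctional Ψ →
      ∃ (φ : BergmanQHA.SBdd n) (j : Fin 2), Ψ = BergmanQHA.Phi s φ j) ∧
    (∀ (φ : BergmanQHA.SBdd n) (j : Fin 2) (f : BergmanQHA.L1K n) (A : BergmanQHA.T1K n ν),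
      BergmanQHA.Phi s φ j (f, A) =
        BergmanQHA.sphTransform (BergmanQHA.onG f) φ +
          (-1) ^ (j : ℕ) *
            BergmanQHA.trace ((A : BergmanQHA.Op n ν) ∘L BergmanQHA.TOp n ν s φ)) ∧
    (∀ φ : BergmanQHA.SBdd n,
      BergmanQHA.IsRadialOp (BergmanQHA.TOp n ν s φ) ∧
      ∀ (m : ℕ) (e : BergmanQHA.E n), ‖e‖ = 1 →
        ∀ g : BergmanQHA.bergman n ν, BergmanQHA.IsHomogeneousPoly m g →
          BergmanQHA.TOp n ν s φ g =
            (((n.factorial * Real.Gamma (m + ν) /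
                  (Real.Gamma ν * (n + m - 1).factorial) : ℝ) : ℂ) / s φ *
              ∫ r in (0 : ℝ)..1, BergmanQHA.onBall φ.1 ((Real.sqrt r : ℂ) • e) *
                ((r ^ (n + m - 1) * (1 - r) ^ (ν - n - 1) : ℝ) : ℂ)) • g) := by
  have := Fact.mk hn
  have := Fact.mk hν
  have h0 : ∀ φ, s φ ≠ 0 := fun φ h =>
    BergmanQHA.hHat_ne_zero (ν := ν) φ (by rw [← hs, h, zero_pow two_ne_zero])
  exact ⟨h0,
    fun φ j => ⟨BergmanQHA.isMultiplicativeFunctional_Phi hs φ (h0 φ) j,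
      BergmanQHA.exists_bound_Phi s φ j⟩,
    fun _ hΨ => BergmanQHA.exists_eq_Phi hs hΨ,
    BergmanQHA.Phi_eq_trace s,
    fun φ => ⟨BergmanQHA.isRadialOp_TOp s φ, fun _ _ he _ hg =>
      BergmanQHA.TOp_apply_of_isHomogeneousPoly s φ he hg⟩⟩
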